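/- Let $N\ge 1$ and let $\mathcal R\subset\mathbb R^N$ be a (possibly empty) root system: a finite set of vectors with $\|\alpha\|^2=2$ that satisfies $-\alpha\in\mathcal R$, $\mathbb R\alpha\cap\mathcal R=\{\pm\alpha\}$ and $\sigma_\alpha(\mathcal R)=\mathcal R$ for all $\alpha\in\mathcal R$, where $\sigma_\alpha$ is the orthogonal reflection in $\alpha^\perp$. Let $\mu:\mathcal R\to[0,\infty)$ be invariant under the group generated by the $\sigma_\alpha$. Let $E_\mu:\mathbb C^N\times\mathbb C^N\to\mathbb C$ be the Dunkl kernel, that is, the entire function with $E_\mu(0,y)=1$ and $T_\xi^xE_\mu(x,y)=\langle\xi,y\rangle E_\mu(x,y)$ for $x,y,\xi\in\mathbb R^N$, where $$T_\xi f(x)=\partial_\xi f(x)+\tfrac12\sum_{\alpha\in\mathcal R}\mu(\alpha)\frac{\langle\alpha,\xi\rangle}{\langle\alpha,x\rangle}\big(f(x)-f(\sigma_\alpha x)\big)$$ (with the quotient extended continuously to $\langle\alpha,x\rangle=0$). For $t>0$ put $$\gamma_\mu=\tfrac12\sum_{\alpha\in\mathcal R}\mu(\alpha),\qquad \tilde\omega_{\mu,t}(x)=t^{-(\gamma_\mu+N/2)}\prod_{\alpha\in\mathcal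 R}|\langle\alpha,x\rangle|^{\mu(\alpha)},$$ $$c_\mu=\int_{\mathbb R^N}e^{-\|x\|^2/2}\,\tilde\omega_{\mu,1}(x)\,dx,\qquad \omega_{\mu,t}=c_\mu^{-1}\tilde\omega_{\mu,t},$$ and use the same symbols for the measures on $\mathbb R^N$ with these densities with respect to Lebesgue measure. Let $\mathcal B_{\mu,1}$ be the Hilbert space of functions on $\mathbb C^N$ with reproducing kernel $K_w(z)=E_\mu(\bar w,z)$ (this kernel is positive semidefinite). With $z^2=\sum_j z_j^2$, let $A_{\mu,1}:L^2(\omega_{\mu,1})\to\mathcal B_{\mu,1}$ and $BSO:L^2(\tilde\omega_{\mu,1})\to\mathcal B_{\mu,1}$ be the bounded operators given by the (absolutely convergent) integrals $$A_{\mu,1}\psi(z)=\int_{\mathbb R^N} e^{-z^2/2-\|q\|^2/4}E_\mu(z,q)\,\psi(q)\,d\omega_{\mu,1}(q),$$ $$BSO\,\varphi(z)=\int_{\mathbb R^N} 2^{\gamma_\mu+N/2}c_\mu^{-1/2}e^{-z^2/2-\|y\|^2}E_\mu(\sqrt2\,y,\sqrt2\,z)\,\varphi(y)\,d\tilde\omega_{\mu,1}(y),$$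 the latter being the Segal–Bargmann transform of Ben Saïd and Ørsted. Then the rescaling $R\varphi=c_\mu^{1/2}2^{-(\gamma_\mu+N/2)}\varphi$ is a unitary isomorphism $L^2(\tilde\omega_{\mu,1})\to L^2(\omega_{\mu,1/4})$, the dilation $\delta_{1/2}\psi(x)=\psi(x/2)$ is a unitary isomorphism $L^2(\omega_{\mu,1/4})\to L^2(\omega_{\mu,1})$, the operators $A_{\mu,1}$ and $BSO$ are well defined with values in $\mathcal B_{\mu,1}$, and $$BSO=A_{\mu,1}\,\delta_{1/2}\,R .$$ So $BSO$ and $A_{\mu,1}$ differ by the unitary isomorphism $\delta_{1/2}R:L^2(\tilde\omega_{\mu,1})\to L^2(\omega_{\mu,1})$, a rescaling followed by a dilation on configuration space. -/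

import Mathlib

open MeasureTheory
open scoped RealInnerProductSpace

noncomputable section

namespace Dunkl

/-- The configuration space `ℝ^N` with its Euclidean structure. -/
abbrev ConfigSpace (N : ℕ) : Type := EuclideanSpace ℝ (Fin N)

/-- The phase space `ℂ^N`. -/
abbrev PhaseSpace (N : ℕ) : Type := EuclideanSpace ℂ (Fin N)

/-- The inclusion of `ℝ^N` in `ℂ^N`. -/
def toPhase {N : ℕ} (x : ConfigSpace N) : PhaseSpace N :=
  WithLp.toLp 2 fun j => (x j : ℂ)

/-- The componentwise complex conjugate of a point of `ℂ^N`. -/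
def conjPhase {N : ℕ} (z : PhaseSpace N) : PhaseSpace N :=
  WithLp.toLp 2 fun j => (starRingEnd ℂ) (z j)

/-- The holomorphic square `z² = ∑ⱼ zⱼ²` on `ℂ^N`. -/
def holoSq {N : ℕ} (z : PhaseSpace N) : ℂ := ∑ j, z j ^ 2

/-- The orthogonal reflection `σ_α` in the hyperplane orthogonal to `α`. -/
def refl {N : ℕ} (α : ConfigSpace N) : ConfigSpace N ≃ₗᵢ[ℝ] ConfigSpace N :=
  (Submodule.span ℝ {α})ᗮ.reflection

/-- Root systems in `ℝ^N`: finite sets of non-zero vectors, normalized by `‖α‖² = 2`. The empty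
set is allowed, and the roots need not span `ℝ^N`. -/
structure IsRootSystem {N : ℕ} (𝓡 : Finset (ConfigSpace N)) : Prop where
  ne_zero : ∀ α ∈ 𝓡, α ≠ 0
  neg_mem : ∀ α ∈ 𝓡, -α ∈ 𝓡
  eq_one_or_neg_one : ∀ α ∈ 𝓡, ∀ r : ℝ, r • α ∈ 𝓡 → r = 1 ∨ r = -1
  image_refl : ∀ α ∈ 𝓡, (refl α) '' (𝓡 : Set (ConfigSpace N)) = 𝓡
  norm_sq : ∀ α ∈ 𝓡, ‖α‖ ^ 2 = 2

/-- The Coxeter group `G(𝓡)`, generated by the reflections in the roots. -/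
def coxeterGroup {N : ℕ} (𝓡 : Finset (ConfigSpace N)) :
    Subgroup (ConfigSpace N ≃ₗᵢ[ℝ] ConfigSpace N) :=
  Subgroup.closure (refl '' (𝓡 : Set (ConfigSpace N)))

/-- Non-negative multiplicity functions on `𝓡`. Only the values of `μ` on `𝓡` are ever used. -/
structure IsMultiplicity {N : ℕ} (𝓡 : Finset (ConfigSpace N)) (μ : ConfigSpace N → ℝ) : Prop where
  invariant : ∀ g ∈ coxeterGroup 𝓡, ∀ α ∈ 𝓡, μ (g α) = μ α
  nonneg : ∀ α ∈ 𝓡, 0 ≤ μ α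

/-- The quotient `(f(x) - f(σ_α x)) / ⟨α, x⟩` of a `C¹` function `f`, with its continuous extension
`∂_α f(x)` to the hyperplane `⟨α, x⟩ = 0` (here `‖α‖² = 2`, so `σ_α x = x - ⟨α, x⟩ α`). -/
def diffQuot {N : ℕ} (α : ConfigSpace N) (f : ConfigSpace N → ℂ) (x : ConfigSpace N) : ℂ :=
  open Classical in
  if ⟪α, x⟫ = 0 then fderiv ℝ f x α else (f x - f (refl α x)) / (⟪α, x⟫ : ℂ)

/-- The Dunkl operator `T_{ξ,μ}`, with the sum written over all roots with the factor `1/2`. -/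
def dunklOp {N : ℕ} (𝓡 : Finset (ConfigSpace N)) (μ : ConfigSpace N → ℝ) (ξ : ConfigSpace N)
    (f : ConfigSpace N → ℂ) (x : ConfigSpace N) : ℂ :=
  fderiv ℝ f x ξ + (1 / 2 : ℂ) * ∑ α ∈ 𝓡, (μ α : ℂ) * (⟪α, ξ⟫ : ℂ) * diffQuot α f x

/-- `E` is the holomorphic extension to `ℂ^N × ℂ^N` of a solution on `ℝ^N × ℝ^N` of the joint
eigenvalue problem `T_ξ^x E(x,y) = ⟨ξ,y⟩ E(x,y)`, `E(0,y) = 1`. -/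
structure IsDunklKernel {N : ℕ} (𝓡 : Finset (ConfigSpace N)) (μ : ConfigSpace N → ℝ)
    (E : PhaseSpace N → PhaseSpace N → ℂ) : Prop where
  holomorphic : Differentiable ℂ fun p : PhaseSpace N × PhaseSpace N => E p.1 p.2
  eigen : ∀ ξ x y : ConfigSpace N,
    dunklOp 𝓡 μ ξ (fun x' => E (toPhase x') (toPhase y)) x =
      (⟪ξ, y⟫ : ℂ) * E (toPhase x) (toPhase y)
  at_zero : ∀ y : ConfigSpace N, E 0 (toPhase y) = 1

open Classical in
/-- The Dunkl kernel `E_μ : ℂ^N × ℂ^N → ℂ`. For a root system and a non-negative multiplicity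
function it is the one and only function satisfying `IsDunklKernel`. -/
def dunklKernel {N : ℕ} (𝓡 : Finset (ConfigSpace N)) (μ : ConfigSpace N → ℝ) :
    PhaseSpace N → PhaseSpace N → ℂ :=
  if h : ∃ E, IsDunklKernel 𝓡 μ E then h.choose else 0

/-- `γ_μ`, half of the sum of `μ` over all roots. -/
def gammaConst {N : ℕ} (𝓡 : Finset (ConfigSpace N)) (μ : ConfigSpace N → ℝ) : ℝ :=
  (1 / 2) * ∑ α ∈ 𝓡, μ α

/-- The weight `ω̃_{μ,t}`. -/
def weightTilde {N : ℕ} (𝓡 : Finset (ConfigSpace N)) (μ : ConfigSpace N → ℝ) (t : ℝ)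
    (x : ConfigSpace N) : ℝ :=
  t ^ (-(gammaConst 𝓡 μ + N / 2)) * ∏ α ∈ 𝓡, |⟪α, x⟫| ^ (μ α)

/-- The measure `dω̃_{μ,t}(x) = ω̃_{μ,t}(x) dx`. -/
def measureTilde {N : ℕ} (𝓡 : Finset (ConfigSpace N)) (μ : ConfigSpace N → ℝ) (t : ℝ) :
    Measure (ConfigSpace N) :=
  volume.withDensity fun x => ENNReal.ofReal (weightTilde 𝓡 μ t x)

/-- The Macdonald-Mehta-Selberg constant `c_μ = c_{μ,1}`. -/
def mehtaConst {N : ℕ} (𝓡 : Finset (ConfigSpace N)) (μ : ConfigSpace N → ℝ) : ℝ :=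
  ∫ x, Real.exp (-‖x‖ ^ 2 / 2) ∂(measureTilde 𝓡 μ 1)

/-- The normalized weight `ω_{μ,t} = c_μ⁻¹ ω̃_{μ,t}`. -/
def weight {N : ℕ} (𝓡 : Finset (ConfigSpace N)) (μ : ConfigSpace N → ℝ) (t : ℝ)
    (x : ConfigSpace N) : ℝ :=
  (mehtaConst 𝓡 μ)⁻¹ * weightTilde 𝓡 μ t x

/-- The measure `dω_{μ,t}(x) = ω_{μ,t}(x) dx`. -/
def measureOmega {N : ℕ} (𝓡 : Finset (ConfigSpace N)) (μ : ConfigSpace N → ℝ) (t : ℝ) :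
    Measure (ConfigSpace N) :=
  volume.withDensity fun x => ENNReal.ofReal (weight 𝓡 μ t x)

/-- The reproducing kernel of the Segal-Bargmann space. The entry at `(z, w)` is the value at `z`
of the kernel function `K_w`, that is, (multiplication by) `E_μ(w^* / √t, z / √t)`. -/
def sbKernel {N : ℕ} (𝓡 : Finset (ConfigSpace N)) (μ : ConfigSpace N → ℝ) (t : ℝ) :
    Matrix (PhaseSpace N) (PhaseSpace N) (ℂ →L[ℂ] ℂ) :=
  Matrix.of fun z w =>
    dunklKernel 𝓡 μ (((√t : ℝ) : ℂ)⁻¹ • conjPhase w) (((√t : ℝ) : ℂ)⁻¹ • z) •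
      ContinuousLinearMap.id ℂ ℂ

/-- The Segal-Bargmann space `𝓑_{μ,t}`: the Hilbert space of functions on `ℂ^N` with the above
reproducing kernel. It is formed as soon as the kernel is positive semidefinite. -/
abbrev SegalBargmannSpace {N : ℕ} (𝓡 : Finset (ConfigSpace N)) (μ : ConfigSpace N → ℝ) (t : ℝ)
    [Fact (sbKernel 𝓡 μ t).PosSemidef] : Type :=
  RKHS.OfKernel (sbKernel 𝓡 μ t)

/-- The kernel `A_{μ,t}(z,q) = exp(-z²/2t - q²/4t) E_μ(z/√t, q/√t)`. -/
def kernelA {N : ℕ} (𝓡 : Finset (ConfigSpace N)) (μ : ConfigSpace N → ℝ) (t : ℝ)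
    (z : PhaseSpace N) (q : ConfigSpace N) : ℂ :=
  Complex.exp (-holoSq z / (2 * t) - (‖q‖ ^ 2 : ℝ) / (4 * t)) *
    dunklKernel 𝓡 μ (((√t : ℝ) : ℂ)⁻¹ • z) (((√t : ℝ) : ℂ)⁻¹ • toPhase q)

/-- The integral kernel transform `A_{μ,t}` with respect to the measure `ω_{μ,t}`. -/
def transformA {N : ℕ} (𝓡 : Finset (ConfigSpace N)) (μ : ConfigSpace N → ℝ) (t : ℝ)
    (ψ : ConfigSpace N → ℂ) (z : PhaseSpace N) : ℂ :=
  ∫ q, kernelA 𝓡 μ t z q * ψ q ∂(measureOmega 𝓡 μ t)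

/-- The kernel of the Segal-Bargmann transform of Ben Saïd and Ørsted:
`BSO(z,y) = 2^(γ_μ + N/2) c_μ^(-1/2) exp(-z²/2 - y²) E_μ(√2 y, √2 z)`. -/
def kernelBSO {N : ℕ} (𝓡 : Finset (ConfigSpace N)) (μ : ConfigSpace N → ℝ)
    (z : PhaseSpace N) (y : ConfigSpace N) : ℂ :=
  ((2 ^ (gammaConst 𝓡 μ + N / 2) * mehtaConst 𝓡 μ ^ (-(1 / 2) : ℝ) : ℝ) : ℂ) *
    Complex.exp (-holoSq z / 2 - (‖y‖ ^ 2 : ℝ)) *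
    dunklKernel 𝓡 μ (((√2 : ℝ) : ℂ) • toPhase y) (((√2 : ℝ) : ℂ) • z)

/-- The transform `BSO`, an integral kernel transform with respect to the measure `ω̃_{μ,1}`. -/
def transformBSO {N : ℕ} (𝓡 : Finset (ConfigSpace N)) (μ : ConfigSpace N → ℝ)
    (φ : ConfigSpace N → ℂ) (z : PhaseSpace N) : ℂ :=
  ∫ y, kernelBSO 𝓡 μ z y * φ y ∂(measureTilde 𝓡 μ 1)

/-- The dilation `δ_r ψ(x) = ψ(r x)`. -/
def dilation {N : ℕ} (r : ℝ) (ψ : ConfigSpace N → ℂ) (x : ConfigSpace N) : ℂ := ψ (r • x)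

/-- The rescaling `R φ = c_μ^(1/2) 2^(-(γ_μ + N/2)) φ`. -/
def rescaling {N : ℕ} (𝓡 : Finset (ConfigSpace N)) (μ : ConfigSpace N → ℝ)
    (φ : ConfigSpace N → ℂ) (x : ConfigSpace N) : ℂ :=
  ((mehtaConst 𝓡 μ ^ (1 / 2 : ℝ) * 2 ^ (-(gammaConst 𝓡 μ + N / 2)) : ℝ) : ℂ) * φ x

end Dunkl

end

namespace Dunkl

section

/-! ### A maximum principle -/

/-! Everything rests on one integral, `IsDunklKernel.integral_gaussian_mul`: with `G` the Gaussian
times the root weight, `∫ G(q) E(z,q) E(w,q) dq = c_μ exp(z²/2 + w²/2) E(z,w)`. It says that `E(w̄,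
z)` is the Gram matrix of the conjugated kernels of `A` in `L²(ω)`. Hence the kernel is positive
semidefinite. Moreover, sending the kernel function at `z` to the vector `v z` extends to a bounded
(in fact isometric) map `J` from the reproducing kernel space to `L²(ω)`, and `A` is the adjoint of
`J` (`exists_clm_of_gram`). The factorization of `BSO` is then the substitution `q = 2y`, together
with `E(√2 y, √2 z) = E(z, 2y)` and a comparison of constants (`dilation_kernelBSO`).

The properties of `E` come from its radial equation alone, `∑ xᵢ Tᵢ U = ⟨x,y⟩ U`, in which all
denominators cancel (`IsEulerSolution`). At a maximum of `‖U‖` times a radial function, the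
reflection terms have a favourable sign because `μ ≥ 0`. So `U` grows at most exponentially and is
determined by `U 0`. Symmetry, homogeneity, conjugation and equivariance of `E` all follow by
checking that two functions solve the same equation. So does the Gaussian integral: integration by
parts (`integral_inner_mul_mul`) shows that, apart from the factor `exp(z²/2)`, it solves the
equation of `E(·, w)`.

Existence of `E` is proved by a power series. The operator `∑ xᵢ Tᵢ` is invertible in each positive
degree, again by a maximum principle, so the radial equation can be solved degree by degree. That
the solution satisfies every eigenvalue equation, and not only the radial one, uses the
commutativity of the Dunkl operators (`polyDunkl_comm`) and the maximum principle once more, now in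
the pair (point, direction). -/

/-- A maximum principle for a positive multiple of the identity plus a sum of operators
`1 - σ k`, on a compact set that is stable under the maps `σ k`. -/
theorem mul_norm_le_of_mul_add_sum_sub_le {V ι : Type*} [TopologicalSpace V] {C : Set V}
    (hC : IsCompact C) {g : V → ℂ} (hg : ContinuousOn g C) (s : Finset ι) {c : ι → ℝ}
    (hc : ∀ k ∈ s, 0 ≤ c k) {σ : ι → V → V} (hσ : ∀ k ∈ s, ∀ x ∈ C, σ k x ∈ C) {n B : ℝ}
    (hn : 0 < n) (h : ∀ x ∈ C, ‖(n : ℂ) * g x + ∑ k ∈ s, (c k : ℂ) * (g x - g (σ k x))‖ ≤ B) :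
    ∀ x ∈ C, n * ‖g x‖ ≤ B := by
  rintro x hx
  obtain ⟨m, hm, hmax⟩ := hC.exists_isMaxOn ⟨x, hx⟩ hg.norm
  -- At a maximum point `m` the terms `c k * g (σ k m)` are moved to the right; their norms are at
  -- most `c k * ‖g m‖`, so the sums of the `c k` cancel.
  have key : (n + ∑ k ∈ s, c k : ℝ) * ‖g m‖ ≤ B + (∑ k ∈ s, c k) * ‖g m‖ := by
    have e : ((n + ∑ k ∈ s, c k : ℝ) : ℂ) * g m = ((n : ℂ) * g m +
        ∑ k ∈ s, (c k : ℂ) * (g m - g (σ k m))) + ∑ k ∈ s, (c k : ℂ) * g (σ k m) := by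
      simp only [mul_sub, Finset.sum_sub_distrib, ← Finset.sum_mul]
      push_cast
      ring
    have hpos : 0 ≤ n + ∑ k ∈ s, c k := add_nonneg hn.le (Finset.sum_nonneg hc)
    have e' := congrArg norm e
    rw [norm_mul, Complex.norm_real, Real.norm_of_nonneg hpos] at e'
    rw [e', Finset.sum_mul]
    refine (norm_add_le _ _).trans (add_le_add (h m hm) ((norm_sum_le _ _).trans
      (Finset.sum_le_sum fun k hk => ?_)))
    rw [norm_mul, Complex.norm_real, Real.norm_of_nonneg (hc k hk)]
    exact mul_le_mul_of_nonneg_left (hmax (hσ k hk m hm)) (hc k hk)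
  have hle : ‖g x‖ ≤ ‖g m‖ := hmax hx
  nlinarith

/-- If the radial derivative of `U` is dominated as below, then `U` grows at most exponentially. -/
theorem norm_le_mul_exp_of_radial {V ι : Type*} [NormedAddCommGroup V] [NormedSpace ℝ V]
    [ProperSpace V] {U U' b : V → ℂ} (hU : Continuous U)
    (hU' : ∀ x, HasDerivAt (fun t : ℝ => U (t • x)) (U' x) 1) (s : Finset ι) {c : ι → ℝ}
    (hc : ∀ k ∈ s, 0 ≤ c k) {σ : ι → V → V} (hσ : ∀ k ∈ s, ∀ x, ‖σ k x‖ = ‖x‖) {K : ℝ}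
    (hb : ∀ x, ‖b x‖ ≤ K * ‖x‖)
    (h : ∀ x, U' x + ∑ k ∈ s, (c k : ℂ) * (U x - U (σ k x)) = b x * U x) (x : V) :
    ‖U x‖ ≤ ‖U 0‖ * Real.exp (K * ‖x‖) := by
  -- The slack `d` makes the radial derivative strictly negative at a maximum away from the origin;
  -- it is sent to `0` at the end.
  have main : ∀ d > 0, ‖U x‖ ≤ ‖U 0‖ * Real.exp ((K + d) * ‖x‖) := by
    intro d hd
    set φ : V → ℝ := fun v => ‖U v‖ ^ 2 * Real.exp (-(2 * (K + d)) * ‖v‖) with hφ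
    have hφc : Continuous φ := by fun_prop
    obtain ⟨m, hm, hmax⟩ := (isCompact_closedBall (0 : V) ‖x‖).exists_isMaxOn
      ⟨x, by simp⟩ hφc.continuousOn
    have hmx : φ x ≤ φ m := hmax (by simp)
    have hfin : φ m ≤ ‖U 0‖ ^ 2 := by
      by_cases hUm : U m = 0
      · simp [hφ, hUm]
      by_cases hm0 : m = 0
      · simp [hφ, hm0]
      exfalso
      have hmpos : 0 < ‖m‖ := norm_pos_iff.mpr hm0
      have hUpos : 0 < ‖U m‖ := norm_pos_iff.mpr hUm
      have hder : HasDerivAt (fun t : ℝ => ‖U (t • m)‖ ^ 2 * Real.exp (-(2 * (K + d)) * (t * ‖m‖)))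
          (2 * ⟪U ((1 : ℝ) • m), U' m⟫ * Real.exp (-(2 * (K + d)) * (1 * ‖m‖)) +
            ‖U ((1 : ℝ) • m)‖ ^ 2 * (Real.exp (-(2 * (K + d)) * (1 * ‖m‖)) *
              (-(2 * (K + d)) * (1 * ‖m‖)))) 1 := by
        refine ((hU' m).norm_sq).mul ?_
        exact (((hasDerivAt_id (1 : ℝ)).mul_const ‖m‖).const_mul (-(2 * (K + d)))).exp
      have hinner : ⟪U m, U' m⟫ ≤ K * ‖m‖ * ‖U m‖ ^ 2 := by
        have e : U' m = b m * U m - ∑ k ∈ s, (c k : ℂ) * (U m - U (σ k m)) := by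
          rw [← h m]; ring
        have h1 : ⟪U m, b m * U m⟫ ≤ K * ‖m‖ * ‖U m‖ ^ 2 := by
          refine (real_inner_le_norm _ _).trans ?_
          rw [norm_mul]
          nlinarith [hb m]
        -- `σ k` preserves the norm, so maximality of `φ` at `m` gives `‖U (σ k m)‖ ≤ ‖U m‖`, and
        -- Cauchy-Schwarz gives the sign.
        have h2 : ∀ k ∈ s, 0 ≤ ⟪U m, (c k : ℂ) * (U m - U (σ k m))⟫ := by
          intro k hk
          rw [← Complex.real_smul, real_inner_smul_right, inner_sub_right,
            real_inner_self_eq_norm_sq]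
          refine mul_nonneg (hc k hk) ?_
          have h3 : φ (σ k m) ≤ φ m := hmax (by
            simpa [hσ k hk m] using hm)
          simp only [hφ, hσ k hk m] at h3
          have h4 := (mul_le_mul_iff_left₀ (Real.exp_pos _)).mp h3
          have h5 : ‖U (σ k m)‖ ≤ ‖U m‖ := (sq_le_sq₀ (norm_nonneg _) (norm_nonneg _)).mp h4
          have h6 := real_inner_le_norm (U m) (U (σ k m))
          nlinarith
        rw [e, inner_sub_right, inner_sum]
        linarith [Finset.sum_nonneg h2]
      have hneg : (2 * ⟪U ((1 : ℝ) • m), U' m⟫ * Real.exp (-(2 * (K + d)) * (1 * ‖m‖)) +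
            ‖U ((1 : ℝ) • m)‖ ^ 2 * (Real.exp (-(2 * (K + d)) * (1 * ‖m‖)) *
              (-(2 * (K + d)) * (1 * ‖m‖)))) < 0 := by
        have hx := Real.exp_pos (-(2 * (K + d)) * (1 * ‖m‖))
        simp only [one_smul] at *
        have : (2 * ⟪U m, U' m⟫ - 2 * (K + d) * ‖m‖ * ‖U m‖ ^ 2) < 0 := by
          have : 0 < d * ‖m‖ * ‖U m‖ ^ 2 := by positivity
          nlinarith
        have := mul_neg_of_neg_of_pos this hx
        nlinarith
      -- Only `t < 1` is available, since `m` may lie on the boundary of the ball. The left slopes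
      -- are then nonnegative, which already contradicts `hneg`.
      have hev : ∀ᶠ t in nhdsWithin (1 : ℝ) (Set.Iio 1),
          ‖U (t • m)‖ ^ 2 * Real.exp (-(2 * (K + d)) * (t * ‖m‖)) ≤ φ m := by
        filter_upwards [Ioo_mem_nhdsLT (show (0 : ℝ) < 1 by norm_num)] with t ht
        have hn : ‖t • m‖ = t * ‖m‖ := by rw [norm_smul, Real.norm_of_nonneg ht.1.le]
        have h3 : φ (t • m) ≤ φ m := hmax (by
          rw [mem_closedBall_zero_iff] at hm ⊢
          rw [hn]
          nlinarith [ht.2])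
        simpa only [hφ, hn] using h3
      have hslope := (hasDerivAt_iff_tendsto_slope_left_right.mp hder).1
      have hge := ge_of_tendsto hslope (b := 0) (by
        filter_upwards [hev, self_mem_nhdsWithin] with t ht ht1
        rw [slope_def_field]
        refine div_nonneg_of_nonpos ?_ (by have : t < 1 := ht1; linarith)
        have : φ m = ‖U ((1 : ℝ) • m)‖ ^ 2 * Real.exp (-(2 * (K + d)) * (1 * ‖m‖)) := by
          simp [hφ]
        linarith)
      linarith
    have h1 := hmx.trans hfin
    simp only [hφ] at h1
    have h2 : ‖U x‖ ^ 2 ≤ (‖U 0‖ * Real.exp ((K + d) * ‖x‖)) ^ 2 := by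
      have : Real.exp (-(2 * (K + d)) * ‖x‖) * Real.exp ((K + d) * ‖x‖) ^ 2 = 1 := by
        rw [← Real.exp_nat_mul, ← Real.exp_add]
        simp only [Nat.cast_ofNat, Real.exp_eq_one_iff]; ring
      have hp : 0 < Real.exp ((K + d) * ‖x‖) ^ 2 := by positivity
      calc ‖U x‖ ^ 2 = ‖U x‖ ^ 2 * Real.exp (-(2 * (K + d)) * ‖x‖) *
            Real.exp ((K + d) * ‖x‖) ^ 2 := by rw [mul_assoc, this, mul_one]
        _ ≤ ‖U 0‖ ^ 2 * Real.exp ((K + d) * ‖x‖) ^ 2 := by gcongr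
        _ = _ := by ring
    exact (sq_le_sq₀ (norm_nonneg _) (by positivity)).mp h2
  have hlim : Filter.Tendsto (fun d : ℝ => ‖U 0‖ * Real.exp ((K + d) * ‖x‖))
      (nhdsWithin 0 (Set.Ioi 0)) (nhds (‖U 0‖ * Real.exp ((K + 0) * ‖x‖))) :=
    Filter.Tendsto.mono_left (Continuous.tendsto (by fun_prop) 0) nhdsWithin_le_nhds
  rw [add_zero] at hlim
  exact ge_of_tendsto hlim (by filter_upwards [self_mem_nhdsWithin] with d hd using main d hd)

end

section

/-! ### The complexification of `ℝ^N` -/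

variable {N : ℕ}

/-- The inclusion of `ℝ^N` in `ℂ^N` as a linear isometry. -/
noncomputable def phaseEmbedding (N : ℕ) : ConfigSpace N →ₗᵢ[ℝ] PhaseSpace N where
  toFun := toPhase
  map_add' x y := by ext j; simp [toPhase]
  map_smul' c x := by ext j; simp [toPhase]
  norm_map' x := by simp [toPhase, EuclideanSpace.norm_eq]

@[simp] theorem toPhase_apply (x : ConfigSpace N) (j : Fin N) : toPhase x j = (x j : ℂ) := rfl

@[simp] theorem norm_toPhase (x : ConfigSpace N) : ‖toPhase x‖ = ‖x‖ := (phaseEmbedding N).norm_map x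

theorem toPhase_smul (c : ℝ) (x : ConfigSpace N) : toPhase (c • x) = c • toPhase x :=
  (phaseEmbedding N).map_smul c x

theorem continuous_toPhase : Continuous (toPhase (N := N)) := (phaseEmbedding N).continuous

@[simp] theorem conjPhase_apply (z : PhaseSpace N) (j : Fin N) :
    conjPhase z j = (starRingEnd ℂ) (z j) := rfl

@[simp] theorem norm_conjPhase (z : PhaseSpace N) : ‖conjPhase z‖ = ‖z‖ := by
  simp [EuclideanSpace.norm_eq]

@[simp] theorem conjPhase_conjPhase (z : PhaseSpace N) : conjPhase (conjPhase z) = z := by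
  ext j; simp

@[simp] theorem conjPhase_toPhase (x : ConfigSpace N) : conjPhase (toPhase x) = toPhase x := by
  ext j; simp

theorem conjPhase_real_smul (t : ℝ) (z : PhaseSpace N) : conjPhase (t • z) = t • conjPhase z := by
  ext j; simp

theorem continuous_conjPhase : Continuous (conjPhase (N := N)) := by
  unfold conjPhase
  fun_prop

/-- The complex bilinear extension of the inner product of `ℝ^N`. -/
noncomputable def bil (x y : PhaseSpace N) : ℂ := ∑ j, x j * y j

theorem bil_comm (x y : PhaseSpace N) : bil x y = bil y x := by simp [bil, mul_comm]

theorem bil_add_right (x y z : PhaseSpace N) : bil x (y + z) = bil x y + bil x z := by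
  simp [bil, mul_add, Finset.sum_add_distrib]

theorem bil_sub_right (x y z : PhaseSpace N) : bil x (y - z) = bil x y - bil x z := by
  simp [bil, mul_sub, Finset.sum_sub_distrib]

theorem bil_sub_left (x y z : PhaseSpace N) : bil (x - y) z = bil x z - bil y z := by
  simp [bil, sub_mul, Finset.sum_sub_distrib]

theorem bil_smul_right (c : ℂ) (x y : PhaseSpace N) : bil x (c • y) = c * bil x y := by
  simp [bil, Finset.mul_sum, mul_left_comm]

theorem bil_smul_left (c : ℂ) (x y : PhaseSpace N) : bil (c • x) y = c * bil x y := by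
  simp [bil, Finset.mul_sum, mul_assoc]

theorem bil_self (z : PhaseSpace N) : bil z z = holoSq z := by simp [bil, holoSq, sq]

theorem bil_toPhase (x y : ConfigSpace N) : bil (toPhase x) (toPhase y) = (⟪x, y⟫ : ℂ) := by
  simp [bil, PiLp.inner_apply, mul_comm]

theorem bil_conjPhase (x y : PhaseSpace N) :
    bil (conjPhase x) (conjPhase y) = (starRingEnd ℂ) (bil x y) := by
  simp [bil]

theorem bil_eq_inner (x y : PhaseSpace N) : bil x y = inner ℂ (conjPhase x) y := by
  simp [bil, PiLp.inner_apply, mul_comm]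

theorem norm_bil_le (x y : PhaseSpace N) : ‖bil x y‖ ≤ ‖x‖ * ‖y‖ := by
  rw [bil_eq_inner, ← norm_conjPhase x]
  exact norm_inner_le_norm _ _

theorem differentiable_bil : Differentiable ℂ fun p : PhaseSpace N × PhaseSpace N => bil p.1 p.2 := by
  unfold bil
  fun_prop

theorem differentiable_bil_right (x : PhaseSpace N) : Differentiable ℂ fun y => bil x y := by
  unfold bil
  fun_prop

theorem differentiable_holoSq : Differentiable ℂ (holoSq (N := N)) := by
  unfold holoSq
  fun_prop

/-- The complex linear extension of the reflection `σ_α`, for `‖α‖² = 2`. -/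
noncomputable def phaseRefl (α : ConfigSpace N) (z : PhaseSpace N) : PhaseSpace N :=
  z - bil (toPhase α) z • toPhase α

theorem differentiable_phaseRefl (α : ConfigSpace N) : Differentiable ℂ (phaseRefl α) :=
  differentiable_id.sub ((differentiable_bil_right _).smul_const _)

theorem phaseRefl_smul (α : ConfigSpace N) (c : ℂ) (z : PhaseSpace N) :
    phaseRefl α (c • z) = c • phaseRefl α z := by
  simp [phaseRefl, bil_smul_right, smul_sub, mul_smul]

theorem phaseRefl_real_smul (α : ConfigSpace N) (c : ℝ) (z : PhaseSpace N) :
    phaseRefl α (c • z) = c • phaseRefl α z := phaseRefl_smul α (c : ℂ) z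

theorem phaseRefl_zero (α : ConfigSpace N) : phaseRefl α 0 = 0 := by
  simpa using phaseRefl_smul α 0 0

theorem phaseRefl_conjPhase (α : ConfigSpace N) (z : PhaseSpace N) :
    phaseRefl α (conjPhase z) = conjPhase (phaseRefl α z) := by
  have h : bil (toPhase α) (conjPhase z) = (starRingEnd ℂ) (bil (toPhase α) z) := by
    rw [← bil_conjPhase, conjPhase_toPhase]
  ext j
  simp [phaseRefl, h]

theorem bil_phaseRefl_left (α : ConfigSpace N) (z w : PhaseSpace N) :
    bil (phaseRefl α z) w = bil z (phaseRefl α w) := by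
  rw [phaseRefl, phaseRefl, bil_sub_left, bil_sub_right, bil_smul_left, bil_smul_right,
    bil_comm z (toPhase α)]
  ring

theorem refl_apply {α : ConfigSpace N} (hα : ‖α‖ ^ 2 = 2) (x : ConfigSpace N) :
    refl α x = x - ⟪α, x⟫ • α := by
  rw [refl, Submodule.reflection_orthogonal_apply, Submodule.reflection_singleton_apply]
  simp only [RCLike.ofReal_real_eq_id, id_eq, hα, neg_sub]
  rw [← Nat.cast_smul_eq_nsmul ℝ, smul_smul]
  congr 2
  push_cast; ring

theorem toPhase_refl {α : ConfigSpace N} (hα : ‖α‖ ^ 2 = 2) (x : ConfigSpace N) :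
    toPhase (refl α x) = phaseRefl α (toPhase x) := by
  rw [refl_apply hα, phaseRefl, bil_toPhase]
  ext j
  simp

theorem phaseRefl_phaseRefl {α : ConfigSpace N} (hα : ‖α‖ ^ 2 = 2) (z : PhaseSpace N) :
    phaseRefl α (phaseRefl α z) = z := by
  have h2 : bil (toPhase α) (toPhase α) = 2 := by
    rw [bil_toPhase, real_inner_self_eq_norm_sq, hα]; norm_num
  simp only [phaseRefl, bil_sub_right, bil_smul_right, h2]
  ext j
  simp
  ring

@[simp] theorem norm_phaseRefl {α : ConfigSpace N} (hα : ‖α‖ ^ 2 = 2) (z : PhaseSpace N) :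
    ‖phaseRefl α z‖ = ‖z‖ := by
  have h : inner ℂ (phaseRefl α z) (phaseRefl α z) = inner ℂ z z := by
    rw [← conjPhase_conjPhase (phaseRefl α z), ← bil_eq_inner, conjPhase_conjPhase,
      ← phaseRefl_conjPhase, bil_phaseRefl_left, phaseRefl_phaseRefl hα, bil_eq_inner,
      conjPhase_conjPhase]
  rw [inner_self_eq_norm_sq_to_K, inner_self_eq_norm_sq_to_K] at h
  have h' : ‖phaseRefl α z‖ ^ 2 = ‖z‖ ^ 2 := by exact_mod_cast h
  exact (pow_left_inj₀ (norm_nonneg _) (norm_nonneg _) two_ne_zero).mp h'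

theorem bil_phaseRefl_phaseRefl {α : ConfigSpace N} (hα : ‖α‖ ^ 2 = 2) (z w : PhaseSpace N) :
    bil (phaseRefl α z) (phaseRefl α w) = bil z w := by
  rw [bil_phaseRefl_left, phaseRefl_phaseRefl hα]

theorem holoSq_phaseRefl {α : ConfigSpace N} (hα : ‖α‖ ^ 2 = 2) (z : PhaseSpace N) :
    holoSq (phaseRefl α z) = holoSq z := by
  rw [← bil_self, bil_phaseRefl_phaseRefl hα, bil_self]

/-- Invariance of the bilinear form under `σ_α` gives this conjugation rule, which permits
reindexing sums over the roots by `β ↦ σ_α β`. -/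
theorem phaseRefl_conj {α : ConfigSpace N} (hα : ‖α‖ ^ 2 = 2) (β : ConfigSpace N)
    (z : PhaseSpace N) : phaseRefl α (phaseRefl β z) = phaseRefl (refl α β) (phaseRefl α z) := by
  have h : bil (toPhase (refl α β)) (phaseRefl α z) = bil (toPhase β) z := by
    rw [toPhase_refl hα, bil_phaseRefl_phaseRefl hα]
  conv_rhs => rw [phaseRefl, h, toPhase_refl hα]
  conv_lhs => rw [phaseRefl.eq_1 β]
  simp only [phaseRefl, bil_sub_right, bil_smul_right]
  ext j
  simp
  ring

theorem fderiv_comp_toPhase {f : PhaseSpace N → ℂ} (hf : Differentiable ℂ f)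
    (x v : ConfigSpace N) :
    fderiv ℝ (fun x => f (toPhase x)) x v = fderiv ℂ f (toPhase x) (toPhase v) := by
  have h1 := (hf (toPhase x)).hasFDerivAt.restrictScalars ℝ
  have h2 := (phaseEmbedding N).toContinuousLinearMap.hasFDerivAt (x := x)
  have h3 := HasFDerivAt.comp x (f := toPhase) h1 h2
  rw [show (fun x => f (toPhase x)) = f ∘ toPhase from rfl, h3.fderiv]
  rfl

/-! ### Entire functions vanishing on the real points -/

/-- Derivatives of entire functions of two variables are holomorphic in the parameter. -/
theorem differentiable_deriv_with_param {G : ℂ × ℂ → ℂ} (hG : Differentiable ℂ G) :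
    Differentiable ℂ fun t => deriv (fun s => G (t, s)) 0 := by
  have hs : ∀ t, Differentiable ℂ fun s => G (t, s) := fun t =>
    hG.comp ((differentiable_const t).prodMk differentiable_id)
  have ht : ∀ s, Differentiable ℂ fun t => G (t, s) := fun s =>
    hG.comp (differentiable_id.prodMk (differentiable_const s))
  -- Cauchy's formula on the unit circle replaces the derivative in `s` by an integral of values of
  -- `G`, which can be differentiated in `t` under the integral sign.
  have hint : (fun t => deriv (fun s => G (t, s)) 0) = fun t =>
      (2 * Real.pi * Complex.I : ℂ)⁻¹ • ∫ θ in (0 : ℝ)..2 * Real.pi,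
        (deriv (circleMap 0 1) θ * ((circleMap 0 1 θ - 0) ^ 2)⁻¹) * G (t, circleMap 0 1 θ) := by
    funext t
    have h := DifferentiableOn.deriv_eq_smul_circleIntegral (c := 0) one_pos
      (hs t).differentiableOn
    rw [circleIntegral] at h
    simp only [smul_eq_mul, ← mul_assoc, one_div] at h
    rw [h, smul_eq_mul, inv_mul_cancel_left₀ Complex.two_pi_I_ne_zero]
  rw [hint]
  intro t₀
  refine DifferentiableAt.fun_const_smul ?_ _
  -- Radius `2` leaves room for unit circles around all points `t` of the unit ball at `t₀`, where
  -- Cauchy's estimate bounds the derivative in `t` by `M`.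
  obtain ⟨M, hM⟩ := ((isCompact_closedBall t₀ 2).prod (isCompact_closedBall (0 : ℂ) 1)
    ).exists_bound_of_continuousOn hG.continuous.continuousOn
  have hk : Continuous fun θ : ℝ => deriv (circleMap 0 1) θ * ((circleMap 0 1 θ - 0) ^ 2)⁻¹ := by
    simp only [deriv_circleMap, sub_zero]
    refine ((continuous_circleMap 0 1).mul continuous_const).mul (Continuous.inv₀ ?_ ?_)
    · exact (continuous_circleMap 0 1).pow 2
    · intro θ
      simp
  have hnk : ∀ θ : ℝ, ‖deriv (circleMap 0 1) θ * ((circleMap 0 1 θ - 0) ^ 2)⁻¹‖ = 1 := by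
    intro θ
    simp [deriv_circleMap]
  refine (intervalIntegral.hasDerivAt_integral_of_dominated_loc_of_deriv_le
    (F' := fun t θ => deriv (circleMap 0 1) θ * ((circleMap 0 1 θ - 0) ^ 2)⁻¹ *
      deriv (fun t => G (t, circleMap 0 1 θ)) t) (bound := fun _ => M)
    (Metric.ball_mem_nhds t₀ one_pos) ?_ ?_ ?_ ?_ ?_ ?_).2.differentiableAt
  · refine Filter.Eventually.of_forall fun t => Continuous.aestronglyMeasurable ?_
    exact hk.mul (hG.continuous.comp (by fun_prop))
  · refine Continuous.intervalIntegrable ?_ _ _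
    exact hk.mul (hG.continuous.comp (by fun_prop))
  · refine hk.aestronglyMeasurable.mul ?_
    have h1 : Continuous (Function.uncurry fun (θ : ℝ) (t : ℂ) => G (t, circleMap 0 1 θ)) :=
      hG.continuous.comp (by fun_prop)
    exact ((measurable_deriv_with_param h1).comp
      (measurable_id.prodMk measurable_const)).aestronglyMeasurable
  · refine Filter.Eventually.of_forall fun θ _ t htb => ?_
    rw [norm_mul, hnk, one_mul]
    have := Complex.norm_deriv_le_of_forall_mem_sphere_norm_le (C := M) one_pos
      (ht (circleMap 0 1 θ)).diffContOnCl (c := t) fun z hz => hM _ ⟨?_, ?_⟩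
    · simpa using this
    · rw [mem_sphere_iff_norm] at hz
      rw [Metric.mem_ball, dist_eq_norm] at htb
      rw [mem_closedBall_iff_norm]
      calc ‖z - t₀‖ = ‖(z - t) + (t - t₀)‖ := by congr 1; ring
        _ ≤ _ := by linarith [norm_add_le (z - t) (t - t₀)]
    · simp
  · exact intervalIntegrable_const
  · refine Filter.Eventually.of_forall fun θ _ t _ => ?_
    exact ((ht _ t).hasDerivAt).const_mul _

/-- The value is the derivative at `s = 0` of `f (q t + s • w t)`, an entire function of two complex
variables, so the scalar case applies. -/
theorem differentiable_fderiv_apply {V : Type*} [NormedAddCommGroup V] [NormedSpace ℂ V]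
    {f : V → ℂ} (hf : Differentiable ℂ f) {q w : ℂ → V} (hq : Differentiable ℂ q)
    (hw : Differentiable ℂ w) : Differentiable ℂ fun t => fderiv ℂ f (q t) (w t) := by
  have h := differentiable_deriv_with_param (G := fun p => f (q p.1 + p.2 • w p.1))
    (hf.comp ((hq.comp differentiable_fst).add
      (differentiable_snd.smul (hw.comp differentiable_fst))))
  convert h using 2 with t
  have h1 : HasDerivAt (fun s : ℂ => q t + s • w t) (w t) 0 := by
    simpa using ((hasDerivAt_id (0 : ℂ)).smul_const (w t)).const_add (q t)
  have h2 := (hf (q t + (0 : ℂ) • w t)).hasFDerivAt.comp_hasDerivAt (0 : ℂ) h1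
  rw [zero_smul, add_zero] at h2
  exact h2.deriv.symm

/-- A function on `ℂ^N × ℂ^N`, holomorphic along holomorphic curves, that vanishes at the real
points is zero. -/
theorem eq_zero_of_differentiable_of_toPhase {f : PhaseSpace N × PhaseSpace N → ℂ}
    (hf : ∀ q : ℂ → PhaseSpace N × PhaseSpace N, Differentiable ℂ q → Differentiable ℂ (f ∘ q))
    (h : ∀ x y, f (toPhase x, toPhase y) = 0)
    (p : PhaseSpace N × PhaseSpace N) : f p = 0 := by
  let re (z : PhaseSpace N) : ConfigSpace N := WithLp.toLp 2 fun j => (z j).re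
  let im (z : PhaseSpace N) : ConfigSpace N := WithLp.toLp 2 fun j => (z j).im
  -- This complex line takes real `t` to real points and `t = i` to `p`, so the identity theorem in
  -- one variable suffices.
  let q (t : ℂ) : PhaseSpace N × PhaseSpace N :=
    (toPhase (re p.1) + t • toPhase (im p.1), toPhase (re p.2) + t • toPhase (im p.2))
  have hq : Differentiable ℂ fun t => f (q t) := hf q (by fun_prop)
  have hqI : q Complex.I = p := by
    refine Prod.ext ?_ ?_ <;>
    · ext j
      simp [q, re, im, mul_comm Complex.I, Complex.re_add_im]
  have hreal : ∀ t : ℝ, f (q t) = 0 := by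
    intro t
    rw [← h (re p.1 + t • im p.1) (re p.2 + t • im p.2)]
    congr 1
    refine Prod.ext ?_ ?_ <;>
    · ext j
      simp [q]
  have hzero : (fun t => f (q t)) = 0 := by
    refine AnalyticOnNhd.eq_of_frequently_eq (z₀ := 0) (hq.differentiableOn.analyticOnNhd isOpen_univ)
      analyticOnNhd_const ?_
    have hfr : ∃ᶠ t : ℝ in nhdsWithin 0 {0}ᶜ, f (q t) = 0 :=
      Filter.Frequently.of_forall hreal
    have ht : Filter.Tendsto (fun t : ℝ => (t : ℂ)) (nhdsWithin 0 {0}ᶜ) (nhdsWithin 0 {0}ᶜ) := by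
      refine tendsto_nhdsWithin_of_tendsto_nhds_of_eventually_within _ ?_ ?_
      · exact (Complex.continuous_ofReal.tendsto' 0 0 (by simp)).mono_left nhdsWithin_le_nhds
      · filter_upwards [self_mem_nhdsWithin] with t ht
        simpa using ht
    exact ht.frequently hfr
  rw [← hqI]
  exact congrFun hzero Complex.I

/-! ### The Euler equation of the Dunkl kernel -/

variable {𝓡 : Finset (ConfigSpace N)} {μ : ConfigSpace N → ℝ}

/-- The radial part `∑ᵢ xᵢ T_i U = b U` of the eigenvalue problem of the Dunkl operators. -/
structure IsEulerSolution (𝓡 : Finset (ConfigSpace N)) (μ : ConfigSpace N → ℝ)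
    (b U : PhaseSpace N → ℂ) : Prop where
  continuous : Continuous U
  hasDerivAt : ∀ x, HasDerivAt (fun t : ℝ => U (t • x))
    (b x * U x - ∑ α ∈ 𝓡, ((μ α / 2 : ℝ) : ℂ) * (U x - U (phaseRefl α x))) 1

namespace IsEulerSolution

variable {b U U' : PhaseSpace N → ℂ}

theorem norm_le (h𝓡 : IsRootSystem 𝓡) (hμ : IsMultiplicity 𝓡 μ) (h : IsEulerSolution 𝓡 μ b U)
    {K : ℝ} (hb : ∀ x, ‖b x‖ ≤ K * ‖x‖) (x : PhaseSpace N) :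
    ‖U x‖ ≤ ‖U 0‖ * Real.exp (K * ‖x‖) :=
  norm_le_mul_exp_of_radial h.continuous h.hasDerivAt 𝓡
    (fun α hα => div_nonneg (hμ.nonneg α hα) zero_le_two)
    (fun α hα x => norm_phaseRefl (h𝓡.norm_sq α hα) x) hb (fun x => by ring) x

theorem sub (h : IsEulerSolution 𝓡 μ b U) (h' : IsEulerSolution 𝓡 μ b U') :
    IsEulerSolution 𝓡 μ b (U - U') where
  continuous := h.continuous.sub h'.continuous
  hasDerivAt x := by
    refine ((h.hasDerivAt x).sub (h'.hasDerivAt x)).congr_deriv ?_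
    rw [sub_sub_sub_comm, ← Finset.sum_sub_distrib]
    simp only [Pi.sub_apply, mul_sub]
    congr 1
    refine Finset.sum_congr rfl fun α _ => ?_
    ring

theorem const_mul (c : ℂ) (h : IsEulerSolution 𝓡 μ b U) :
    IsEulerSolution 𝓡 μ b (fun x => c * U x) where
  continuous := h.continuous.const_mul c
  hasDerivAt x := by
    refine ((h.hasDerivAt x).const_mul c).congr_deriv ?_
    rw [mul_sub, Finset.mul_sum]
    congr 1
    · ring
    · refine Finset.sum_congr rfl fun α _ => ?_
      ring

/-- Solutions of the Euler equation are determined by their value at the origin. -/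
theorem unique (h𝓡 : IsRootSystem 𝓡) (hμ : IsMultiplicity 𝓡 μ) (h : IsEulerSolution 𝓡 μ b U)
    (h' : IsEulerSolution 𝓡 μ b U') {K : ℝ} (hb : ∀ x, ‖b x‖ ≤ K * ‖x‖) (h0 : U 0 = U' 0) :
    U = U' := by
  funext x
  have := (h.sub h').norm_le h𝓡 hμ hb x
  simp only [Pi.sub_apply, h0, sub_self, norm_zero, zero_mul, norm_le_zero_iff] at this
  exact sub_eq_zero.mp this

end IsEulerSolution

/-- This also holds on the hyperplane, where both sides vanish. It is the reason why the radial
equation contains no denominators. -/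
theorem inner_mul_diffQuot {α : ConfigSpace N} (hα : ‖α‖ ^ 2 = 2) (f : ConfigSpace N → ℂ)
    (x : ConfigSpace N) : (⟪α, x⟫ : ℂ) * diffQuot α f x = f x - f (refl α x) := by
  unfold diffQuot
  split_ifs with h
  · simp [refl_apply hα, h]
  · have : (⟪α, x⟫ : ℂ) ≠ 0 := by exact_mod_cast h
    field_simp

namespace IsDunklKernel

variable {E : PhaseSpace N → PhaseSpace N → ℂ}

theorem differentiable_fst (hE : IsDunklKernel 𝓡 μ E) (y : PhaseSpace N) :
    Differentiable ℂ fun x => E x y :=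
  hE.holomorphic.comp (differentiable_id.prodMk (differentiable_const y))

theorem differentiable_snd (hE : IsDunklKernel 𝓡 μ E) (x : PhaseSpace N) :
    Differentiable ℂ fun y => E x y :=
  hE.holomorphic.comp ((differentiable_const x).prodMk differentiable_id)

/-- The normalization is prescribed at real `y` only; it propagates to complex `y` by holomorphy. -/
theorem zero_left (hE : IsDunklKernel 𝓡 μ E) (y : PhaseSpace N) : E 0 y = 1 := by
  have h := eq_zero_of_differentiable_of_toPhase
    (f := fun p : PhaseSpace N × PhaseSpace N => E 0 p.2 - 1)
    (fun q hq => ((hE.differentiable_snd 0).comp hq.snd).sub_const 1)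
    (fun x y => by simp [hE.at_zero]) (0, y)
  exact sub_eq_zero.mp h

theorem fderiv_fst_apply (hE : IsDunklKernel 𝓡 μ E) (x y v : PhaseSpace N) :
    fderiv ℂ (fun x' => E x' y) x v =
      fderiv ℂ (fun p : PhaseSpace N × PhaseSpace N => E p.1 p.2) (x, y) (v, 0) := by
  have h1 := (hE.holomorphic (x, y)).hasFDerivAt
  have h2 : HasFDerivAt (fun x' : PhaseSpace N => (x', y))
    (ContinuousLinearMap.inl ℂ (PhaseSpace N) (PhaseSpace N)) x := hasFDerivAt_prodMk_left x y
  have h3 := HasFDerivAt.comp x h1 h2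
  rw [show (fun x' => E x' y) = (fun p : PhaseSpace N × PhaseSpace N => E p.1 p.2) ∘
    fun x' => (x', y) from rfl, h3.fderiv]
  simp

theorem fderiv_toPhase (hE : IsDunklKernel 𝓡 μ E) (y : PhaseSpace N) (x v : ConfigSpace N) :
    fderiv ℝ (fun x' => E (toPhase x') y) x v =
      fderiv ℂ (fun x' => E x' y) (toPhase x) (toPhase v) :=
  fderiv_comp_toPhase (hE.differentiable_fst y) x v

/-- The Euler equation satisfied by the Dunkl kernel. -/
theorem isEulerSolution (h𝓡 : IsRootSystem 𝓡) (hE : IsDunklKernel 𝓡 μ E) (y : PhaseSpace N) :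
    IsEulerSolution 𝓡 μ (fun x => bil x y) (fun x => E x y) where
  continuous := (hE.differentiable_fst y).continuous
  hasDerivAt x := by
    -- The radial equation is holomorphic in `(x, y)`, so real points are enough.
    have key := eq_zero_of_differentiable_of_toPhase
      (f := fun p : PhaseSpace N × PhaseSpace N =>
        fderiv ℂ (fun p : PhaseSpace N × PhaseSpace N => E p.1 p.2) p (p.1, 0) - (bil p.1 p.2 * E p.1 p.2 -
          ∑ α ∈ 𝓡, ((μ α / 2 : ℝ) : ℂ) * (E p.1 p.2 - E (phaseRefl α p.1) p.2))) ?_ ?_ (x, y)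
    · have h1 := ((hE.differentiable_fst y x).hasFDerivAt).restrictScalars ℝ
      rw [← one_smul ℝ x] at h1
      have h2 : HasDerivAt (fun t : ℝ => t • x) x 1 := by
        simpa using (hasDerivAt_id (1 : ℝ)).smul_const x
      have h3 := h1.comp_hasDerivAt (1 : ℝ) h2
      refine h3.congr_deriv ?_
      rw [← sub_eq_zero, ← key]
      simp only [one_smul, ContinuousLinearMap.coe_restrictScalars', fderiv_fst_apply hE]
    · intro q hq
      have h1 := differentiable_fderiv_apply hE.holomorphic hq
        (hq.fst.prodMk (differentiable_const (0 : PhaseSpace N)))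
      have h2 := hE.holomorphic.comp hq
      have h3 := differentiable_bil.comp hq
      refine h1.sub ((h3.mul h2).sub (Differentiable.fun_sum fun α _ => ?_))
      refine (h2.sub (hE.holomorphic.comp (f := fun t => (phaseRefl α (q t).1, (q t).2)) ?_)).const_mul _
      exact ((differentiable_phaseRefl α).comp hq.fst).prodMk hq.snd
    · intro x y
      -- With `ξ = x` the coefficient `⟪α, ξ⟫` cancels the denominator of the difference quotient.
      have h := hE.eigen x x y
      rw [dunklOp, hE.fderiv_toPhase, hE.fderiv_fst_apply] at h
      rw [bil_toPhase, ← h, Finset.mul_sum]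
      simp only
      rw [sub_eq_zero, eq_sub_iff_add_eq, add_right_inj]
      refine Finset.sum_congr rfl fun α hα => ?_
      have := inner_mul_diffQuot (h𝓡.norm_sq α hα) (fun x' => E (toPhase x') (toPhase y)) x
      rw [mul_assoc (μ α : ℂ), this, toPhase_refl (h𝓡.norm_sq α hα)]
      push_cast
      ring

theorem norm_bil_le_right (x y : PhaseSpace N) : ‖bil x y‖ ≤ ‖y‖ * ‖x‖ :=
  (norm_bil_le x y).trans (mul_comm _ _).le

theorem norm_le (h𝓡 : IsRootSystem 𝓡) (hμ : IsMultiplicity 𝓡 μ) (hE : IsDunklKernel 𝓡 μ E)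
    (x y : PhaseSpace N) : ‖E x y‖ ≤ Real.exp (‖x‖ * ‖y‖) := by
  have := (hE.isEulerSolution h𝓡 y).norm_le h𝓡 hμ (fun x => norm_bil_le_right x y) x
  simpa [hE.zero_left, mul_comm] using this

/-- A function with the properties of `E · y` in the Euler equation is `E · y`. -/
theorem eq_of_isEulerSolution (h𝓡 : IsRootSystem 𝓡) (hμ : IsMultiplicity 𝓡 μ)
    (hE : IsDunklKernel 𝓡 μ E) {y : PhaseSpace N} {U : PhaseSpace N → ℂ}
    (hU : IsEulerSolution 𝓡 μ (fun x => bil x y) U) (h0 : U 0 = 1) (x : PhaseSpace N) :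
    U x = E x y :=
  congrFun (hU.unique h𝓡 hμ (hE.isEulerSolution h𝓡 y) (fun x => norm_bil_le_right x y)
    (h0.trans (hE.zero_left y).symm)) x

theorem sum_comp_refl {M : Type*} [AddCommMonoid M] (h𝓡 : IsRootSystem 𝓡) {α : ConfigSpace N}
    (hα : α ∈ 𝓡) (f : ConfigSpace N → M) : ∑ β ∈ 𝓡, f (refl α β) = ∑ β ∈ 𝓡, f β := by
  have hmem : ∀ β ∈ 𝓡, refl α β ∈ 𝓡 := fun β hβ => by
    have : refl α β ∈ (refl α) '' (𝓡 : Set (ConfigSpace N)) := ⟨β, hβ, rfl⟩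
    rw [h𝓡.image_refl α hα] at this
    exact this
  have hinv : ∀ β, refl α (refl α β) = β := fun β => Submodule.reflection_reflection _ β
  exact Finset.sum_bij' (fun β _ => refl α β) (fun β _ => refl α β) hmem hmem
    (fun β _ => hinv β) (fun β _ => hinv β) (fun β _ => rfl)

theorem mu_refl (hμ : IsMultiplicity 𝓡 μ) {α β : ConfigSpace N} (hα : α ∈ 𝓡) (hβ : β ∈ 𝓡) :
    μ (refl α β) = μ β :=
  hμ.invariant _ (Subgroup.subset_closure ⟨α, hα, rfl⟩) β hβ

/-- As a function of `x`, the left side solves the radial equation with parameter `y`: the bilinear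
form is invariant, and the sum over the roots is permuted by `σ_α`, which preserves `μ`. Uniqueness
concludes. -/
theorem phaseRefl_phaseRefl_arg (h𝓡 : IsRootSystem 𝓡) (hμ : IsMultiplicity 𝓡 μ)
    (hE : IsDunklKernel 𝓡 μ E) {α : ConfigSpace N} (hα : α ∈ 𝓡) (x y : PhaseSpace N) :
    E (phaseRefl α x) (phaseRefl α y) = E x y := by
  have hn := h𝓡.norm_sq α hα
  refine hE.eq_of_isEulerSolution h𝓡 hμ (U := fun x => E (phaseRefl α x) (phaseRefl α y))
    ⟨?_, fun x => ?_⟩ ?_ x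
  · exact (hE.differentiable_fst _).continuous.comp (differentiable_phaseRefl α).continuous
  · have h := (hE.isEulerSolution h𝓡 (phaseRefl α y)).hasDerivAt (phaseRefl α x)
    simp only [← phaseRefl_real_smul] at h
    refine h.congr_deriv ?_
    rw [bil_phaseRefl_phaseRefl hn, ← sum_comp_refl h𝓡 hα]
    congr 1
    refine Finset.sum_congr rfl fun β hβ => ?_
    rw [mu_refl hμ hα hβ, phaseRefl_conj hn]
  · rw [phaseRefl_zero, hE.zero_left]

theorem phaseRefl_left (h𝓡 : IsRootSystem 𝓡) (hμ : IsMultiplicity 𝓡 μ)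
    (hE : IsDunklKernel 𝓡 μ E) {α : ConfigSpace N} (hα : α ∈ 𝓡) (x y : PhaseSpace N) :
    E (phaseRefl α x) y = E x (phaseRefl α y) := by
  rw [← hE.phaseRefl_phaseRefl_arg h𝓡 hμ hα x (phaseRefl α y),
    phaseRefl_phaseRefl (h𝓡.norm_sq α hα)]

/-- Complex scaling commutes with the radial derivative and with the reflections, so both sides
solve the radial equation with parameter `c • y`. -/
theorem smul_left (h𝓡 : IsRootSystem 𝓡) (hμ : IsMultiplicity 𝓡 μ)
    (hE : IsDunklKernel 𝓡 μ E) (c : ℂ) (x y : PhaseSpace N) : E (c • x) y = E x (c • y) := by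
  refine hE.eq_of_isEulerSolution h𝓡 hμ (U := fun x => E (c • x) y) ⟨?_, fun x => ?_⟩ ?_ x
  · exact (hE.differentiable_fst _).continuous.comp (continuous_const_smul c)
  · have h := (hE.isEulerSolution h𝓡 y).hasDerivAt (c • x)
    simp only [smul_comm _ c, phaseRefl_smul] at h
    rwa [bil_smul_left, ← bil_smul_right] at h
  · rw [smul_zero, hE.zero_left]

/-- The radial derivative is taken along real `t`, so conjugating the equation at the conjugate
points is legitimate and gives the same equation. -/
theorem conj_apply (h𝓡 : IsRootSystem 𝓡) (hμ : IsMultiplicity 𝓡 μ)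
    (hE : IsDunklKernel 𝓡 μ E) (x y : PhaseSpace N) :
    (starRingEnd ℂ) (E (conjPhase x) (conjPhase y)) = E x y := by
  refine hE.eq_of_isEulerSolution h𝓡 hμ
    (U := fun x => (starRingEnd ℂ) (E (conjPhase x) (conjPhase y))) ⟨?_, fun x => ?_⟩ ?_ x
  · exact Complex.continuous_conj.comp
      ((hE.differentiable_fst _).continuous.comp continuous_conjPhase)
  · have h := (hE.isEulerSolution h𝓡 (conjPhase y)).hasDerivAt (conjPhase x)
    have h2 := Complex.conjCLE.toContinuousLinearMap.hasFDerivAt.comp_hasDerivAt (1 : ℝ) h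
    simp only [← conjPhase_real_smul] at h2
    refine h2.congr_deriv ?_
    simp [bil_conjPhase, phaseRefl_conjPhase, Complex.conj_ofNat]
  · have : conjPhase (0 : PhaseSpace N) = 0 := by ext j; simp
    simp [this, hE.zero_left]

/-- The Dunkl kernel is symmetric. -/
theorem symm (h𝓡 : IsRootSystem 𝓡) (hμ : IsMultiplicity 𝓡 μ)
    (hE : IsDunklKernel 𝓡 μ E) (x y : PhaseSpace N) : E x y = E y x := by
  refine (hE.eq_of_isEulerSolution h𝓡 hμ (U := fun x => E y x) ⟨?_, fun x => ?_⟩ ?_ x).symm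
  · exact (hE.differentiable_snd _).continuous
  · have h := (hE.isEulerSolution h𝓡 x).hasDerivAt y
    -- A real dilation can be moved from one argument to the other, and so can a reflection; this
    -- turns the radial equation in the first argument into one in the second.
    have e : ∀ t : ℝ, E (t • y) x = E y (t • x) := fun t => hE.smul_left h𝓡 hμ (t : ℂ) y x
    simp only [e] at h
    refine h.congr_deriv ?_
    rw [bil_comm]
    congr 1
    refine Finset.sum_congr rfl fun α hα => ?_
    rw [hE.phaseRefl_left h𝓡 hμ hα]
  · have := hE.smul_left h𝓡 hμ 0 y 0
    rw [zero_smul, zero_smul, hE.zero_left] at this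
    exact this.symm

/-- The eigenvalue equations with a complex spectral parameter. -/
theorem dunklOp_toPhase (hE : IsDunklKernel 𝓡 μ E) (ξ x : ConfigSpace N)
    (hx : ∀ α ∈ 𝓡, ⟪α, x⟫ ≠ 0) (y : PhaseSpace N) :
    dunklOp 𝓡 μ ξ (fun x' => E (toPhase x') y) x = bil (toPhase ξ) y * E (toPhase x) y := by
  -- Here `x` stays fixed off the hyperplanes and only `y` is complexified. The first component of
  -- the point is a dummy.
  have key := eq_zero_of_differentiable_of_toPhase
    (f := fun p : PhaseSpace N × PhaseSpace N =>
        fderiv ℂ (fun p : PhaseSpace N × PhaseSpace N => E p.1 p.2) (toPhase x, p.2) (toPhase ξ, 0) +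
        (1 / 2 : ℂ) * ∑ α ∈ 𝓡, (μ α : ℂ) * (⟪α, ξ⟫ : ℂ) *
          ((E (toPhase x) p.2 - E (toPhase (refl α x)) p.2) / (⟪α, x⟫ : ℂ)) -
        bil (toPhase ξ) p.2 * E (toPhase x) p.2) ?_ ?_ (0, y)
  · rw [dunklOp, hE.fderiv_toPhase, hE.fderiv_fst_apply, ← sub_eq_zero, ← key]
    simp only
    congr 3
    refine Finset.sum_congr rfl fun α hα => ?_
    rw [diffQuot, if_neg (hx α hα)]
  · intro q hq
    have h4 : ∀ x, Differentiable ℂ fun t => E x (q t).2 :=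
      fun x => (hE.differentiable_snd x).comp hq.snd
    have h1 := differentiable_fderiv_apply hE.holomorphic
      ((differentiable_const (toPhase x)).prodMk hq.snd)
      (differentiable_const (toPhase ξ, (0 : PhaseSpace N)))
    refine (h1.add ((Differentiable.fun_sum fun α _ => ?_).const_mul _)).sub
      (((differentiable_bil_right _).comp hq.snd).mul (h4 _))
    simp only [div_eq_mul_inv]
    exact (((h4 _).sub (h4 _)).mul_const _).const_mul _
  · intro _ y
    have h := hE.eigen ξ x y
    rw [dunklOp, hE.fderiv_toPhase, hE.fderiv_fst_apply] at h
    rw [bil_toPhase, ← h]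
    simp only
    rw [sub_eq_zero]
    congr 2
    refine Finset.sum_congr rfl fun α hα => ?_
    rw [diffQuot, if_neg (hx α hα)]

end IsDunklKernel

end

section

/-! ### Functions of exponential growth and Gaussian weights -/

variable {N : ℕ}

/-- Functions of at most exponential growth. -/
def ExpBounded {V : Type*} [Norm V] (f : ConfigSpace N → V) : Prop :=
  ∃ C c : ℝ, 0 ≤ C ∧ 0 ≤ c ∧ ∀ x, ‖f x‖ ≤ C * Real.exp (c * ‖x‖)

namespace ExpBounded

variable {f g : ConfigSpace N → ℂ}

theorem of_norm_le {V W : Type*} [Norm V] [Norm W] {f : ConfigSpace N → V}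
    {g : ConfigSpace N → W} (hf : ExpBounded f) (h : ∀ x, ‖g x‖ ≤ ‖f x‖) : ExpBounded g := by
  obtain ⟨C, c, hC, hc, h'⟩ := hf
  exact ⟨C, c, hC, hc, fun x => (h x).trans (h' x)⟩

theorem const (a : ℂ) : ExpBounded fun _ : ConfigSpace N => a :=
  ⟨‖a‖, 0, norm_nonneg _, le_rfl, fun x => by simp⟩

theorem mul (hf : ExpBounded f) (hg : ExpBounded g) : ExpBounded fun x => f x * g x := by
  obtain ⟨C, c, hC, hc, h⟩ := hf
  obtain ⟨C', c', hC', hc', h'⟩ := hg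
  refine ⟨C * C', c + c', by positivity, by positivity, fun x => ?_⟩
  rw [norm_mul, add_mul, Real.exp_add, mul_mul_mul_comm]
  exact mul_le_mul (h x) (h' x) (norm_nonneg _) (by positivity)

theorem add (hf : ExpBounded f) (hg : ExpBounded g) : ExpBounded fun x => f x + g x := by
  obtain ⟨C, c, hC, hc, h⟩ := hf
  obtain ⟨C', c', hC', hc', h'⟩ := hg
  refine ⟨C + C', c + c', by positivity, by positivity, fun x => ?_⟩
  have h1 : Real.exp (c * ‖x‖) ≤ Real.exp ((c + c') * ‖x‖) :=
    Real.exp_le_exp.mpr (by nlinarith [norm_nonneg x])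
  have h2 : Real.exp (c' * ‖x‖) ≤ Real.exp ((c + c') * ‖x‖) :=
    Real.exp_le_exp.mpr (by nlinarith [norm_nonneg x])
  rw [add_mul]
  exact (norm_add_le _ _).trans (add_le_add ((h x).trans (by gcongr)) ((h' x).trans (by gcongr)))

theorem const_mul (a : ℂ) (hf : ExpBounded f) : ExpBounded fun x => a * f x := (const a).mul hf

theorem neg (hf : ExpBounded f) : ExpBounded fun x => -f x :=
  hf.of_norm_le fun x => (norm_neg (f x)).le

theorem sub (hf : ExpBounded f) (hg : ExpBounded g) : ExpBounded fun x => f x - g x := by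
  simpa only [sub_eq_add_neg] using hf.add hg.neg

theorem sum {ι : Type*} {s : Finset ι} {f : ι → ConfigSpace N → ℂ}
    (hf : ∀ i ∈ s, ExpBounded (f i)) : ExpBounded fun x => ∑ i ∈ s, f i x := by
  classical
  induction s using Finset.induction_on with
  | empty => simpa using const (N := N) 0
  | insert i s hi ih =>
    simp only [Finset.sum_insert hi]
    exact (hf i (by simp)).add (ih fun j hj => hf j (by simp [hj]))

theorem inner (ξ : ConfigSpace N) : ExpBounded fun x : ConfigSpace N => (⟪ξ, x⟫ : ℂ) := by
  refine ⟨‖ξ‖, 1, norm_nonneg _, zero_le_one, fun x => ?_⟩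
  rw [Complex.norm_real, one_mul]
  refine (norm_inner_le_norm ξ x).trans ?_
  gcongr
  linarith [Real.add_one_le_exp ‖x‖]

theorem comp_isometry (hf : ExpBounded f) (e : ConfigSpace N ≃ₗᵢ[ℝ] ConfigSpace N) :
    ExpBounded fun x => f (e x) := by
  obtain ⟨C, c, hC, hc, h⟩ := hf
  exact ⟨C, c, hC, hc, fun x => by simpa using h (e x)⟩

theorem clm_apply {f : ConfigSpace N → ConfigSpace N →L[ℝ] ℂ} (hf : ExpBounded f)
    (ξ : ConfigSpace N) : ExpBounded fun x => f x ξ := by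
  obtain ⟨C, c, hC, hc, h⟩ := hf
  refine ⟨C * ‖ξ‖, c, by positivity, hc, fun x => ?_⟩
  refine ((f x).le_opNorm ξ).trans ?_
  rw [mul_right_comm]
  gcongr
  exact h x

theorem fderiv_mul (hf : ExpBounded f) (hf' : ExpBounded (fderiv ℝ f)) (hg : ExpBounded g)
    (hg' : ExpBounded (fderiv ℝ g)) (hfd : Differentiable ℝ f) (hgd : Differentiable ℝ g) :
    ExpBounded (fderiv ℝ fun x => f x * g x) := by
  have h1 : ExpBounded fun x => ((‖f x‖ * ‖fderiv ℝ g x‖ + ‖g x‖ * ‖fderiv ℝ f x‖ : ℝ) : ℂ) := by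
    push_cast
    have a1 : ExpBounded fun x => ((‖f x‖ : ℝ) : ℂ) := hf.of_norm_le (by simp)
    have a2 : ExpBounded fun x => ((‖g x‖ : ℝ) : ℂ) := hg.of_norm_le (by simp)
    have a3 : ExpBounded fun x => ((‖fderiv ℝ f x‖ : ℝ) : ℂ) := hf'.of_norm_le (by simp)
    have a4 : ExpBounded fun x => ((‖fderiv ℝ g x‖ : ℝ) : ℂ) := hg'.of_norm_le (by simp)
    exact (a1.mul a4).add (a2.mul a3)
  refine h1.of_norm_le fun x => ?_
  rw [fderiv_fun_mul (hfd x) (hgd x), Complex.norm_real, Real.norm_of_nonneg (by positivity)]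
  refine (norm_add_le _ _).trans ?_
  rw [norm_smul, norm_smul]

/-- The difference quotient along a root is controlled by the derivative. -/
theorem sub_refl_div {α : ConfigSpace N} (hα : ‖α‖ ^ 2 = 2) (hf' : ExpBounded (fderiv ℝ f))
    (hfd : Differentiable ℝ f) :
    ExpBounded fun x => (f x - f (refl α x)) / (⟪α, x⟫ : ℂ) := by
  obtain ⟨C, c, hC, hc, h⟩ := hf'
  refine ⟨C * ‖α‖, c, by positivity, hc, fun x => ?_⟩
  by_cases hx : ⟪α, x⟫ = 0
  · simp only [hx, Complex.ofReal_zero, div_zero, norm_zero]; positivity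
  -- Mean value inequality on the ball of radius `‖x‖`, which contains both `x` and `σ_α x`; the
  -- increment `⟪α, x⟫ • α` cancels the denominator.
  have h1 := (convex_closedBall (0 : ConfigSpace N) ‖x‖).norm_image_sub_le_of_norm_fderiv_le
    (f := f) (𝕜 := ℝ) (C := C * Real.exp (c * ‖x‖)) (fun y _ => hfd y) (fun y hy => by
      refine (h y).trans ?_
      have : ‖y‖ ≤ ‖x‖ := by simpa using hy
      gcongr) (x := refl α x) (y := x) (by simp) (by simp)
  rw [norm_div, Complex.norm_real, div_le_iff₀ (by simpa using hx)]
  refine h1.trans (le_of_eq ?_)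
  rw [refl_apply hα, sub_sub_cancel, norm_smul]
  ring

theorem diffQuot {α : ConfigSpace N} (hα : ‖α‖ ^ 2 = 2) (hf' : ExpBounded (fderiv ℝ f))
    (hfd : Differentiable ℝ f) : ExpBounded (diffQuot α f) := by
  have h1 : ExpBounded fun x => ((‖(f x - f (refl α x)) / (⟪α, x⟫ : ℂ)‖ +
      ‖fderiv ℝ f x α‖ : ℝ) : ℂ) := by
    push_cast
    exact ((sub_refl_div hα hf' hfd).of_norm_le (by simp)).add
      ((hf'.clm_apply α).of_norm_le (by simp))
  refine h1.of_norm_le fun x => ?_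
  rw [Complex.norm_real, Real.norm_of_nonneg (by positivity), Dunkl.diffQuot]
  split_ifs
  · exact le_add_of_nonneg_left (norm_nonneg _)
  · exact le_add_of_nonneg_right (norm_nonneg _)

end ExpBounded

theorem integrable_exp_neg_mul_sq_norm {a : ℝ} (ha : 0 < a) :
    Integrable fun x : ConfigSpace N => Real.exp (-a * ‖x‖ ^ 2) := by
  have h := GaussianFourier.integrable_cexp_neg_mul_sq_norm_add (V := ConfigSpace N) (b := (a : ℂ))
    (by simpa using ha) 0 0
  refine h.norm.congr (Filter.Eventually.of_forall fun x => ?_)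
  simp [Complex.norm_exp, ← Complex.ofReal_pow]

theorem integrable_exp_neg_mul_sq_norm_add {a c : ℝ} (ha : 0 < a) :
    Integrable fun x : ConfigSpace N => Real.exp (-a * ‖x‖ ^ 2 + c * ‖x‖) := by
  refine ((integrable_exp_neg_mul_sq_norm (N := N) (half_pos ha)).const_mul
    (Real.exp (c ^ 2 / (2 * a)))).mono' (by fun_prop) (Filter.Eventually.of_forall fun x => ?_)
  rw [Real.norm_of_nonneg (Real.exp_pos _).le, ← Real.exp_add, Real.exp_le_exp]
  -- Completing the square: half of the Gaussian absorbs the linear term.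
  have h : 0 ≤ (a * ‖x‖ - c) ^ 2 / (2 * a) := by positivity
  have h2 : (a * ‖x‖ - c) ^ 2 / (2 * a) = a / 2 * ‖x‖ ^ 2 - c * ‖x‖ + c ^ 2 / (2 * a) := by
    field_simp
    ring
  rw [h2] at h
  nlinarith

theorem norm_mul_le_of_expBounded {f : ConfigSpace N → ℂ} {C c : ℝ}
    (hf : ∀ x, ‖f x‖ ≤ C * Real.exp (c * ‖x‖)) {g : ConfigSpace N → ℝ} {a c' : ℝ}
    (hg : ∀ x, ‖g x‖ ≤ Real.exp (-a * ‖x‖ ^ 2 + c' * ‖x‖)) (x : ConfigSpace N) :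
    ‖(g x : ℂ) * f x‖ ≤ C * Real.exp (-a * ‖x‖ ^ 2 + (c' + c) * ‖x‖) := by
  rw [norm_mul, Complex.norm_real]
  calc ‖g x‖ * ‖f x‖ ≤ Real.exp (-a * ‖x‖ ^ 2 + c' * ‖x‖) * (C * Real.exp (c * ‖x‖)) :=
        mul_le_mul (hg x) (hf x) (norm_nonneg _) (Real.exp_pos _).le
    _ = C * Real.exp (-a * ‖x‖ ^ 2 + (c' + c) * ‖x‖) := by
        rw [mul_left_comm, ← Real.exp_add]
        congr 2
        ring

theorem ExpBounded.integrable_mul {f : ConfigSpace N → ℂ} (hf : ExpBounded f)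
    (hfm : AEStronglyMeasurable f) {g : ConfigSpace N → ℝ} (hgm : AEStronglyMeasurable g)
    {a c' : ℝ} (ha : 0 < a) (hg : ∀ x, ‖g x‖ ≤ Real.exp (-a * ‖x‖ ^ 2 + c' * ‖x‖)) :
    Integrable fun x => (g x : ℂ) * f x := by
  obtain ⟨C, c, -, -, h⟩ := hf
  exact ((integrable_exp_neg_mul_sq_norm_add (c := c' + c) ha).const_mul C).mono'
    ((Complex.continuous_ofReal.comp_aestronglyMeasurable hgm).mul hfm)
    (Filter.Eventually.of_forall (norm_mul_le_of_expBounded h hg))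

/-! ### The Gaussian weight and its regularization -/

/-- The weight `∏ |⟨α, x⟩|^{μ(α)}`. -/
noncomputable def rootWeight (𝓡 : Finset (ConfigSpace N)) (μ : ConfigSpace N → ℝ)
    (x : ConfigSpace N) : ℝ := ∏ α ∈ 𝓡, |⟪α, x⟫| ^ μ α

/-- The product of a Gaussian and a smooth approximation of `rootWeight`. -/
noncomputable def regWeight (𝓡 : Finset (ConfigSpace N)) (μ : ConfigSpace N → ℝ) (ε : ℝ)
    (x : ConfigSpace N) : ℝ :=
  Real.exp (-‖x‖ ^ 2 / 2 + ∑ α ∈ 𝓡, μ α / 2 * Real.log (⟪α, x⟫ ^ 2 + ε ^ 2))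

variable {𝓡 : Finset (ConfigSpace N)} {μ : ConfigSpace N → ℝ}

theorem measurable_rootWeight : Measurable (rootWeight 𝓡 μ) := by
  unfold rootWeight
  fun_prop

theorem rootWeight_nonneg (x : ConfigSpace N) : 0 ≤ rootWeight 𝓡 μ x :=
  Finset.prod_nonneg fun _ _ => by positivity

/-- Since `‖α‖² = 2`, the left side is at most `1 + 2‖x‖²`, which the second order expansion of `exp
(2‖x‖)` dominates. Being uniform in `ε`, the bound supplies the dominating functions for the limit
`ε → 0`. -/
theorem inner_sq_add_le (h𝓡 : IsRootSystem 𝓡) {α : ConfigSpace N} (hα : α ∈ 𝓡) {ε : ℝ}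
    (hε : ε ^ 2 ≤ 1) (x : ConfigSpace N) : ⟪α, x⟫ ^ 2 + ε ^ 2 ≤ Real.exp (2 * ‖x‖) := by
  have h1 : ⟪α, x⟫ ^ 2 ≤ 2 * ‖x‖ ^ 2 := by
    have := abs_real_inner_le_norm α x
    rw [← sq_abs, ← h𝓡.norm_sq α hα, ← mul_pow]
    gcongr
  have h2 := Real.quadratic_le_exp_of_nonneg (x := 2 * ‖x‖) (by positivity)
  nlinarith [norm_nonneg x]

theorem rootWeight_le (h𝓡 : IsRootSystem 𝓡) (hμ : IsMultiplicity 𝓡 μ) (x : ConfigSpace N) :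
    rootWeight 𝓡 μ x ≤ Real.exp ((∑ α ∈ 𝓡, μ α) * ‖x‖) := by
  rw [Finset.sum_mul, Real.exp_sum]
  refine Finset.prod_le_prod (fun _ _ => by positivity) fun α hα => ?_
  rw [mul_comm, Real.exp_mul]
  refine Real.rpow_le_rpow (abs_nonneg _) ?_ (hμ.nonneg α hα)
  have h := inner_sq_add_le h𝓡 hα (ε := 0) (by norm_num) x
  rw [mul_comm, Real.exp_mul, zero_pow two_ne_zero, add_zero, Real.rpow_two] at h
  exact abs_le_of_sq_le_sq h (Real.exp_pos _).le

theorem regWeight_le (h𝓡 : IsRootSystem 𝓡) (hμ : IsMultiplicity 𝓡 μ) {ε : ℝ} (hε0 : 0 < ε)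
    (hε : ε ≤ 1) (x : ConfigSpace N) :
    ‖regWeight 𝓡 μ ε x‖ ≤ Real.exp (-(1 / 2) * ‖x‖ ^ 2 + (∑ α ∈ 𝓡, μ α) * ‖x‖) := by
  rw [regWeight, Real.norm_of_nonneg (Real.exp_pos _).le, Real.exp_le_exp, Finset.sum_mul]
  refine add_le_add (by linarith) (Finset.sum_le_sum fun α hα => ?_)
  have h1 := Real.log_le_log (by positivity) (inner_sq_add_le h𝓡 hα (ε := ε) (by nlinarith) x)
  rw [Real.log_exp] at h1
  nlinarith [hμ.nonneg α hα]

theorem gaussian_mul_rootWeight_le (h𝓡 : IsRootSystem 𝓡) (hμ : IsMultiplicity 𝓡 μ) (a : ℝ)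
    (x : ConfigSpace N) : ‖Real.exp (-a * ‖x‖ ^ 2) * rootWeight 𝓡 μ x‖ ≤
      Real.exp (-a * ‖x‖ ^ 2 + (∑ α ∈ 𝓡, μ α) * ‖x‖) := by
  rw [Real.norm_of_nonneg (mul_nonneg (Real.exp_pos _).le (rootWeight_nonneg x)), Real.exp_add]
  gcongr
  exact rootWeight_le h𝓡 hμ x

theorem ae_inner_ne_zero (h𝓡 : IsRootSystem 𝓡) :
    ∀ᵐ x : ConfigSpace N, ∀ α ∈ 𝓡, ⟪α, x⟫ ≠ 0 := by
  rw [Filter.eventually_all_finset]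
  intro α hα
  have h := Measure.addHaar_submodule (volume : Measure (ConfigSpace N))
    (LinearMap.ker (innerSL ℝ α).toLinearMap) (by
      intro h
      have : α ∈ LinearMap.ker (innerSL ℝ α).toLinearMap := h ▸ Submodule.mem_top
      simp only [LinearMap.mem_ker, ContinuousLinearMap.coe_coe, innerSL_apply_apply,
        inner_self_eq_zero] at this
      exact h𝓡.ne_zero α hα this)
  rw [ae_iff]
  convert h using 2
  ext x
  simp

theorem tendsto_regWeight {x : ConfigSpace N} (hx : ∀ α ∈ 𝓡, ⟪α, x⟫ ≠ 0) :
    Filter.Tendsto (fun ε => regWeight 𝓡 μ ε x) (nhdsWithin 0 (Set.Ioi 0))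
      (nhds (Real.exp (-(1 / 2) * ‖x‖ ^ 2) * rootWeight 𝓡 μ x)) := by
  have h0 : Real.exp (-(1 / 2) * ‖x‖ ^ 2) * rootWeight 𝓡 μ x = regWeight 𝓡 μ 0 x := by
    rw [regWeight, rootWeight, Real.exp_add, Real.exp_sum]
    congr 1
    · congr 1; ring
    · refine Finset.prod_congr rfl fun α hα => ?_
      rw [Real.rpow_def_of_pos (abs_pos.mpr (hx α hα)), zero_pow two_ne_zero, add_zero,
        ← sq_abs, Real.log_pow]
      congr 1
      push_cast; ring
  rw [h0]
  refine Filter.Tendsto.mono_left (ContinuousAt.tendsto ?_) nhdsWithin_le_nhds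
  unfold regWeight
  refine Real.continuous_exp.continuousAt.comp (continuousAt_const.add ?_)
  refine tendsto_finsetSum _ fun α hα => ?_
  refine ContinuousAt.mul continuousAt_const (ContinuousAt.log (by fun_prop) ?_)
  have := hx α hα
  positivity

theorem regWeight_refl (h𝓡 : IsRootSystem 𝓡) (hμ : IsMultiplicity 𝓡 μ) {α : ConfigSpace N}
    (hα : α ∈ 𝓡) (ε : ℝ) (x : ConfigSpace N) :
    regWeight 𝓡 μ ε (refl α x) = regWeight 𝓡 μ ε x := by
  rw [regWeight, regWeight, LinearIsometryEquiv.norm_map, ← IsDunklKernel.sum_comp_refl h𝓡 hα]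
  congr 2
  refine Finset.sum_congr rfl fun β hβ => ?_
  rw [LinearIsometryEquiv.inner_map_map, IsDunklKernel.mu_refl hμ hα hβ]

/-- For small positive multiplicities the true weight is not differentiable on the hyperplanes.
Regularization replaces the singular `1 / ⟪α, x⟫` in its logarithmic derivative by a function that
is bounded for each fixed `ε`. -/
theorem hasLineDerivAt_regWeight {ε : ℝ} (hε : 0 < ε) (ξ x : ConfigSpace N) :
    HasLineDerivAt ℝ (regWeight 𝓡 μ ε) (regWeight 𝓡 μ ε x * (-⟪ξ, x⟫ +
      ∑ α ∈ 𝓡, μ α * ⟪α, ξ⟫ * (⟪α, x⟫ / (⟪α, x⟫ ^ 2 + ε ^ 2)))) x ξ := by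
  unfold HasLineDerivAt regWeight
  have h1 : HasDerivAt (fun t : ℝ => x + t • ξ) ξ 0 := by
    simpa using ((hasDerivAt_id (0 : ℝ)).smul_const ξ).const_add x
  have h2 : HasDerivAt (fun t : ℝ => -‖x + t • ξ‖ ^ 2 / 2) (-⟪ξ, x⟫) 0 := by
    refine (h1.norm_sq.neg.div_const 2).congr_deriv ?_
    simp [real_inner_comm]
    ring
  have h3 : ∀ α ∈ 𝓡, HasDerivAt (fun t : ℝ => μ α / 2 * Real.log (⟪α, x + t • ξ⟫ ^ 2 + ε ^ 2))
      (μ α * ⟪α, ξ⟫ * (⟪α, x⟫ / (⟪α, x⟫ ^ 2 + ε ^ 2))) 0 := by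
    intro α _
    have h4 : HasDerivAt (fun t : ℝ => ⟪α, x + t • ξ⟫) ⟪α, ξ⟫ 0 :=
      (innerSL ℝ α).hasFDerivAt.comp_hasDerivAt (0 : ℝ) h1
    have hpos : (⟪α, x⟫ ^ 2 + ε ^ 2) ≠ 0 := by positivity
    refine ((((h4.pow 2).add_const (ε ^ 2)).log (by simpa using hpos)).const_mul
      (μ α / 2)).congr_deriv ?_
    simp only [Nat.cast_ofNat, zero_smul, add_zero, Nat.add_one_sub_one, pow_one, Pi.pow_apply]
    field_simp
  refine ((h2.add (HasDerivAt.fun_sum h3)).exp).congr_deriv ?_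
  simp

end

section

/-! ### Integration by parts for the Dunkl operators -/

variable {N : ℕ} {𝓡 : Finset (ConfigSpace N)} {μ : ConfigSpace N → ℝ}

theorem continuous_regWeight {ε : ℝ} (hε : 0 < ε) : Continuous (regWeight 𝓡 μ ε) := by
  unfold regWeight
  refine Real.continuous_exp.comp ((by fun_prop : Continuous _).add
    (continuous_finsetSum _ fun α _ => continuous_const.mul (Continuous.log (by fun_prop) ?_)))
  intro x
  positivity

theorem integral_comp_refl (α : ConfigSpace N) (f : ConfigSpace N → ℂ) :
    ∫ x, f (refl α x) = ∫ x, f x :=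
  (refl α).measurePreserving.integral_comp (refl α).toHomeomorph.measurableEmbedding f

theorem measurable_diffQuot (α : ConfigSpace N) {f : ConfigSpace N → ℂ} (hf : Continuous f) :
    Measurable (diffQuot α f) := by
  unfold diffQuot
  refine Measurable.ite ?_ (measurable_fderiv_apply_const ℝ f α) ?_
  · exact (isClosed_singleton (x := (0 : ℝ))).preimage
      (by fun_prop : Continuous fun x => ⟪α, x⟫) |>.measurableSet
  · have h1 : Continuous fun x => f x - f (refl α x) :=
      hf.sub (hf.comp (refl α).continuous)
    have h2 : Continuous fun x : ConfigSpace N => (⟪α, x⟫ : ℂ) := by fun_prop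
    exact h1.measurable.div h2.measurable

/-- Convergence of integrals against the regularized weights. -/
theorem tendsto_integral_regWeight (h𝓡 : IsRootSystem 𝓡) (hμ : IsMultiplicity 𝓡 μ)
    {f : ConfigSpace N → ℂ} (hf : ExpBounded f) (hfm : Measurable f) :
    Filter.Tendsto (fun ε => ∫ x, (regWeight 𝓡 μ ε x : ℂ) * f x) (nhdsWithin 0 (Set.Ioi 0))
      (nhds (∫ x, ((Real.exp (-(1 / 2) * ‖x‖ ^ 2) * rootWeight 𝓡 μ x : ℝ) : ℂ) * f x)) := by
  obtain ⟨C, c, -, -, h⟩ := hf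
  have hev : ∀ᶠ ε : ℝ in nhdsWithin 0 (Set.Ioi 0), ε ∈ Set.Ioo (0 : ℝ) 1 :=
    Ioo_mem_nhdsGT one_pos
  refine tendsto_integral_filter_of_dominated_convergence
    (fun x => C * Real.exp (-(1 / 2) * ‖x‖ ^ 2 + ((∑ α ∈ 𝓡, μ α) + c) * ‖x‖)) ?_ ?_ ?_ ?_
  · filter_upwards [hev] with ε hε
    exact ((Complex.continuous_ofReal.comp (continuous_regWeight hε.1)).measurable.mul
      hfm).aestronglyMeasurable
  · filter_upwards [hev] with ε hε
    exact Filter.Eventually.of_forall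
      (norm_mul_le_of_expBounded h (regWeight_le h𝓡 hμ hε.1 hε.2.le))
  · exact (integrable_exp_neg_mul_sq_norm_add (by norm_num)).const_mul C
  · filter_upwards [ae_inner_ne_zero h𝓡] with x hx
    exact ((Complex.continuous_ofReal.tendsto _).comp (tendsto_regWeight hx)).mul_const _

theorem integrable_regWeight_mul (h𝓡 : IsRootSystem 𝓡) (hμ : IsMultiplicity 𝓡 μ) {ε : ℝ}
    (hε : 0 < ε) (hε1 : ε ≤ 1) {f : ConfigSpace N → ℂ} (hf : ExpBounded f)
    (hfm : Measurable f) : Integrable fun x => (regWeight 𝓡 μ ε x : ℂ) * f x :=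
  hf.integrable_mul hfm.aestronglyMeasurable (continuous_regWeight hε).aestronglyMeasurable
    (by norm_num) (regWeight_le h𝓡 hμ hε hε1)

/-- The weight and Lebesgue measure are invariant under `σ_α`, so the integrand may be averaged.
Averaging turns the singular terms of the integration by parts into difference quotients. -/
theorem integral_regWeight_eq_half (h𝓡 : IsRootSystem 𝓡) (hμ : IsMultiplicity 𝓡 μ) {ε : ℝ}
    (hε : 0 < ε) (hε1 : ε ≤ 1) {α : ConfigSpace N} (hα : α ∈ 𝓡) {f : ConfigSpace N → ℂ}
    (hf : ExpBounded f) (hfm : Measurable f) :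
    ∫ x, (regWeight 𝓡 μ ε x : ℂ) * f x =
      ∫ x, (regWeight 𝓡 μ ε x : ℂ) * ((f x + f (refl α x)) / 2) := by
  have h1 : ∫ x, (regWeight 𝓡 μ ε x : ℂ) * f (refl α x) = ∫ x, (regWeight 𝓡 μ ε x : ℂ) * f x := by
    rw [← integral_comp_refl α fun x => (regWeight 𝓡 μ ε x : ℂ) * f x]
    simp only [regWeight_refl h𝓡 hμ hα]
  have h2 : ∀ x, (regWeight 𝓡 μ ε x : ℂ) * ((f x + f (refl α x)) / 2) =
      (1 / 2 : ℂ) * ((regWeight 𝓡 μ ε x : ℂ) * f x + (regWeight 𝓡 μ ε x : ℂ) * f (refl α x)) :=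
    fun x => by ring
  simp_rw [h2]
  rw [integral_const_mul, integral_add (integrable_regWeight_mul h𝓡 hμ hε hε1 hf hfm)
    (integrable_regWeight_mul h𝓡 hμ hε hε1 (hf.comp_isometry _)
      (hfm.comp (refl α).continuous.measurable)), h1]
  ring

variable {F G : ConfigSpace N → ℂ}

theorem expBounded_inner_div (α : ConfigSpace N) {ε : ℝ} (hε : 0 < ε) :
    ExpBounded fun x : ConfigSpace N => ((⟪α, x⟫ / (⟪α, x⟫ ^ 2 + ε ^ 2) : ℝ) : ℂ) := by
  have hp : 0 < ε ^ 2 := by positivity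
  refine (ExpBounded.const_mul (((ε ^ 2)⁻¹ : ℝ) : ℂ) (ExpBounded.inner α)).of_norm_le fun x => ?_
  rw [Complex.norm_real, norm_div, norm_mul, Complex.norm_real, Complex.norm_real,
    Real.norm_of_nonneg (by positivity : (0 : ℝ) ≤ ⟪α, x⟫ ^ 2 + ε ^ 2),
    Real.norm_of_nonneg (by positivity : (0 : ℝ) ≤ (ε ^ 2)⁻¹), div_eq_mul_inv,
    mul_comm (ε ^ 2)⁻¹]
  gcongr
  nlinarith [sq_nonneg ⟪α, x⟫]

theorem expBounded_logDeriv_regWeight (ξ : ConfigSpace N) {ε : ℝ} (hε : 0 < ε) :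
    ExpBounded fun x : ConfigSpace N => ((-⟪ξ, x⟫ + ∑ α ∈ 𝓡, μ α * ⟪α, ξ⟫ *
      (⟪α, x⟫ / (⟪α, x⟫ ^ 2 + ε ^ 2)) : ℝ) : ℂ) := by
  have h3 := (ExpBounded.inner ξ).neg.add (ExpBounded.sum (s := 𝓡) fun α _ =>
    (expBounded_inner_div α hε).const_mul ((μ α * ⟪α, ξ⟫ : ℝ) : ℂ))
  refine h3.of_norm_le fun x => le_of_eq ?_
  push_cast
  rfl

/-- The contribution of one root to integration by parts vanishes in the limit. -/
theorem tendsto_integral_root_term (h𝓡 : IsRootSystem 𝓡) (hμ : IsMultiplicity 𝓡 μ)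
    {α : ConfigSpace N} (hα : α ∈ 𝓡) (hF : ExpBounded F) (hF' : ExpBounded (fderiv ℝ F))
    (hFd : Differentiable ℝ F) (hG : ExpBounded G) (hG' : ExpBounded (fderiv ℝ G))
    (hGd : Differentiable ℝ G) :
    Filter.Tendsto (fun ε => ∫ x, (regWeight 𝓡 μ ε x : ℂ) *
      (F x * G x * ((⟪α, x⟫ / (⟪α, x⟫ ^ 2 + ε ^ 2) : ℝ) : ℂ) -
        1 / 2 * (diffQuot α F x * G x + F x * diffQuot α G x)))
      (nhdsWithin 0 (Set.Ioi 0)) (nhds 0) := by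
  have hn := h𝓡.norm_sq α hα
  have hev : ∀ᶠ ε : ℝ in nhdsWithin 0 (Set.Ioi 0), ε ∈ Set.Ioo (0 : ℝ) 1 :=
    Ioo_mem_nhdsGT one_pos
  have hH' := hF.fderiv_mul hF' hG hG' hFd hGd
  -- `Q` is the difference quotient of the product `F * G`; the derivative of the product controls
  -- it.
  set Q : ConfigSpace N → ℂ := fun x => (F x * G x - F (refl α x) * G (refl α x)) / (⟪α, x⟫ : ℂ)
    with hQ
  have hQb : ExpBounded Q := ExpBounded.sub_refl_div hn hH' (hFd.mul hGd)
  have hFc := hFd.continuous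
  have hGc := hGd.continuous
  have hrc := (refl α).continuous
  have hQm : Measurable Q := by
    have h1 : Continuous fun x => F x * G x - F (refl α x) * G (refl α x) := by fun_prop
    have h2 : Continuous fun x : ConfigSpace N => (⟪α, x⟫ : ℂ) := by fun_prop
    exact h1.measurable.div h2.measurable
  have hinner : ∀ x, ⟪α, refl α x⟫ = -⟪α, x⟫ := by
    intro x
    rw [refl_apply hn, inner_sub_right, real_inner_smul_right, real_inner_self_eq_norm_sq, hn]
    ring
  -- Write `u = ⟪α, x⟫`. After averaging, the first term becomes `u² / (u² + ε²) * Q / 2` and the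
  -- second becomes `Q / 2`. Their difference carries the factor `ε² / (u² + ε²)`, which is at most
  -- `1` and tends to `0` off the hyperplane.
  have hkey : ∀ ε ∈ Set.Ioo (0 : ℝ) 1, ∫ x, (regWeight 𝓡 μ ε x : ℂ) *
      (F x * G x * ((⟪α, x⟫ / (⟪α, x⟫ ^ 2 + ε ^ 2) : ℝ) : ℂ) -
        1 / 2 * (diffQuot α F x * G x + F x * diffQuot α G x)) =
      ∫ x, (regWeight 𝓡 μ ε x : ℂ) *
        (((-(ε ^ 2 / (⟪α, x⟫ ^ 2 + ε ^ 2)) / 2 : ℝ) : ℂ) * Q x) := by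
    intro ε hε
    rw [integral_regWeight_eq_half h𝓡 hμ hε.1 hε.2.le hα]
    · refine integral_congr_ae ?_
      filter_upwards [ae_inner_ne_zero h𝓡] with x hx
      have hx := hx α hα
      have hx' : ⟪α, refl α x⟫ ≠ 0 := by rw [hinner]; exact neg_ne_zero.mpr hx
      have hxc : (⟪α, x⟫ : ℂ) ≠ 0 := by exact_mod_cast hx
      have hden : (⟪α, x⟫ : ℂ) ^ 2 + (ε : ℂ) ^ 2 ≠ 0 := by
        have : ⟪α, x⟫ ^ 2 + ε ^ 2 ≠ 0 := by positivity
        exact_mod_cast this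
      have hrr : refl α (refl α x) = x := Submodule.reflection_reflection _ x
      simp only [hQ, diffQuot, if_neg hx, if_neg hx', hrr]
      rw [hinner]
      push_cast
      rw [neg_sq]
      field_simp
      ring
    · have h1 := expBounded_inner_div α hε.1
      exact ((hF.mul hG).mul h1).sub ((((hF'.diffQuot hn hFd).mul hG).add
        (hF.mul (hG'.diffQuot hn hGd))).const_mul _)
    · have h1 : Measurable fun x : ConfigSpace N => ((⟪α, x⟫ / (⟪α, x⟫ ^ 2 + ε ^ 2) : ℝ) : ℂ) := by
        fun_prop
      have h2 := measurable_diffQuot α hFc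
      have h3 := measurable_diffQuot α hGc
      have h4 := hFc.measurable
      have h5 := hGc.measurable
      fun_prop
  refine Filter.Tendsto.congr' (f₁ := fun ε => ∫ x, (regWeight 𝓡 μ ε x : ℂ) *
        (((-(ε ^ 2 / (⟪α, x⟫ ^ 2 + ε ^ 2)) / 2 : ℝ) : ℂ) * Q x))
    (by filter_upwards [hev] with ε hε using (hkey ε hε).symm) ?_
  obtain ⟨C, c, hC, -, hQle⟩ := hQb
  have hle : ∀ ε ∈ Set.Ioo (0 : ℝ) 1, ∀ x,
      ‖((-(ε ^ 2 / (⟪α, x⟫ ^ 2 + ε ^ 2)) / 2 : ℝ) : ℂ) * Q x‖ ≤ C * Real.exp (c * ‖x‖) := by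
    intro ε hε x
    rw [norm_mul, Complex.norm_real, norm_div, norm_neg, norm_div]
    refine (mul_le_of_le_one_left (norm_nonneg _) ?_).trans (hQle x)
    have hp : 0 < ε ^ 2 := by have := hε.1; positivity
    have h2 : ‖ε ^ 2‖ / ‖⟪α, x⟫ ^ 2 + ε ^ 2‖ ≤ 1 := by
      rw [Real.norm_of_nonneg (by positivity), Real.norm_of_nonneg (by positivity)]
      rw [div_le_one (by positivity)]
      nlinarith [sq_nonneg ⟪α, x⟫]
    rw [Real.norm_of_nonneg (zero_le_two)]
    linarith
  rw [← integral_zero (ConfigSpace N) ℂ (μ := volume)]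
  refine tendsto_integral_filter_of_dominated_convergence
    (fun x => C * Real.exp (-(1 / 2) * ‖x‖ ^ 2 + ((∑ α ∈ 𝓡, μ α) + c) * ‖x‖)) ?_ ?_ ?_ ?_
  · filter_upwards [hev] with ε hε
    have h1 := (continuous_regWeight (𝓡 := 𝓡) (μ := μ) hε.1).measurable
    exact (by fun_prop : Measurable _).aestronglyMeasurable
  · filter_upwards [hev] with ε hε
    exact Filter.Eventually.of_forall
      (norm_mul_le_of_expBounded (hle ε hε) (regWeight_le h𝓡 hμ hε.1 hε.2.le))
  · exact (integrable_exp_neg_mul_sq_norm_add (by norm_num)).const_mul C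
  · filter_upwards [ae_inner_ne_zero h𝓡] with x hx
    have h1 := (Complex.continuous_ofReal.tendsto _).comp (tendsto_regWeight (μ := μ) hx)
    have h2 : Filter.Tendsto (fun ε : ℝ => -(ε ^ 2 / (⟪α, x⟫ ^ 2 + ε ^ 2)) / 2)
        (nhdsWithin 0 (Set.Ioi 0)) (nhds 0) := by
      have hx := hx α hα
      have : ContinuousAt (fun ε : ℝ => -(ε ^ 2 / (⟪α, x⟫ ^ 2 + ε ^ 2)) / 2) 0 := by
        refine ContinuousAt.div_const (ContinuousAt.neg (ContinuousAt.div (by fun_prop)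
          (by fun_prop) ?_)) 2
        positivity
      simpa using this.tendsto.mono_left nhdsWithin_le_nhds
    have h3 := h1.mul (((Complex.continuous_ofReal.tendsto _).comp h2).mul_const (Q x))
    simpa using h3

theorem integral_regWeight_parts (h𝓡 : IsRootSystem 𝓡) (hμ : IsMultiplicity 𝓡 μ) {ε : ℝ}
    (hε : 0 < ε) (hε1 : ε ≤ 1) (ξ : ConfigSpace N) {H : ConfigSpace N → ℂ} (hH : ExpBounded H)
    (hH' : ExpBounded (fderiv ℝ H)) (hHd : Differentiable ℝ H) :
    ∫ x, (regWeight 𝓡 μ ε x : ℂ) * fderiv ℝ H x ξ =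
      -∫ x, (regWeight 𝓡 μ ε x : ℂ) * (((-⟪ξ, x⟫ + ∑ α ∈ 𝓡, μ α * ⟪α, ξ⟫ *
        (⟪α, x⟫ / (⟪α, x⟫ ^ 2 + ε ^ 2)) : ℝ) : ℂ) * H x) := by
  have hmain := integral_bilinear_hasLineDerivAt_right_eq_neg_left_of_integrable
    (μ := (volume : Measure (ConfigSpace N))) (v := ξ) (B := ContinuousLinearMap.mul ℝ ℂ)
    (f := fun x => (regWeight 𝓡 μ ε x : ℂ))
    (f' := fun x => ((regWeight 𝓡 μ ε x * (-⟪ξ, x⟫ +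
      ∑ α ∈ 𝓡, μ α * ⟪α, ξ⟫ * (⟪α, x⟫ / (⟪α, x⟫ ^ 2 + ε ^ 2))) : ℝ) : ℂ)) (g := H)
    (g' := fun x => fderiv ℝ H x ξ) ?_ ?_ ?_ ?_ ?_
  · simp only [ContinuousLinearMap.mul_apply', Complex.ofReal_mul, mul_assoc] at hmain
    simpa only [Complex.ofReal_mul, mul_assoc] using hmain
  · have h4 := hHd.continuous.measurable
    refine (integrable_regWeight_mul h𝓡 hμ hε hε1
      ((expBounded_logDeriv_regWeight (𝓡 := 𝓡) (μ := μ) ξ hε).mul hH) (by fun_prop)).congr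
      (Filter.Eventually.of_forall fun x => ?_)
    simp only [ContinuousLinearMap.mul_apply']
    push_cast
    ring
  · simp only [ContinuousLinearMap.mul_apply']
    exact integrable_regWeight_mul h𝓡 hμ hε hε1 (hH'.clm_apply ξ)
      (measurable_fderiv_apply_const ℝ H ξ)
  · simp only [ContinuousLinearMap.mul_apply']
    exact integrable_regWeight_mul h𝓡 hμ hε hε1 hH hHd.continuous.measurable
  · intro x _
    exact HasDerivAt.ofReal_comp (hasLineDerivAt_regWeight hε ξ x)
  · exact fun x _ => (hHd x).hasFDerivAt.hasLineDerivAt ξ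

/-- Integration by parts: `T_ξ` is formally skew-adjoint for the weight `∏ |⟨α, x⟩|^{μ(α)}`. -/
theorem integral_inner_mul_mul (h𝓡 : IsRootSystem 𝓡) (hμ : IsMultiplicity 𝓡 μ)
    (ξ : ConfigSpace N) (hF : ExpBounded F) (hF' : ExpBounded (fderiv ℝ F))
    (hFd : Differentiable ℝ F) (hG : ExpBounded G) (hG' : ExpBounded (fderiv ℝ G))
    (hGd : Differentiable ℝ G) :
    ∫ x, ((Real.exp (-(1 / 2) * ‖x‖ ^ 2) * rootWeight 𝓡 μ x : ℝ) : ℂ) *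
      (dunklOp 𝓡 μ ξ F x * G x + F x * dunklOp 𝓡 μ ξ G x - (⟪ξ, x⟫ : ℂ) * (F x * G x)) = 0 := by
  have hH := hF.mul hG
  have hH' := hF.fderiv_mul hF' hG hG' hFd hGd
  have hHd : Differentiable ℝ fun x => F x * G x := hFd.mul hGd
  have hFm := hFd.continuous.measurable
  have hGm := hGd.continuous.measurable
  have hdF : ∀ α, Measurable (diffQuot α F) := fun α => measurable_diffQuot α hFd.continuous
  have hdG : ∀ α, Measurable (diffQuot α G) := fun α => measurable_diffQuot α hGd.continuous
  have hev : ∀ᶠ ε : ℝ in nhdsWithin 0 (Set.Ioi 0), ε ∈ Set.Ioo (0 : ℝ) 1 :=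
    Ioo_mem_nhdsGT one_pos
  have hopb : ∀ {F : ConfigSpace N → ℂ}, ExpBounded (fderiv ℝ F) → Differentiable ℝ F →
      ExpBounded (dunklOp 𝓡 μ ξ F) := fun hF' hFd =>
    (hF'.clm_apply ξ).add ((ExpBounded.sum fun α hα =>
      (hF'.diffQuot (h𝓡.norm_sq α hα) hFd).const_mul _).const_mul _)
  have hopm : ∀ {F : ConfigSpace N → ℂ}, Differentiable ℝ F → Measurable (dunklOp 𝓡 μ ξ F) := by
    intro F hFd
    exact (measurable_fderiv_apply_const ℝ F ξ).add ((Finset.measurable_fun_sum _ fun α _ =>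
      (measurable_diffQuot α hFd.continuous).const_mul _).const_mul _)
  have hFo := hopm hFd
  have hGo := hopm hGd
  have hlim := tendsto_integral_regWeight h𝓡 hμ
    (((hopb hF' hFd).mul hG).add (hF.mul (hopb hG' hGd)) |>.sub ((ExpBounded.inner ξ).mul hH))
    (by fun_prop)
  -- For each small `ε` the regularized integral equals a linear combination of the root terms, all
  -- of which tend to `0`.
  refine tendsto_nhds_unique hlim ?_
  have hsum := tendsto_finsetSum 𝓡 fun α hα =>
    (tendsto_integral_root_term h𝓡 hμ hα hF hF' hFd hG hG' hGd).const_mul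
      (-((μ α * ⟪α, ξ⟫ : ℝ) : ℂ))
  simp only [mul_zero, Finset.sum_const_zero] at hsum
  refine hsum.congr' ?_
  filter_upwards [hev] with ε hε
  have hu := fun α : ConfigSpace N => expBounded_inner_div α hε.1
  have hparts := integral_regWeight_parts h𝓡 hμ hε.1 hε.2.le ξ hH hH' hHd
  have hI : ∀ {f : ConfigSpace N → ℂ}, ExpBounded f → Measurable f →
      Integrable fun x => (regWeight 𝓡 μ ε x : ℂ) * f x :=
    fun hf hfm => integrable_regWeight_mul h𝓡 hμ hε.1 hε.2.le hf hfm
  simp_rw [← integral_const_mul]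
  have hterm : ∀ α ∈ 𝓡, ExpBounded fun x => F x * G x * ((⟪α, x⟫ / (⟪α, x⟫ ^ 2 + ε ^ 2) : ℝ) : ℂ) -
        1 / 2 * (diffQuot α F x * G x + F x * diffQuot α G x) := fun α hα =>
    (hH.mul (hu α)).sub ((((hF'.diffQuot (h𝓡.norm_sq α hα) hFd).mul hG).add
        (hF.mul (hG'.diffQuot (h𝓡.norm_sq α hα) hGd))).const_mul _)
  have htermm : ∀ α ∈ 𝓡, Measurable fun x => F x * G x *
      ((⟪α, x⟫ / (⟪α, x⟫ ^ 2 + ε ^ 2) : ℝ) : ℂ) -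
        1 / 2 * (diffQuot α F x * G x + F x * diffQuot α G x) := by
    intro α _
    have := hdF α
    have := hdG α
    fun_prop
  rw [← integral_finsetSum _ fun α hα => (hI (hterm α hα) (htermm α hα)).const_mul _]
  have hsb := expBounded_logDeriv_regWeight (𝓡 := 𝓡) (μ := μ) ξ hε.1
  have hsm : Measurable fun x : ConfigSpace N => ((-⟪ξ, x⟫ + ∑ α ∈ 𝓡, μ α * ⟪α, ξ⟫ *
        (⟪α, x⟫ / (⟪α, x⟫ ^ 2 + ε ^ 2)) : ℝ) : ℂ) := by fun_prop
  -- Ordinary integration by parts against the smooth weight. Putting this integral in place of `0`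
  -- reduces the claim to a pointwise identity of integrands.
  have hzero : ∫ x, ((regWeight 𝓡 μ ε x : ℂ) * fderiv ℝ (fun x => F x * G x) x ξ +
      (regWeight 𝓡 μ ε x : ℂ) * (((-⟪ξ, x⟫ + ∑ α ∈ 𝓡, μ α * ⟪α, ξ⟫ *
        (⟪α, x⟫ / (⟪α, x⟫ ^ 2 + ε ^ 2)) : ℝ) : ℂ) * (F x * G x))) = 0 := by
    rw [integral_add (hI (hH'.clm_apply ξ) (measurable_fderiv_apply_const ℝ _ ξ))
      (hI (hsb.mul hH) (by fun_prop)), hparts, neg_add_cancel]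
  rw [eq_comm, ← sub_eq_zero, ← hzero, ← integral_sub]
  · congr 1
    ext x
    have hfd : fderiv ℝ (fun x => F x * G x) x ξ = F x * fderiv ℝ G x ξ + G x * fderiv ℝ F x ξ := by
      rw [fderiv_fun_mul (hFd x) (hGd x)]
      simp
    have hs : ∑ α ∈ 𝓡, -((μ α * ⟪α, ξ⟫ : ℝ) : ℂ) * ((regWeight 𝓡 μ ε x : ℂ) *
        (F x * G x * ((⟪α, x⟫ / (⟪α, x⟫ ^ 2 + ε ^ 2) : ℝ) : ℂ) -
          1 / 2 * (diffQuot α F x * G x + F x * diffQuot α G x))) =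
        (regWeight 𝓡 μ ε x : ℂ) * (-(∑ α ∈ 𝓡, ((μ α * ⟪α, ξ⟫ *
          (⟪α, x⟫ / (⟪α, x⟫ ^ 2 + ε ^ 2)) : ℝ) : ℂ)) * (F x * G x) +
          1 / 2 * ((∑ α ∈ 𝓡, (μ α : ℂ) * (⟪α, ξ⟫ : ℂ) * diffQuot α F x) * G x +
            F x * ∑ α ∈ 𝓡, (μ α : ℂ) * (⟪α, ξ⟫ : ℂ) * diffQuot α G x)) := by
      rw [Finset.sum_mul, Finset.mul_sum, ← Finset.sum_add_distrib, Finset.mul_sum,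
        ← Finset.sum_neg_distrib, Finset.sum_mul, ← Finset.sum_add_distrib, Finset.mul_sum]
      refine Finset.sum_congr rfl fun α _ => ?_
      push_cast
      ring
    rw [hs, hfd, dunklOp, dunklOp]
    push_cast
    ring
  · exact hI (((hopb hF' hFd).mul hG).add (hF.mul (hopb hG' hGd)) |>.sub
      ((ExpBounded.inner ξ).mul hH)) (by fun_prop)
  · exact integrable_finsetSum _ fun α hα => (hI (hterm α hα) (htermm α hα)).const_mul _

end

section

/-! ### The Gaussian integral of two Dunkl kernels -/

variable {N : ℕ} {𝓡 : Finset (ConfigSpace N)} {μ : ConfigSpace N → ℝ}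

/-- The Cauchy estimate for the derivative of an entire function. -/
theorem norm_fderiv_le_of_forall_closedBall {V : Type*} [NormedAddCommGroup V] [NormedSpace ℂ V]
    {f : V → ℂ} (hf : Differentiable ℂ f) {x : V} {M : ℝ}
    (hM : ∀ y, ‖y‖ ≤ ‖x‖ + 1 → ‖f y‖ ≤ M) : ‖fderiv ℂ f x‖ ≤ M := by
  have hM0 : 0 ≤ M := (norm_nonneg _).trans (hM x (by linarith))
  refine ContinuousLinearMap.opNorm_le_bound _ hM0 fun v => ?_
  rcases eq_or_ne v 0 with rfl | hv
  · simp
  have hv' : 0 < ‖v‖ := norm_pos_iff.mpr hv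
  have h1 : HasDerivAt (fun s : ℂ => x + s • v) v 0 := by
    simpa using ((hasDerivAt_id (0 : ℂ)).smul_const v).const_add x
  have h2 := (hf (x + (0 : ℂ) • v)).hasFDerivAt.comp_hasDerivAt (0 : ℂ) h1
  rw [zero_smul, add_zero] at h2
  have h3 : Differentiable ℂ (f ∘ fun s : ℂ => x + s • v) := hf.comp (by fun_prop)
  -- The radius `‖v‖⁻¹` keeps `x + s • v` within distance `1` of `x` and produces the bound `M *
  -- ‖v‖`.
  have h4 := Complex.norm_deriv_le_of_forall_mem_sphere_norm_le (c := 0) (C := M)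
    (inv_pos.mpr hv') h3.diffContOnCl fun s hs => hM _ <| by
      have hs' : ‖s‖ = ‖v‖⁻¹ := by simpa using hs
      refine (norm_add_le _ _).trans (add_le_add le_rfl ?_)
      rw [norm_smul, hs', inv_mul_cancel₀ hv'.ne']
  rw [h2.deriv] at h4
  simpa using h4

namespace IsEulerSolution

/-- Multiplication by a Gaussian in the Euler equation. -/
theorem gaussian_mul (h𝓡 : IsRootSystem 𝓡) {b U : PhaseSpace N → ℂ}
    (h : IsEulerSolution 𝓡 μ (fun x => holoSq x + b x) U) :
    IsEulerSolution 𝓡 μ b (fun x => Complex.exp (-holoSq x / 2) * U x) where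
  continuous := by
    have := (differentiable_holoSq (N := N)).continuous
    have := h.continuous
    fun_prop
  hasDerivAt x := by
    have e : ∀ t : ℝ, holoSq (t • x) = (t : ℂ) ^ 2 * holoSq x := by
      intro t
      simp [holoSq, mul_pow, Finset.mul_sum]
    have h0 : HasDerivAt (fun t : ℝ => (t : ℂ) ^ 2 * holoSq x) (2 * holoSq x) 1 := by
      have : HasDerivAt (fun t : ℝ => (t : ℂ)) 1 1 := Complex.ofRealCLM.hasDerivAt
      simpa using (this.pow 2).mul_const (holoSq x)
    have h1 : HasDerivAt (fun t : ℝ => Complex.exp (-holoSq (t • x) / 2))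
        (Complex.exp (-holoSq x / 2) * -holoSq x) 1 := by
      simp only [e]
      refine (h0.neg.div_const 2).cexp.congr_deriv ?_
      simp
      ring_nf
    refine (h1.mul (h.hasDerivAt x)).congr_deriv ?_
    simp only [one_smul]
    -- Reflections preserve `holoSq`, so the Gaussian factors out of the difference terms; its
    -- radial derivative cancels the `holoSq x` in the coefficient.
    have hs : ∑ α ∈ 𝓡, ((μ α / 2 : ℝ) : ℂ) * (Complex.exp (-holoSq x / 2) * U x -
        Complex.exp (-holoSq (phaseRefl α x) / 2) * U (phaseRefl α x)) =
        Complex.exp (-holoSq x / 2) *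
          ∑ α ∈ 𝓡, ((μ α / 2 : ℝ) : ℂ) * (U x - U (phaseRefl α x)) := by
      rw [Finset.mul_sum]
      refine Finset.sum_congr rfl fun α hα => ?_
      rw [holoSq_phaseRefl (h𝓡.norm_sq α hα)]
      ring
    rw [hs]
    ring

end IsEulerSolution

/-- The Gaussian integral of the product of two functions on `ℝ^N`. -/
noncomputable def gaussianWeight (𝓡 : Finset (ConfigSpace N)) (μ : ConfigSpace N → ℝ)
    (x : ConfigSpace N) : ℝ := Real.exp (-(1 / 2) * ‖x‖ ^ 2) * rootWeight 𝓡 μ x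

theorem measurable_gaussianWeight : Measurable (gaussianWeight 𝓡 μ) := by
  have := measurable_rootWeight (𝓡 := 𝓡) (μ := μ)
  unfold gaussianWeight
  fun_prop

theorem gaussianWeight_le (h𝓡 : IsRootSystem 𝓡) (hμ : IsMultiplicity 𝓡 μ) (x : ConfigSpace N) :
    ‖gaussianWeight 𝓡 μ x‖ ≤ Real.exp (-(1 / 2) * ‖x‖ ^ 2 + (∑ α ∈ 𝓡, μ α) * ‖x‖) :=
  gaussian_mul_rootWeight_le h𝓡 hμ _ x

theorem ExpBounded.integrable_gaussianWeight (h𝓡 : IsRootSystem 𝓡) (hμ : IsMultiplicity 𝓡 μ)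
    {f : ConfigSpace N → ℂ} (hf : ExpBounded f) (hfc : Continuous f) :
    Integrable fun x => (gaussianWeight 𝓡 μ x : ℂ) * f x :=
  hf.integrable_mul hfc.aestronglyMeasurable measurable_gaussianWeight.aestronglyMeasurable
    (by norm_num) (gaussianWeight_le h𝓡 hμ)

theorem toPhase_eq_sum (x : ConfigSpace N) (z : PhaseSpace N) :
    bil z (toPhase x) = ∑ i, z i * (⟪EuclideanSpace.single i (1 : ℝ), x⟫ : ℂ) := by
  simp [bil, EuclideanSpace.inner_single_left]

theorem bil_single (i : Fin N) (z : PhaseSpace N) :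
    bil (toPhase (EuclideanSpace.single i (1 : ℝ))) z = z i := by
  rw [bil, Finset.sum_eq_single i]
  · simp
  · intro j _ hj
    simp [hj]
  · simp

namespace IsDunklKernel

variable {E : PhaseSpace N → PhaseSpace N → ℂ}

theorem differentiable_toPhase (hE : IsDunklKernel 𝓡 μ E) (z : PhaseSpace N) :
    Differentiable ℝ fun q => E (toPhase q) z := fun q =>
  ((hE.differentiable_fst z (toPhase q)).restrictScalars ℝ).comp q
    (phaseEmbedding N).toContinuousLinearMap.differentiableAt

theorem continuous_snd_toPhase (hE : IsDunklKernel 𝓡 μ E) (z : PhaseSpace N) :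
    Continuous fun q => E z (toPhase q) :=
  (hE.differentiable_snd z).continuous.comp continuous_toPhase

variable (h𝓡 : IsRootSystem 𝓡) (hμ : IsMultiplicity 𝓡 μ) (hE : IsDunklKernel 𝓡 μ E)

include h𝓡 hμ hE

theorem expBounded_snd (z : PhaseSpace N) : ExpBounded fun q => E z (toPhase q) :=
  ⟨1, ‖z‖, zero_le_one, norm_nonneg z, fun q => by simpa using hE.norm_le h𝓡 hμ z (toPhase q)⟩

theorem norm_fderiv_fst_le (x y : PhaseSpace N) :
    ‖fderiv ℂ (fun x' => E x' y) x‖ ≤ Real.exp ((‖x‖ + 1) * ‖y‖) :=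
  norm_fderiv_le_of_forall_closedBall (hE.differentiable_fst y) fun x' hx' =>
    (hE.norm_le h𝓡 hμ x' y).trans (Real.exp_le_exp.mpr (by gcongr))

theorem expBounded_fderiv (z : PhaseSpace N) :
    ExpBounded (fderiv ℝ fun q => E (toPhase q) z) := by
  refine ⟨Real.exp ‖z‖, ‖z‖, (Real.exp_pos _).le, norm_nonneg z, fun q => ?_⟩
  refine ContinuousLinearMap.opNorm_le_bound _ (by positivity) fun v => ?_
  rw [hE.fderiv_toPhase]
  refine (ContinuousLinearMap.le_opNorm _ _).trans ?_
  rw [norm_toPhase]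
  gcongr
  refine (hE.norm_fderiv_fst_le h𝓡 hμ _ _).trans (le_of_eq ?_)
  rw [← Real.exp_add, norm_toPhase]
  ring_nf

/-- The two kernels are eigenfunctions of `T_ξ`, so skew-adjointness turns multiplication by `⟪ξ,
q⟫` into the sum of the eigenvalues. The eigenvalue equation is needed only almost everywhere. -/
theorem integral_inner_mul (ξ : ConfigSpace N) (z w : PhaseSpace N) :
    ∫ q, (gaussianWeight 𝓡 μ q : ℂ) * ((⟪ξ, q⟫ : ℂ) * (E z (toPhase q) * E w (toPhase q))) =
      (bil (toPhase ξ) z + bil (toPhase ξ) w) *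
        ∫ q, (gaussianWeight 𝓡 μ q : ℂ) * (E z (toPhase q) * E w (toPhase q)) := by
  have hb : ∀ z, ExpBounded fun q => E (toPhase q) z := fun z => by
    simpa only [hE.symm h𝓡 hμ _ z] using hE.expBounded_snd h𝓡 hμ z
  have h := integral_inner_mul_mul h𝓡 hμ ξ (hb z) (hE.expBounded_fderiv h𝓡 hμ z)
    (hE.differentiable_toPhase z) (hb w) (hE.expBounded_fderiv h𝓡 hμ w)
    (hE.differentiable_toPhase w)
  have hI1 := ((hE.expBounded_snd h𝓡 hμ z).mul
    (hE.expBounded_snd h𝓡 hμ w)).integrable_gaussianWeight h𝓡 hμ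
    ((hE.continuous_snd_toPhase z).mul (hE.continuous_snd_toPhase w))
  have hI2 := ((ExpBounded.inner ξ).mul ((hE.expBounded_snd h𝓡 hμ z).mul
    (hE.expBounded_snd h𝓡 hμ w))).integrable_gaussianWeight h𝓡 hμ
    ((by fun_prop : Continuous fun q : ConfigSpace N => (⟪ξ, q⟫ : ℂ)).mul
      ((hE.continuous_snd_toPhase z).mul (hE.continuous_snd_toPhase w)))
  rw [← integral_const_mul, ← sub_eq_zero, ← integral_sub hI2 (hI1.const_mul _),
    ← neg_eq_zero, ← integral_neg, ← h]
  refine integral_congr_ae ?_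
  filter_upwards [ae_inner_ne_zero h𝓡] with q hq
  rw [hE.dunklOp_toPhase ξ q hq, hE.dunklOp_toPhase ξ q hq, hE.symm h𝓡 hμ _ z,
    hE.symm h𝓡 hμ _ w, gaussianWeight]
  ring

/-- Radial differentiation under the integral produces the factor `bil z q` and the reflection
terms. By `integral_inner_mul`, each coordinate `qᵢ` acts as `zᵢ + wᵢ`, and `∑ zᵢ (zᵢ + wᵢ)` is the
stated coefficient. -/
theorem isEulerSolution_integral (w : PhaseSpace N) :
    IsEulerSolution 𝓡 μ (fun z => holoSq z + bil z w)
      (fun z => ∫ q, (gaussianWeight 𝓡 μ q : ℂ) * (E z (toPhase q) * E w (toPhase q))) := by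
  have hwm := measurable_gaussianWeight (𝓡 := 𝓡) (μ := μ)
  have hc := hE.continuous_snd_toPhase
  have hnorm : ∀ (R : ℝ) (q : ConfigSpace N) (a : ℂ), ‖a‖ ≤ Real.exp (R * ‖q‖) →
      ‖(gaussianWeight 𝓡 μ q : ℂ) * (a * E w (toPhase q))‖ ≤
        Real.exp (-(1 / 2) * ‖q‖ ^ 2 + ((∑ α ∈ 𝓡, μ α) + R + ‖w‖) * ‖q‖) := by
    intro R q a ha
    have h1 := gaussianWeight_le h𝓡 hμ q
    have h2 := hE.norm_le h𝓡 hμ w (toPhase q)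
    rw [norm_toPhase] at h2
    rw [norm_mul, norm_mul, Complex.norm_real]
    calc _ ≤ Real.exp (-(1 / 2) * ‖q‖ ^ 2 + (∑ α ∈ 𝓡, μ α) * ‖q‖) *
          (Real.exp (R * ‖q‖) * Real.exp (‖w‖ * ‖q‖)) := by gcongr
      _ = _ := by
        rw [← Real.exp_add, ← Real.exp_add]
        ring_nf
  refine ⟨continuous_iff_continuousAt.mpr fun z₀ => ?_, fun z => ?_⟩
  · refine continuousAt_of_dominated (bound := fun q =>
      Real.exp (-(1 / 2) * ‖q‖ ^ 2 + ((∑ α ∈ 𝓡, μ α) + (‖z₀‖ + 1) + ‖w‖) * ‖q‖)) ?_ ?_ ?_ ?_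
    · refine Filter.Eventually.of_forall fun z => ?_
      exact ((Complex.measurable_ofReal.comp hwm).mul
        ((hc z).measurable.mul (hc w).measurable)).aestronglyMeasurable
    · filter_upwards [Metric.closedBall_mem_nhds z₀ one_pos] with z hz
      refine Filter.Eventually.of_forall fun q => hnorm _ q _ ?_
      refine (hE.norm_le h𝓡 hμ z (toPhase q)).trans (Real.exp_le_exp.mpr ?_)
      rw [norm_toPhase]
      rw [mem_closedBall_iff_norm] at hz
      gcongr
      calc ‖z‖ = ‖z₀ + (z - z₀)‖ := by congr 1; abel
        _ ≤ _ := by linarith [norm_add_le z₀ (z - z₀)]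
    · exact integrable_exp_neg_mul_sq_norm_add (by norm_num)
    · refine Filter.Eventually.of_forall fun q => ?_
      have := (hE.differentiable_fst (toPhase q)).continuous
      exact (by fun_prop : Continuous _).continuousAt
  · have hder : ∀ (q : ConfigSpace N) (t : ℝ), HasDerivAt (fun t : ℝ => E (t • z) (toPhase q))
        (fderiv ℂ (fun x => E x (toPhase q)) (t • z) z) t := by
      intro q t
      have h1 := ((hE.differentiable_fst (toPhase q) (t • z)).hasFDerivAt).restrictScalars ℝ
      have h2 : HasDerivAt (fun t : ℝ => t • z) z t := by
        simpa using (hasDerivAt_id t).smul_const z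
      exact h1.comp_hasDerivAt t h2
    have hder1 : ∀ q : ConfigSpace N, fderiv ℂ (fun x => E x (toPhase q)) ((1 : ℝ) • z) z =
        bil z (toPhase q) * E z (toPhase q) - ∑ α ∈ 𝓡, ((μ α / 2 : ℝ) : ℂ) *
          (E z (toPhase q) - E (phaseRefl α z) (toPhase q)) := fun q =>
      (hder q 1).unique ((hE.isEulerSolution h𝓡 (toPhase q)).hasDerivAt z)
    have hmain := (hasDerivAt_integral_of_dominated_loc_of_deriv_le
      (μ := (volume : Measure (ConfigSpace N))) (𝕜 := ℝ) (x₀ := (1 : ℝ))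
      (F := fun t q => (gaussianWeight 𝓡 μ q : ℂ) * (E (t • z) (toPhase q) * E w (toPhase q)))
      (F' := fun t q => (gaussianWeight 𝓡 μ q : ℂ) *
        (fderiv ℂ (fun x => E x (toPhase q)) (t • z) z * E w (toPhase q)))
      -- For `|t - 1| < 1` one has `‖t • z‖ ≤ 2‖z‖`; the additional `1` is the radius used in
      -- Cauchy's estimate for the derivative of the kernel.
      (bound := fun q => ‖z‖ * Real.exp (-(1 / 2) * ‖q‖ ^ 2 +
        ((∑ α ∈ 𝓡, μ α) + (2 * ‖z‖ + 1) + ‖w‖) * ‖q‖))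
      (Metric.ball_mem_nhds 1 one_pos) ?_ ?_ ?_ ?_ ?_ ?_).2
    · refine hmain.congr_deriv ?_
      have hI : ∀ z, Integrable fun q => (gaussianWeight 𝓡 μ q : ℂ) *
          (E z (toPhase q) * E w (toPhase q)) := fun z =>
        ((hE.expBounded_snd h𝓡 hμ z).mul (hE.expBounded_snd h𝓡 hμ w)).integrable_gaussianWeight
          h𝓡 hμ ((hc z).mul (hc w))
      have hIi : ∀ i : Fin N, Integrable fun q => (gaussianWeight 𝓡 μ q : ℂ) *
          ((⟪EuclideanSpace.single i (1 : ℝ), q⟫ : ℂ) * (E z (toPhase q) * E w (toPhase q))) :=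
        fun i => ((ExpBounded.inner _).mul ((hE.expBounded_snd h𝓡 hμ z).mul
          (hE.expBounded_snd h𝓡 hμ w))).integrable_gaussianWeight h𝓡 hμ
          ((by fun_prop : Continuous fun q : ConfigSpace N =>
            (⟪EuclideanSpace.single i (1 : ℝ), q⟫ : ℂ)).mul ((hc z).mul (hc w)))
      have hsplit : ∀ q : ConfigSpace N, (gaussianWeight 𝓡 μ q : ℂ) *
          (fderiv ℂ (fun x => E x (toPhase q)) ((1 : ℝ) • z) z * E w (toPhase q)) =
          (∑ i, z i * ((gaussianWeight 𝓡 μ q : ℂ) *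
            ((⟪EuclideanSpace.single i (1 : ℝ), q⟫ : ℂ) * (E z (toPhase q) * E w (toPhase q))))) -
          ∑ α ∈ 𝓡, ((μ α / 2 : ℝ) : ℂ) *
            ((gaussianWeight 𝓡 μ q : ℂ) * (E z (toPhase q) * E w (toPhase q)) -
            (gaussianWeight 𝓡 μ q : ℂ) * (E (phaseRefl α z) (toPhase q) * E w (toPhase q))) := by
        intro q
        have e1 : ∑ i, z i * ((gaussianWeight 𝓡 μ q : ℂ) *
            ((⟪EuclideanSpace.single i (1 : ℝ), q⟫ : ℂ) * (E z (toPhase q) * E w (toPhase q)))) =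
            bil z (toPhase q) * ((gaussianWeight 𝓡 μ q : ℂ) *
              (E z (toPhase q) * E w (toPhase q))) := by
          rw [toPhase_eq_sum, Finset.sum_mul]
          exact Finset.sum_congr rfl fun i _ => by ring
        have e2 : ∑ α ∈ 𝓡, ((μ α / 2 : ℝ) : ℂ) *
            ((gaussianWeight 𝓡 μ q : ℂ) * (E z (toPhase q) * E w (toPhase q)) -
            (gaussianWeight 𝓡 μ q : ℂ) * (E (phaseRefl α z) (toPhase q) * E w (toPhase q))) =
            (∑ α ∈ 𝓡, ((μ α / 2 : ℝ) : ℂ) *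
              (E z (toPhase q) - E (phaseRefl α z) (toPhase q))) *
              ((gaussianWeight 𝓡 μ q : ℂ) * E w (toPhase q)) := by
          rw [Finset.sum_mul]
          exact Finset.sum_congr rfl fun α _ => by ring
        rw [hder1, e1, e2]
        ring
      simp_rw [hsplit]
      have hIs : ∀ α ∈ 𝓡, Integrable fun q => ((μ α / 2 : ℝ) : ℂ) *
          ((gaussianWeight 𝓡 μ q : ℂ) * (E z (toPhase q) * E w (toPhase q)) -
          (gaussianWeight 𝓡 μ q : ℂ) * (E (phaseRefl α z) (toPhase q) * E w (toPhase q))) :=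
        fun α _ => ((hI z).sub (hI _)).const_mul _
      rw [integral_sub (integrable_finsetSum _ fun i _ => (hIi i).const_mul _)
        (integrable_finsetSum _ hIs), integral_finsetSum _ fun i _ => (hIi i).const_mul _,
        integral_finsetSum _ hIs]
      simp_rw [integral_const_mul, hE.integral_inner_mul h𝓡 hμ, bil_single]
      congr 1
      · rw [← bil_self, bil, bil, ← Finset.sum_add_distrib, Finset.sum_mul]
        exact Finset.sum_congr rfl fun i _ => by ring
      · exact Finset.sum_congr rfl fun α _ => by rw [integral_sub (hI z) (hI _)]
    · refine Filter.Eventually.of_forall fun t => ?_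
      exact ((Complex.measurable_ofReal.comp hwm).mul
        ((hc (t • z)).measurable.mul (hc w).measurable)).aestronglyMeasurable
    · exact ((hE.expBounded_snd h𝓡 hμ _).mul
        (hE.expBounded_snd h𝓡 hμ w)).integrable_gaussianWeight h𝓡 hμ ((hc _).mul (hc w))
    · simp_rw [hder1]
      have h2 := ((differentiable_bil_right z).continuous.comp continuous_toPhase).measurable
      exact ((Complex.measurable_ofReal.comp hwm).mul (((h2.mul (hc z).measurable).sub
        (Finset.measurable_fun_sum _ fun α _ => ((hc z).measurable.sub
          (hc _).measurable).const_mul _)).mul (hc w).measurable)).aestronglyMeasurable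
    · refine Filter.Eventually.of_forall fun q t ht => ?_
      have h1 : ‖t • z‖ ≤ 2 * ‖z‖ := by
        rw [norm_smul]
        rw [Metric.mem_ball, Real.dist_eq, abs_lt] at ht
        have : ‖t‖ ≤ 2 := by rw [Real.norm_eq_abs, abs_le]; constructor <;> linarith
        gcongr
      rcases eq_or_ne z 0 with rfl | hz
      · simp
      have hz' : 0 < ‖z‖ := norm_pos_iff.mpr hz
      have h2 := hnorm (2 * ‖z‖ + 1) q
        ((‖z‖ : ℂ)⁻¹ * fderiv ℂ (fun x => E x (toPhase q)) (t • z) z) ?_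
      · rw [show (gaussianWeight 𝓡 μ q : ℂ) *
          (fderiv ℂ (fun x => E x (toPhase q)) (t • z) z * E w (toPhase q)) = (‖z‖ : ℂ) *
            ((gaussianWeight 𝓡 μ q : ℂ) * ((‖z‖ : ℂ)⁻¹ *
              fderiv ℂ (fun x => E x (toPhase q)) (t • z) z * E w (toPhase q))) by
          have : (‖z‖ : ℂ) ≠ 0 := by exact_mod_cast hz'.ne'
          field_simp, norm_mul, Complex.norm_real, norm_norm]
        gcongr
      · rw [norm_mul, norm_inv, Complex.norm_real, norm_norm, inv_mul_le_iff₀ hz']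
        refine (ContinuousLinearMap.le_opNorm _ _).trans ?_
        rw [mul_comm]
        gcongr
        refine (hE.norm_fderiv_fst_le h𝓡 hμ _ _).trans (Real.exp_le_exp.mpr ?_)
        rw [norm_toPhase]
        gcongr
    · exact (integrable_exp_neg_mul_sq_norm_add (by norm_num)).const_mul _
    · exact Filter.Eventually.of_forall fun q t _ => ((hder q t).mul_const _).const_mul _

/-- The Gaussian integral of the product of two Dunkl kernels. -/
theorem integral_gaussian_mul (z w : PhaseSpace N) :
    ∫ q, (gaussianWeight 𝓡 μ q : ℂ) * (E z (toPhase q) * E w (toPhase q)) =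
      Complex.exp (holoSq z / 2 + holoSq w / 2) * E z w *
        ∫ q, (gaussianWeight 𝓡 μ q : ℂ) := by
  -- Without its Gaussian factor the integral solves the equation of `E(·, w)`, hence is a multiple
  -- of it; the multiple is read off at `z = 0`.
  have key : ∀ z w, ∫ q, (gaussianWeight 𝓡 μ q : ℂ) * (E z (toPhase q) * E w (toPhase q)) =
      Complex.exp (holoSq z / 2) * E z w * ∫ q, (gaussianWeight 𝓡 μ q : ℂ) * E w (toPhase q) := by
    intro z w
    have h := ((hE.isEulerSolution_integral h𝓡 hμ w).gaussian_mul h𝓡).unique h𝓡 hμ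
      ((hE.isEulerSolution h𝓡 w).const_mul (∫ q, (gaussianWeight 𝓡 μ q : ℂ) * E w (toPhase q)))
      (fun x => norm_bil_le_right x w) (by simp [hE.zero_left, holoSq])
    have h' := congrFun h z
    beta_reduce at h'
    rw [mul_assoc, mul_comm (E z w), ← h', ← mul_assoc, ← Complex.exp_add]
    simp [neg_div]
  have h1 : ∀ w, E w 0 = 1 := fun w => by rw [hE.symm h𝓡 hμ, hE.zero_left]
  -- The remaining integral has a single kernel, so the same formula with second parameter `0`
  -- evaluates it.
  have h0 := key w 0
  simp only [h1, mul_one] at h0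
  have h00 : ∀ q : ConfigSpace N, E 0 (toPhase q) = 1 := fun q => hE.zero_left _
  simp only [h00, mul_one] at h0
  rw [key z w, h0, Complex.exp_add]
  ring

end IsDunklKernel

end

section

/-! ### Hilbert spaces with a Gram kernel -/

/-- The quadratic form of a Gram kernel is the squared norm of the corresponding linear combination
of the vectors `v x`. -/
theorem posSemidef_of_gram {X H : Type*} [NormedAddCommGroup H] [InnerProductSpace ℂ H]
    (v : X → H) {K : Matrix X X (ℂ →L[ℂ] ℂ)}
    (hK : ∀ x y, K x y = (inner ℂ (v x) (v y)) • ContinuousLinearMap.id ℂ ℂ) : K.PosSemidef := by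
  have happ : ∀ x y a, K x y a = inner ℂ (v x) (v y) * a := fun x y a => by simp [hK]
  have ht := (RKHS.posSemidef_tfae (K := K)).out 0 2
  refine ht.mpr ⟨?_, ?_⟩
  · ext x y
    refine ext_inner_right ℂ fun w => ?_
    rw [Matrix.conjTranspose_apply, ContinuousLinearMap.star_eq_adjoint,
      ContinuousLinearMap.adjoint_inner_left, happ, happ]
    simp [inner_conj_symm, mul_comm]
  · intro f
    have h : (f.sum fun x w => f.sum fun x' w' => inner ℂ (K x' x w) w') =
        inner ℂ (f.sum fun x w => w • v x) (f.sum fun x w => w • v x) := by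
      rw [Finsupp.sum_inner]
      refine Finsupp.sum_congr fun x _ => ?_
      rw [Finsupp.inner_sum]
      simp only [Finsupp.sum]
      refine Finset.sum_congr rfl fun x' _ => ?_
      rw [happ, inner_smul_right, inner_smul_left]
      simp only [RCLike.inner_apply, map_mul, inner_conj_symm]
      ring
    rw [h]
    exact inner_self_nonneg

/-- If the kernel is the Gram matrix of vectors `v x` of a Hilbert space, then `ψ ↦ ⟪v ·, ψ⟫`
is a bounded operator into the reproducing kernel Hilbert space. -/
theorem exists_clm_of_gram {X H : Type*} [NormedAddCommGroup H] [InnerProductSpace ℂ H]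
    [CompleteSpace H] (v : X → H) {K : Matrix X X (ℂ →L[ℂ] ℂ)}
    (hK : ∀ x y, K x y = (inner ℂ (v x) (v y)) • ContinuousLinearMap.id ℂ ℂ)
    [Fact K.PosSemidef] :
    ∃ A : H →L[ℂ] RKHS.OfKernel K, ∀ ψ x, A ψ x = inner ℂ (v x) ψ := by
  let k : X → RKHS.OfKernel K := fun x => RKHS.kerFun (RKHS.OfKernel K) x 1
  have hkk : ∀ x y, inner ℂ (k x) (k y) = inner ℂ (v x) (v y) := by
    intro x y
    have h := RKHS.kernel_inner (RKHS.OfKernel K) y x (1 : ℂ) (1 : ℂ)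
    rw [← h, RKHS.OfKernel.kernel_ofKernel, hK]
    simp [inner_conj_symm]
  -- The families `k` and `v` have the same Gram matrix, so equal combinations have equal norms.
  -- This makes the map `k x ↦ v x` well defined on the span of the `k x`, and by density on the
  -- whole space.
  let e := Finsupp.linearCombination ℂ k
  let f := Finsupp.linearCombination ℂ v
  have hnorm : ∀ c, ‖f c‖ = ‖e c‖ := by
    intro c
    have h : inner ℂ (f c) (f c) = inner ℂ (e c) (e c) := by
      simp only [e, f, Finsupp.linearCombination_apply]
      rw [Finsupp.sum_inner, Finsupp.sum_inner]
      refine Finsupp.sum_congr fun x _ => ?_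
      rw [Finsupp.inner_sum, Finsupp.inner_sum]
      simp only [Finsupp.sum, inner_smul_left, inner_smul_right, hkk]
    rw [inner_self_eq_norm_sq_to_K, inner_self_eq_norm_sq_to_K] at h
    have h' : ‖f c‖ ^ 2 = ‖e c‖ ^ 2 := by exact_mod_cast h
    exact (pow_left_inj₀ (norm_nonneg _) (norm_nonneg _) two_ne_zero).mp h'
  have hdense : DenseRange e := by
    have h1 : Submodule.span ℂ {RKHS.kerFun (RKHS.OfKernel K) x a | (x) (a)} ≤
        LinearMap.range e := by
      rw [Submodule.span_le]
      rintro _ ⟨x, a, rfl⟩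
      refine ⟨Finsupp.single x a, ?_⟩
      simp only [e, k, Finsupp.linearCombination_single, ← map_smul, smul_eq_mul, mul_one]
    have h2 := RKHS.kerFun_dense (RKHS.OfKernel K)
    have h3 : (LinearMap.range e).topologicalClosure = ⊤ :=
      top_le_iff.mp (h2 ▸ Submodule.topologicalClosure_mono h1)
    have h4 := Submodule.dense_iff_topologicalClosure_eq_top.mpr h3
    exact h4
  let J := f.extendOfNorm e
  have hJ : ∀ x, J (k x) = v x := by
    intro x
    have h := LinearMap.extendOfNorm_eq (f := f) hdense ⟨1, fun c => by rw [one_mul, hnorm]⟩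
      (Finsupp.single x 1)
    simpa [e, f] using h
  -- By the reproducing property, evaluation of the adjoint at `x` is pairing with `k x`, that is,
  -- pairing `ψ` with `J (k x) = v x`.
  refine ⟨ContinuousLinearMap.adjoint J, fun ψ x => ?_⟩
  rw [← hJ x, ← ContinuousLinearMap.adjoint_inner_right]
  have h := RKHS.kerFun_inner x (1 : ℂ) (ContinuousLinearMap.adjoint J ψ)
  rw [h]
  simp

/-! ### Rescaling of measures -/

/-- Multiplication by `r^(-1/2)` is unitary from `L²(ν)` to `L²(r ν)`. -/
theorem exists_linearIsometryEquiv_smul_measure {X : Type*} [MeasurableSpace X] {ν ν' : Measure X}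
    {r a : ℝ} (hr : 0 < r) (ha : 0 < a) (hra : r * a ^ 2 = 1) (hν : ν' = ENNReal.ofReal r • ν) :
    ∃ e : Lp ℂ 2 ν ≃ₗᵢ[ℂ] Lp ℂ 2 ν', ∀ φ, e φ =ᵐ[ν'] fun x => (a : ℂ) * φ x := by
  have hr0 : ENNReal.ofReal r ≠ 0 := by simpa using hr
  have hae : ∀ {p : X → Prop}, (∀ᵐ x ∂ν', p x) ↔ ∀ᵐ x ∂ν, p x := by
    intro p
    rw [hν, Measure.ae_ennreal_smul_measure_iff hr0]
  have hmem : ∀ φ : Lp ℂ 2 ν, MemLp (fun x => (a : ℂ) * φ x) 2 ν' := fun φ => by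
    rw [hν]
    exact ((Lp.memLp φ).const_mul _).smul_measure ENNReal.ofReal_ne_top
  have hmem' : ∀ ψ : Lp ℂ 2 ν', MemLp (fun x => (a : ℂ)⁻¹ * ψ x) 2 ν := fun ψ => by
    have h : ν = (ENNReal.ofReal r)⁻¹ • ν' := by
      rw [hν, smul_smul, ENNReal.inv_mul_cancel hr0 ENNReal.ofReal_ne_top, one_smul]
    rw [h]
    exact ((Lp.memLp ψ).const_mul _).smul_measure (ENNReal.inv_ne_top.mpr hr0)
  have hcoe : ∀ φ, (hmem φ).toLp _ =ᵐ[ν'] fun x => (a : ℂ) * φ x := fun φ => MemLp.coeFn_toLp _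
  let L : Lp ℂ 2 ν →ₗᵢ[ℂ] Lp ℂ 2 ν' :=
    { toFun := fun φ => (hmem φ).toLp _
      map_add' := fun φ ψ => by
        refine Lp.ext ?_
        filter_upwards [hcoe (φ + ψ), hcoe φ, hcoe ψ,
          Lp.coeFn_add ((hmem φ).toLp _) ((hmem ψ).toLp _), hae.mpr (Lp.coeFn_add φ ψ)]
          with x h1 h2 h3 h4 h5
        rw [h1, h4, Pi.add_apply, h2, h3, h5, Pi.add_apply, mul_add]
      map_smul' := fun c φ => by
        refine Lp.ext ?_
        filter_upwards [hcoe (c • φ), hcoe φ, Lp.coeFn_smul c ((hmem φ).toLp _),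
          hae.mpr (Lp.coeFn_smul c φ)] with x h1 h2 h4 h5
        rw [h1, RingHom.id_apply, h4, Pi.smul_apply, h2, h5, Pi.smul_apply, smul_eq_mul,
          smul_eq_mul, mul_left_comm]
      norm_map' := fun φ => by
        simp only [LinearMap.coe_mk, AddHom.coe_mk]
        have h1 : ((‖(hmem φ).toLp _‖ : ℂ)) ^ 2 = (‖φ‖ : ℂ) ^ 2 := by
          have e1 := inner_self_eq_norm_sq_to_K (𝕜 := ℂ) ((hmem φ).toLp _)
          have e2 := inner_self_eq_norm_sq_to_K (𝕜 := ℂ) φ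
          simp only [Complex.coe_algebraMap] at e1 e2
          rw [← e1, ← e2, L2.inner_def, L2.inner_def]
          rw [integral_congr_ae (g := fun x => ((a ^ 2 : ℝ) : ℂ) * inner ℂ (φ x) (φ x)) ?_]
          · conv_lhs => rw [hν]
            rw [integral_smul_measure, integral_const_mul, ENNReal.toReal_ofReal hr.le,
              Complex.real_smul, ← mul_assoc, ← Complex.ofReal_mul, hra, Complex.ofReal_one,
              one_mul]
          · filter_upwards [hcoe φ] with x hx
            rw [hx]
            simp only [RCLike.inner_apply, map_mul, Complex.conj_ofReal]
            push_cast
            ring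
        have h2 : ‖(hmem φ).toLp _‖ ^ 2 = ‖φ‖ ^ 2 := by exact_mod_cast h1
        exact (pow_left_inj₀ (norm_nonneg _) (norm_nonneg _) two_ne_zero).mp h2 }
  have hsurj : Function.Surjective L := fun ψ => by
    refine ⟨(hmem' ψ).toLp _, Lp.ext ?_⟩
    filter_upwards [hcoe ((hmem' ψ).toLp _), hae.mpr (MemLp.coeFn_toLp (hmem' ψ))] with x h1 h2
    rw [show L ((hmem' ψ).toLp _) = (hmem ((hmem' ψ).toLp _)).toLp _ from rfl, h1, h2,
      mul_inv_cancel_left₀ (by exact_mod_cast ha.ne')]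
  exact ⟨LinearIsometryEquiv.ofSurjective L hsurj, fun φ => hcoe φ⟩

/-- Composition with an invertible measure preserving map is unitary. -/
theorem exists_linearIsometryEquiv_comp {X Y : Type*} [MeasurableSpace X] [MeasurableSpace Y]
    {ν : Measure X} {ν' : Measure Y} {g : X → Y} {g' : Y → X} (hg : MeasurePreserving g ν ν')
    (hg' : MeasurePreserving g' ν' ν) (h : ∀ x, g' (g x) = x) :
    ∃ e : Lp ℂ 2 ν' ≃ₗᵢ[ℂ] Lp ℂ 2 ν, ∀ φ, e φ =ᵐ[ν] fun x => φ (g x) := by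
  refine ⟨LinearIsometryEquiv.ofSurjective (Lp.compMeasurePreservingₗᵢ ℂ g hg) fun ψ => ?_,
    fun φ => Lp.coeFn_compMeasurePreserving φ hg⟩
  refine ⟨Lp.compMeasurePreserving g' hg' ψ, Lp.ext ?_⟩
  have h1 := Lp.coeFn_compMeasurePreserving (Lp.compMeasurePreserving g' hg' ψ) hg
  have h2 := hg.quasiMeasurePreserving.ae (Lp.coeFn_compMeasurePreserving ψ hg')
  filter_upwards [h1, h2] with x h1 h2
  rw [show Lp.compMeasurePreservingₗᵢ ℂ g hg (Lp.compMeasurePreserving g' hg' ψ) =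
    Lp.compMeasurePreserving g hg (Lp.compMeasurePreserving g' hg' ψ) from rfl, h1,
    Function.comp_apply, h2, Function.comp_apply, h]

/-! ### The weights of the Dunkl setting -/

variable {N : ℕ} {𝓡 : Finset (ConfigSpace N)} {μ : ConfigSpace N → ℝ}

theorem weightTilde_eq (t : ℝ) (x : ConfigSpace N) :
    weightTilde 𝓡 μ t x = t ^ (-(gammaConst 𝓡 μ + N / 2)) * rootWeight 𝓡 μ x := rfl

theorem weightTilde_one (x : ConfigSpace N) : weightTilde 𝓡 μ 1 x = rootWeight 𝓡 μ x := by
  rw [weightTilde_eq, Real.one_rpow, one_mul]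

theorem measureTilde_one : measureTilde 𝓡 μ 1 =
    volume.withDensity fun x => ENNReal.ofReal (rootWeight 𝓡 μ x) := by
  simp only [measureTilde, weightTilde_one]

theorem integral_measureTilde_one (f : ConfigSpace N → ℂ) :
    ∫ x, f x ∂(measureTilde 𝓡 μ 1) = ∫ x, (rootWeight 𝓡 μ x : ℂ) * f x := by
  rw [measureTilde_one, integral_withDensity_eq_integral_toReal_smul
    measurable_rootWeight.ennreal_ofReal (by simp)]
  simp only [ENNReal.toReal_ofReal (rootWeight_nonneg _), Complex.real_smul]

theorem integrable_measureTilde_one {f : ConfigSpace N → ℂ} :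
    Integrable f (measureTilde 𝓡 μ 1) ↔ Integrable fun x => (rootWeight 𝓡 μ x : ℂ) * f x := by
  rw [measureTilde_one, integrable_withDensity_iff_integrable_smul'
    measurable_rootWeight.ennreal_ofReal (by simp)]
  simp only [ENNReal.toReal_ofReal (rootWeight_nonneg _), Complex.real_smul]

theorem ofReal_mehtaConst : (mehtaConst 𝓡 μ : ℂ) = ∫ x, (gaussianWeight 𝓡 μ x : ℂ) := by
  rw [mehtaConst, ← integral_complex_ofReal, integral_measureTilde_one]
  refine integral_congr_ae (Filter.Eventually.of_forall fun x => ?_)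
  simp only [gaussianWeight]
  rw [show -‖x‖ ^ 2 / 2 = -(1 / 2) * ‖x‖ ^ 2 by ring]
  push_cast
  ring

/-- The Gaussian weight is positive off finitely many hyperplanes, hence almost everywhere. -/
theorem mehtaConst_pos (h𝓡 : IsRootSystem 𝓡) (hμ : IsMultiplicity 𝓡 μ) : 0 < mehtaConst 𝓡 μ := by
  have h1 : mehtaConst 𝓡 μ = ∫ x, gaussianWeight 𝓡 μ x := by
    have := ofReal_mehtaConst (𝓡 := 𝓡) (μ := μ)
    rw [integral_complex_ofReal] at this
    exact_mod_cast this
  have hnn : ∀ x, 0 ≤ gaussianWeight 𝓡 μ x := fun x =>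
    mul_nonneg (Real.exp_pos _).le (rootWeight_nonneg x)
  have hint : Integrable (gaussianWeight 𝓡 μ) :=
    (integrable_exp_neg_mul_sq_norm_add (by norm_num)).mono'
      measurable_gaussianWeight.aestronglyMeasurable
      (Filter.Eventually.of_forall (gaussianWeight_le h𝓡 hμ))
  rw [h1, integral_pos_iff_support_of_nonneg hnn hint]
  have hsupp : ∀ᵐ x : ConfigSpace N, x ∈ Function.support (gaussianWeight 𝓡 μ) := by
    filter_upwards [ae_inner_ne_zero h𝓡] with x hx
    have : 0 < rootWeight 𝓡 μ x := Finset.prod_pos fun α hα =>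
      Real.rpow_pos_of_pos (abs_pos.mpr (hx α hα)) _
    exact (mul_pos (Real.exp_pos _) this).ne'
  rw [measure_eq_measure_of_null_sdiff (Set.subset_univ _)
    (by rw [← Set.compl_eq_univ_sdiff]; exact mem_ae_iff.mp hsupp)]
  exact Measure.measure_univ_pos.mpr (NeZero.ne _)

theorem measureOmega_eq_smul (h𝓡 : IsRootSystem 𝓡) (hμ : IsMultiplicity 𝓡 μ) {t : ℝ} (ht : 0 < t) :
    measureOmega 𝓡 μ t =
      ENNReal.ofReal ((mehtaConst 𝓡 μ)⁻¹ * t ^ (-(gammaConst 𝓡 μ + N / 2))) •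
        measureTilde 𝓡 μ 1 := by
  have hc := mehtaConst_pos h𝓡 hμ
  rw [measureTilde_one, ← withDensity_smul _ measurable_rootWeight.ennreal_ofReal, measureOmega]
  congr 1
  ext x
  rw [Pi.smul_apply, smul_eq_mul, ← ENNReal.ofReal_mul (by positivity), weight, weightTilde_eq,
    mul_assoc]

theorem rootWeight_smul {r : ℝ} (hr : 0 < r) (x : ConfigSpace N) :
    rootWeight 𝓡 μ (r • x) = r ^ (2 * gammaConst 𝓡 μ) * rootWeight 𝓡 μ x := by
  have h2 : 2 * gammaConst 𝓡 μ = ∑ α ∈ 𝓡, μ α := by rw [gammaConst]; ring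
  rw [h2, Real.rpow_sum_of_pos hr, rootWeight, rootWeight, ← Finset.prod_mul_distrib]
  refine Finset.prod_congr rfl fun α _ => ?_
  rw [real_inner_smul_right, abs_mul, abs_of_pos hr, Real.mul_rpow hr.le (abs_nonneg _)]

/-- Lebesgue measure contributes `r ^ N` and the root weight `r ^ (2γ)`; both are compensated by the
power `-(γ + N/2)` of `r ^ 2` in the normalization of the weight. -/
theorem measurePreserving_smul {r t : ℝ} (hr : 0 < r) (ht : 0 < t) :
    MeasurePreserving (fun x : ConfigSpace N => r • x) (measureOmega 𝓡 μ t)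
      (measureOmega 𝓡 μ (r ^ 2 * t)) := by
  have hm : Measurable fun x : ConfigSpace N => r • x := measurable_const_smul r
  have hwm : ∀ t, Measurable fun x => ENNReal.ofReal (weight 𝓡 μ t x) := fun t =>
    ((measurable_rootWeight.const_mul _).const_mul _).ennreal_ofReal
  refine ⟨hm, ?_⟩
  have hvol : (volume : Measure (ConfigSpace N)) =
      ENNReal.ofReal (r ^ N) • Measure.map (fun x : ConfigSpace N => r • x) volume := by
    rw [Measure.map_addHaar_smul _ hr.ne', smul_smul, ← ENNReal.ofReal_mul (by positivity)]
    simp [abs_of_pos hr, hr.ne']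
  have hfun : ∀ x, ENNReal.ofReal (r ^ N) * ENNReal.ofReal (weight 𝓡 μ (r ^ 2 * t) (r • x)) =
      ENNReal.ofReal (weight 𝓡 μ t x) := by
    intro x
    rw [← ENNReal.ofReal_mul (by positivity)]
    congr 1
    rw [weight, weight, weightTilde_eq, weightTilde_eq, rootWeight_smul hr,
      Real.mul_rpow (by positivity) ht.le, ← Real.rpow_natCast r 2, ← Real.rpow_mul hr.le,
      ← Real.rpow_natCast r N]
    have : r ^ (N : ℝ) * (r ^ (((2 : ℕ) : ℝ) * (-(gammaConst 𝓡 μ + N / 2))) *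
        r ^ (2 * gammaConst 𝓡 μ)) = 1 := by
      rw [← Real.rpow_add hr, ← Real.rpow_add hr]
      convert Real.rpow_zero r using 2
      push_cast; ring
    linear_combination (mehtaConst 𝓡 μ)⁻¹ * (t ^ (-(gammaConst 𝓡 μ + N / 2)) *
      rootWeight 𝓡 μ x) * this
  ext s hs
  rw [Measure.map_apply hm hs, measureOmega, measureOmega, withDensity_apply _ (hm hs),
    withDensity_apply _ hs]
  conv_rhs => rw [hvol]
  rw [Measure.restrict_smul, lintegral_smul_measure, setLIntegral_map hs (hwm _) hm, smul_eq_mul,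
    ← lintegral_const_mul (ENNReal.ofReal (r ^ N))
    (f := fun x => ENNReal.ofReal (weight 𝓡 μ (r ^ 2 * t) (r • x))) ((hwm _).comp hm)]
  simp only [hfun]

end

section

/-! ### The Segal-Bargmann transforms -/

variable {N : ℕ} {𝓡 : Finset (ConfigSpace N)} {μ : ConfigSpace N → ℝ}

theorem kernelA_one (z : PhaseSpace N) (q : ConfigSpace N) :
    kernelA 𝓡 μ 1 z q = Complex.exp (-holoSq z / 2) * ((Real.exp (-(1 / 4) * ‖q‖ ^ 2) : ℝ) : ℂ) *
      dunklKernel 𝓡 μ z (toPhase q) := by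
  rw [kernelA, Complex.ofReal_exp, ← Complex.exp_add]
  simp only [Real.sqrt_one, Complex.ofReal_one, inv_one, one_smul]
  congr 2
  push_cast
  ring

theorem sbKernel_one (z w : PhaseSpace N) :
    sbKernel 𝓡 μ 1 z w = dunklKernel 𝓡 μ (conjPhase w) z • ContinuousLinearMap.id ℂ ℂ := by
  simp [sbKernel]

/-- The first constant is the density of `ω_{μ,1/4}` with respect to `ω̃_{μ,1}`. The Gaussians agree
because `‖2y‖² / 4 = ‖y‖²`, and the Dunkl kernels agree by homogeneity and symmetry. -/
theorem dilation_kernelBSO (h𝓡 : IsRootSystem 𝓡) (hμ : IsMultiplicity 𝓡 μ)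
    (hE : IsDunklKernel 𝓡 μ (dunklKernel 𝓡 μ)) (φ : ConfigSpace N → ℂ) (z : PhaseSpace N)
    (y : ConfigSpace N) :
    (((mehtaConst 𝓡 μ)⁻¹ * (1 / 4 : ℝ) ^ (-(gammaConst 𝓡 μ + N / 2)) : ℝ) : ℂ) *
      (kernelA 𝓡 μ 1 z ((2 : ℝ) • y) * rescaling 𝓡 μ φ y) = kernelBSO 𝓡 μ z y * φ y := by
  have hc := mehtaConst_pos h𝓡 hμ
  have h2 : (0 : ℝ) < 2 := two_pos
  set g := gammaConst 𝓡 μ + N / 2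
  set c := mehtaConst 𝓡 μ
  have hconst : c⁻¹ * (1 / 4 : ℝ) ^ (-g) * (c ^ (1 / 2 : ℝ) * 2 ^ (-g)) =
      2 ^ g * c ^ (-(1 / 2) : ℝ) := by
    have h4 : (1 / 4 : ℝ) ^ (-g) = 2 ^ g * 2 ^ g := by
      rw [← Real.mul_rpow h2.le h2.le, Real.rpow_neg (by norm_num), ← Real.inv_rpow (by norm_num)]
      norm_num
    have hh : c ^ (-(1 / 2) : ℝ) = c⁻¹ * c ^ (1 / 2 : ℝ) := by
      rw [← Real.rpow_neg_one, ← Real.rpow_add hc]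
      norm_num
    rw [h4, hh, Real.rpow_neg h2.le]
    have : (2 : ℝ) ^ g ≠ 0 := (Real.rpow_pos_of_pos h2 g).ne'
    field_simp
  have hker : dunklKernel 𝓡 μ (((√2 : ℝ) : ℂ) • toPhase y) (((√2 : ℝ) : ℂ) • z) =
      dunklKernel 𝓡 μ z (toPhase ((2 : ℝ) • y)) := by
    rw [hE.smul_left h𝓡 hμ, smul_smul, ← Complex.ofReal_mul, Real.mul_self_sqrt h2.le,
      ← hE.smul_left h𝓡 hμ, hE.symm h𝓡 hμ, toPhase_smul]
    rfl
  have hexp : Complex.exp (-holoSq z / 2) *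
      ((Real.exp (-(1 / 4) * ‖(2 : ℝ) • y‖ ^ 2) : ℝ) : ℂ) =
      Complex.exp (-holoSq z / 2 - (‖y‖ ^ 2 : ℝ)) := by
    rw [Complex.ofReal_exp, ← Complex.exp_add, norm_smul]
    congr 1
    push_cast
    rw [Real.norm_of_nonneg h2.le]
    push_cast
    ring
  rw [kernelA_one, hexp, kernelBSO, hker, rescaling, ← hconst]
  push_cast
  ring

/-- The transforms of the theorem, provided that the Dunkl kernel has its defining properties. -/
theorem exists_transforms (h𝓡 : IsRootSystem 𝓡) (hμ : IsMultiplicity 𝓡 μ)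
    (hE : IsDunklKernel 𝓡 μ (dunklKernel 𝓡 μ)) :
    ∃ _ : Fact (sbKernel 𝓡 μ 1).PosSemidef,
    ∃ (R : Lp ℂ 2 (measureTilde 𝓡 μ 1) ≃ₗᵢ[ℂ] Lp ℂ 2 (measureOmega 𝓡 μ (1 / 4)))
      (δ : Lp ℂ 2 (measureOmega 𝓡 μ (1 / 4)) ≃ₗᵢ[ℂ] Lp ℂ 2 (measureOmega 𝓡 μ 1))
      (A : Lp ℂ 2 (measureOmega 𝓡 μ 1) →L[ℂ] SegalBargmannSpace 𝓡 μ 1)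
      (BSO : Lp ℂ 2 (measureTilde 𝓡 μ 1) →L[ℂ] SegalBargmannSpace 𝓡 μ 1),
      (∀ φ, R φ =ᵐ[measureOmega 𝓡 μ (1 / 4)] rescaling 𝓡 μ φ) ∧
      (∀ ψ, δ ψ =ᵐ[measureOmega 𝓡 μ 1] dilation (1 / 2) ψ) ∧
      (∀ ψ z, Integrable (fun q => kernelA 𝓡 μ 1 z q * ψ q) (measureOmega 𝓡 μ 1) ∧
        A ψ z = transformA 𝓡 μ 1 ψ z) ∧
      (∀ φ z, Integrable (fun y => kernelBSO 𝓡 μ z y * φ y) (measureTilde 𝓡 μ 1) ∧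
        BSO φ z = transformBSO 𝓡 μ φ z) ∧
      ∀ φ, BSO φ = A (δ (R φ)) := by
  have hc := mehtaConst_pos h𝓡 hμ
  have hω1 : measureOmega 𝓡 μ 1 = ENNReal.ofReal (mehtaConst 𝓡 μ)⁻¹ • measureTilde 𝓡 μ 1 := by
    rw [measureOmega_eq_smul h𝓡 hμ one_pos, Real.one_rpow, mul_one]
  have hcontA : ∀ z, Continuous (kernelA 𝓡 μ 1 z) := fun z => by
    have h := hE.continuous_snd_toPhase z
    have e : kernelA 𝓡 μ 1 z = fun q => Complex.exp (-holoSq z / 2) *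
        ((Real.exp (-(1 / 4) * ‖q‖ ^ 2) : ℝ) : ℂ) * dunklKernel 𝓡 μ z (toPhase q) :=
      funext (kernelA_one z)
    rw [e]
    exact (by fun_prop : Continuous fun q : ConfigSpace N => Complex.exp (-holoSq z / 2) *
        ((Real.exp (-(1 / 4) * ‖q‖ ^ 2) : ℝ) : ℂ)).mul h
  have hconj : ∀ w (q : ConfigSpace N), (starRingEnd ℂ) (dunklKernel 𝓡 μ w (toPhase q)) =
      dunklKernel 𝓡 μ (conjPhase w) (toPhase q) := fun w q => by
    rw [← hE.conj_apply h𝓡 hμ (conjPhase w), conjPhase_conjPhase, conjPhase_toPhase]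
  have hholo : ∀ w : PhaseSpace N, (starRingEnd ℂ) (holoSq w) = holoSq (conjPhase w) := fun w => by
    simp [holoSq]
  have hprod : ∀ z w (q : ConfigSpace N),
      (rootWeight 𝓡 μ q : ℂ) * (kernelA 𝓡 μ 1 z q * (starRingEnd ℂ) (kernelA 𝓡 μ 1 w q)) =
      Complex.exp (-holoSq z / 2 + -holoSq (conjPhase w) / 2) * ((gaussianWeight 𝓡 μ q : ℂ) *
        (dunklKernel 𝓡 μ z (toPhase q) * dunklKernel 𝓡 μ (conjPhase w) (toPhase q))) := by
    intro z w q
    rw [kernelA_one, kernelA_one, map_mul, map_mul, hconj, ← Complex.exp_conj, Complex.conj_ofReal,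
      gaussianWeight, Complex.exp_add]
    have h1 : Real.exp (-(1 / 2) * ‖q‖ ^ 2) =
        Real.exp (-(1 / 4) * ‖q‖ ^ 2) * Real.exp (-(1 / 4) * ‖q‖ ^ 2) := by
      rw [← Real.exp_add]; ring_nf
    have h2 : (starRingEnd ℂ) (-holoSq w / 2) = -holoSq (conjPhase w) / 2 := by
      rw [map_div₀, map_neg, hholo, Complex.conj_ofNat]
    rw [h1, h2]
    push_cast
    ring
  have hint : ∀ z w, Integrable (fun q => kernelA 𝓡 μ 1 z q * (starRingEnd ℂ) (kernelA 𝓡 μ 1 w q))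
      (measureTilde 𝓡 μ 1) := by
    intro z w
    rw [integrable_measureTilde_one]
    simp_rw [hprod]
    exact (((hE.expBounded_snd h𝓡 hμ z).mul
      (hE.expBounded_snd h𝓡 hμ _)).integrable_gaussianWeight h𝓡 hμ
      ((hE.continuous_snd_toPhase z).mul (hE.continuous_snd_toPhase _))).const_mul _
  have hmem : ∀ z, MemLp (fun q => (starRingEnd ℂ) (kernelA 𝓡 μ 1 z q)) 2 (measureOmega 𝓡 μ 1) := by
    intro z
    have hc1 : Continuous fun q => (starRingEnd ℂ) (kernelA 𝓡 μ 1 z q) :=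
      Complex.continuous_conj.comp (hcontA z)
    rw [hω1]
    refine MemLp.smul_measure ?_ ENNReal.ofReal_ne_top
    rw [memLp_two_iff_integrable_sq_norm hc1.aestronglyMeasurable]
    refine (hint z z).norm.congr (Filter.Eventually.of_forall fun q => ?_)
    simp only [norm_mul, RCLike.norm_conj, sq]
  -- The kernel is conjugated because the inner product is conjugate linear in its first variable;
  -- thus `⟪v z, ψ⟫` is the transform of `ψ` at `z`.
  let v : PhaseSpace N → Lp ℂ 2 (measureOmega 𝓡 μ 1) := fun z => (hmem z).toLp _
  have hv : ∀ z, v z =ᵐ[measureOmega 𝓡 μ 1] fun q => (starRingEnd ℂ) (kernelA 𝓡 μ 1 z q) :=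
    fun z => MemLp.coeFn_toLp _
  -- In the Gaussian integral the factors `exp(± z²/2)` and `exp(± w̄²/2)` cancel, and the
  -- normalization of `ω` removes `c_μ`.
  have hgram : ∀ z w, sbKernel 𝓡 μ 1 z w = (inner ℂ (v z) (v w)) • ContinuousLinearMap.id ℂ ℂ := by
    intro z w
    rw [sbKernel_one]
    congr 1
    rw [L2.inner_def, integral_congr_ae
      (g := fun q => kernelA 𝓡 μ 1 z q * (starRingEnd ℂ) (kernelA 𝓡 μ 1 w q))]
    · rw [hω1, integral_smul_measure, integral_measureTilde_one]
      simp_rw [hprod]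
      rw [integral_const_mul, hE.integral_gaussian_mul h𝓡 hμ, ← ofReal_mehtaConst,
        ENNReal.toReal_ofReal (inv_nonneg.mpr hc.le), Complex.real_smul, ← mul_assoc _ _
        (mehtaConst 𝓡 μ : ℂ), ← mul_assoc (Complex.exp _), ← Complex.exp_add]
      rw [show -holoSq z / 2 + -holoSq (conjPhase w) / 2 +
        (holoSq z / 2 + holoSq (conjPhase w) / 2) = 0 by ring, Complex.exp_zero, one_mul,
        hE.symm h𝓡 hμ]
      have : (mehtaConst 𝓡 μ : ℂ) ≠ 0 := by exact_mod_cast hc.ne'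
      push_cast
      field_simp
    · filter_upwards [hv z, hv w] with q h1 h2
      rw [h1, h2]
      simp [mul_comm]
  have hfact : Fact (sbKernel 𝓡 μ 1).PosSemidef := ⟨posSemidef_of_gram v hgram⟩
  obtain ⟨A, hA⟩ := exists_clm_of_gram v hgram
  have hA' : ∀ ψ z, Integrable (fun q => kernelA 𝓡 μ 1 z q * ψ q) (measureOmega 𝓡 μ 1) ∧
        A ψ z = transformA 𝓡 μ 1 ψ z := by
    intro ψ z
    have h1 : (fun q => inner ℂ (v z q) (ψ q)) =ᵐ[measureOmega 𝓡 μ 1]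
        fun q => kernelA 𝓡 μ 1 z q * ψ q := by
      filter_upwards [hv z] with q h1
      rw [h1]
      simp [mul_comm]
    refine ⟨(L2.integrable_inner (𝕜 := ℂ) (v z) ψ).congr h1, ?_⟩
    rw [hA, L2.inner_def, integral_congr_ae h1, transformA]
  set r : ℝ := (mehtaConst 𝓡 μ)⁻¹ * (1 / 4 : ℝ) ^ (-(gammaConst 𝓡 μ + N / 2)) with hr
  have hrpos : 0 < r := by positivity
  have hω4 : measureOmega 𝓡 μ (1 / 4) = ENNReal.ofReal r • measureTilde 𝓡 μ 1 :=
    measureOmega_eq_smul h𝓡 hμ (by norm_num)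
  -- With `g = γ + N/2`, unitarity is the identity `(c⁻¹ * 4 ^ g) * (c ^ (1/2) * 2 ^ (-g)) ^ 2 = 1`.
  obtain ⟨R, hR⟩ := exists_linearIsometryEquiv_smul_measure
    (a := mehtaConst 𝓡 μ ^ (1 / 2 : ℝ) * 2 ^ (-(gammaConst 𝓡 μ + N / 2))) hrpos (by positivity) (by
      rw [hr, mul_pow, ← Real.sqrt_eq_rpow, Real.sq_sqrt hc.le, ← Real.rpow_natCast,
        ← Real.rpow_mul zero_le_two, mul_comm (-(gammaConst 𝓡 μ + N / 2)), Real.rpow_mul zero_le_two,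
        mul_mul_mul_comm, inv_mul_cancel₀ hc.ne', one_mul, ← Real.mul_rpow (by norm_num)
        (by norm_num)]
      norm_num) hω4
  have hhalf : MeasurePreserving (fun x : ConfigSpace N => (1 / 2 : ℝ) • x) (measureOmega 𝓡 μ 1)
      (measureOmega 𝓡 μ (1 / 4)) := by
    have h := measurePreserving_smul (𝓡 := 𝓡) (μ := μ) (r := 1 / 2) (t := 1) (by norm_num) one_pos
    norm_num at h ⊢
    exact h
  have hdouble : MeasurePreserving (fun x : ConfigSpace N => (2 : ℝ) • x)
      (measureOmega 𝓡 μ (1 / 4)) (measureOmega 𝓡 μ 1) := by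
    have h := measurePreserving_smul (𝓡 := 𝓡) (μ := μ) (r := 2) (t := 1 / 4) two_pos (by norm_num)
    norm_num at h ⊢
    exact h
  obtain ⟨δ, hδ⟩ := exists_linearIsometryEquiv_comp hhalf hdouble
    (fun x => by rw [smul_smul]; norm_num)
  -- `BSO` is taken to be the composite, so the factorization is definitional; what has to be proved
  -- is its integral formula.
  refine ⟨hfact, R, δ, A, A ∘L δ.toLinearIsometry.toContinuousLinearMap ∘L
    R.toLinearIsometry.toContinuousLinearMap, hR, hδ, hA',
    fun φ z => ?_, fun φ => rfl⟩
  -- Written as a function of `q / 2`, the integrand can be transported to `ω_{μ,1/4}` and from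
  -- there to `ω̃_{μ,1}`.
  have hfun : (fun q => kernelA 𝓡 μ 1 z q * δ (R φ) q) =ᵐ[measureOmega 𝓡 μ 1]
      fun q => (fun y => kernelA 𝓡 μ 1 z ((2 : ℝ) • y) * rescaling 𝓡 μ φ y) ((1 / 2 : ℝ) • q) := by
    filter_upwards [hδ (R φ), hhalf.quasiMeasurePreserving.ae (hR φ)] with q h1 h2
    have h3 : (2 : ℝ) • (1 / 2 : ℝ) • q = q := by rw [smul_smul]; norm_num
    rw [h1, h2, h3]
    rfl
  have hemb : MeasurableEmbedding fun x : ConfigSpace N => (1 / 2 : ℝ) • x :=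
    (Homeomorph.smulOfNeZero (1 / 2 : ℝ) (by norm_num)).measurableEmbedding
  have hi := (hA' (δ (R φ)) z).1.congr hfun
  have hi4 : Integrable (fun y => kernelA 𝓡 μ 1 z ((2 : ℝ) • y) * rescaling 𝓡 μ φ y)
      (measureOmega 𝓡 μ (1 / 4)) := (hhalf.integrable_comp_emb hemb).mp hi
  rw [hω4, integrable_smul_measure (by simpa using hrpos) ENNReal.ofReal_ne_top] at hi4
  refine ⟨(hi4.const_mul (r : ℂ)).congr
    (Filter.Eventually.of_forall (dilation_kernelBSO h𝓡 hμ hE φ z)), ?_⟩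
  rw [show (A ∘L δ.toLinearIsometry.toContinuousLinearMap ∘L
    R.toLinearIsometry.toContinuousLinearMap) φ = A (δ (R φ)) from rfl,
    (hA' (δ (R φ)) z).2, transformA, integral_congr_ae hfun, hhalf.integral_comp hemb
      (fun y => kernelA 𝓡 μ 1 z ((2 : ℝ) • y) * rescaling 𝓡 μ φ y), hω4, integral_smul_measure,
    ENNReal.toReal_ofReal hrpos.le, Complex.real_smul, ← integral_const_mul, transformBSO]
  exact integral_congr_ae (Filter.Eventually.of_forall (dilation_kernelBSO h𝓡 hμ hE φ z))

end

section

/-! ### Dunkl operators on polynomials -/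

open MvPolynomial

variable {N : ℕ} {𝓡 : Finset (ConfigSpace N)} {μ : ConfigSpace N → ℝ}

theorem poly_ext {p q : MvPolynomial (Fin N) ℂ}
    (h : ∀ x : PhaseSpace N, eval x.ofLp p = eval x.ofLp q) : p = q :=
  MvPolynomial.funext fun x => h (WithLp.toLp 2 x)

/-- The linear form `x ↦ ∑ vᵢ xᵢ`. -/
noncomputable def linForm (v : PhaseSpace N) : MvPolynomial (Fin N) ℂ := ∑ i, C (v i) * X i

@[simp] theorem eval_linForm (x v : PhaseSpace N) : eval x.ofLp (linForm v) = bil v x := by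
  simp [linForm, bil]

/-- The action of the reflection `σ_α` on polynomials. -/
noncomputable def polyRefl (α : ConfigSpace N) : MvPolynomial (Fin N) ℂ →ₐ[ℂ] MvPolynomial (Fin N) ℂ :=
  aeval fun i => X i - C (toPhase α i) * linForm (toPhase α)

@[simp] theorem polyRefl_X (α : ConfigSpace N) (i : Fin N) :
    polyRefl α (X i) = X i - C (toPhase α i) * linForm (toPhase α) := aeval_X _ _

@[simp] theorem eval_polyRefl (α : ConfigSpace N) (x : PhaseSpace N) (p : MvPolynomial (Fin N) ℂ) :
    eval x.ofLp (polyRefl α p) = eval (phaseRefl α x).ofLp p := by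
  induction p using MvPolynomial.induction_on with
  | C a => simp [polyRefl]
  | add p q hp hq => simp [hp, hq]
  | mul_X p i hp =>
    rw [map_mul, map_mul, hp, map_mul, polyRefl_X]
    simp [phaseRefl, mul_comm]

/-- On variables the difference is a multiple of the linear form by definition, and the twisted
product rule `p q - σp σq = (p - σp) q + σp (q - σq)` propagates this. -/
theorem linForm_dvd (α : ConfigSpace N) (p : MvPolynomial (Fin N) ℂ) :
    linForm (toPhase α) ∣ p - polyRefl α p := by
  induction p using MvPolynomial.induction_on with
  | C a => simp [polyRefl]
  | add p q hp hq =>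
    rw [map_add, add_sub_add_comm]
    exact dvd_add hp hq
  | mul_X p i hp =>
    have : p * X i - polyRefl α (p * X i) = (p - polyRefl α p) * X i +
        linForm (toPhase α) * (polyRefl α p * C (toPhase α i)) := by
      rw [map_mul, polyRefl_X]
      ring
    rw [this]
    exact dvd_add (hp.mul_right _) (dvd_mul_right _ _)

/-- The divided difference `(p - σ_α p) / ⟨α, ·⟩` of a polynomial. -/
noncomputable def divDiff (α : ConfigSpace N) (p : MvPolynomial (Fin N) ℂ) :
    MvPolynomial (Fin N) ℂ := (linForm_dvd α p).choose

theorem linForm_mul_divDiff (α : ConfigSpace N) (p : MvPolynomial (Fin N) ℂ) :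
    linForm (toPhase α) * divDiff α p = p - polyRefl α p :=
  (linForm_dvd α p).choose_spec.symm

theorem linForm_ne_zero {α : ConfigSpace N} (hα : ‖α‖ ^ 2 = 2) : linForm (toPhase α) ≠ 0 := by
  intro h
  have := eval_linForm (toPhase α) (toPhase α)
  rw [h, map_zero, bil_toPhase, real_inner_self_eq_norm_sq, hα] at this
  norm_num at this

/-- Polynomials form a domain, so the chosen quotient is unique and its identities can be verified
after multiplication by the linear form. -/
theorem divDiff_eq {α : ConfigSpace N} (hα : ‖α‖ ^ 2 = 2) {p q : MvPolynomial (Fin N) ℂ}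
    (h : linForm (toPhase α) * q = p - polyRefl α p) : divDiff α p = q :=
  mul_left_cancel₀ (linForm_ne_zero hα) ((linForm_mul_divDiff α p).trans h.symm)

/-- The derivative of polynomials in a constant direction. -/
noncomputable def polyDeriv (v : PhaseSpace N) :
    Derivation ℂ (MvPolynomial (Fin N) ℂ) (MvPolynomial (Fin N) ℂ) :=
  mkDerivation ℂ fun i => C (v i)

@[simp] theorem polyDeriv_X (v : PhaseSpace N) (i : Fin N) : polyDeriv v (X i) = C (v i) :=
  mkDerivation_X _ _ _

@[simp] theorem polyDeriv_C (v : PhaseSpace N) (a : ℂ) : polyDeriv v (C a) = 0 :=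
  (polyDeriv v).map_algebraMap a

theorem polyDeriv_linForm (v w : PhaseSpace N) : polyDeriv v (linForm w) = C (bil w v) := by
  simp [linForm, bil, Derivation.leibniz]

/-- The Euler vector field `∑ xᵢ ∂ᵢ`. -/
noncomputable def polyEuler :
    Derivation ℂ (MvPolynomial (Fin N) ℂ) (MvPolynomial (Fin N) ℂ) := mkDerivation ℂ X

theorem polyEuler_linForm (v : PhaseSpace N) : polyEuler (linForm v) = linForm v := by
  simp [linForm, Derivation.leibniz, polyEuler]

theorem polyEuler_eq_sum (p : MvPolynomial (Fin N) ℂ) :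
    polyEuler p = ∑ i, X i * polyDeriv (EuclideanSpace.single i 1) p := by
  induction p using MvPolynomial.induction_on with
  | C a => simp [polyEuler]
  | add p q hp hq => simp only [map_add, hp, hq, mul_add, Finset.sum_add_distrib]
  | mul_X p j hp =>
    have h : ∑ i, X i * (p * C ((EuclideanSpace.single i (1 : ℂ) : PhaseSpace N) j)) =
        p * X j := by
      rw [Finset.sum_eq_single j]
      · simp [mul_comm]
      · intro i _ hi
        simp [hi.symm]
      · simp
    simp only [Derivation.leibniz, hp, polyDeriv_X, smul_eq_mul, mul_add, Finset.sum_add_distrib, h]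
    rw [polyEuler, mkDerivation_X, Finset.mul_sum]
    congr 1
    exact Finset.sum_congr rfl fun i _ => by ring

theorem polyDeriv_single (i : Fin N) : polyDeriv (EuclideanSpace.single i 1) = pderiv i := by
  refine MvPolynomial.derivation_ext fun j => ?_
  rw [polyDeriv_X, pderiv_X]
  simp [Pi.single_apply, eq_comm]

theorem polyEuler_of_isHomogeneous {p : MvPolynomial (Fin N) ℂ} {n : ℕ} (hp : p.IsHomogeneous n) :
    polyEuler p = (n : ℂ) • p := by
  simp only [polyEuler_eq_sum, polyDeriv_single]
  rw [hp.sum_X_mul_pderiv, Nat.cast_smul_eq_nsmul]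

theorem polyDeriv_polyRefl {α : ConfigSpace N} (v : PhaseSpace N) (p : MvPolynomial (Fin N) ℂ) :
    polyDeriv v (polyRefl α p) = polyRefl α (polyDeriv (phaseRefl α v) p) := by
  induction p using MvPolynomial.induction_on with
  | C a => simp [polyRefl]
  | add p q hp hq => simp [hp, hq]
  | mul_X p i hp =>
    have h : ∀ a : ℂ, polyRefl α (C a) = C a := fun a => (polyRefl α).commutes a
    rw [map_mul, Derivation.leibniz, Derivation.leibniz, hp, polyRefl_X, polyDeriv_X]
    simp only [smul_eq_mul, map_add, map_mul, map_sub, Derivation.leibniz, polyDeriv_linForm,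
      polyDeriv_X, polyDeriv_C, polyRefl_X, h, phaseRefl, PiLp.sub_apply, PiLp.smul_apply]
    ring

theorem polyRefl_linForm (α : ConfigSpace N) (v : PhaseSpace N) :
    polyRefl α (linForm v) = linForm (phaseRefl α v) :=
  poly_ext fun x => by rw [eval_polyRefl, eval_linForm, eval_linForm, bil_phaseRefl_left]

/-- The Dunkl operator `T_v` on polynomials. -/
noncomputable def polyDunkl (𝓡 : Finset (ConfigSpace N)) (μ : ConfigSpace N → ℝ)
    (v : PhaseSpace N) (p : MvPolynomial (Fin N) ℂ) : MvPolynomial (Fin N) ℂ :=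
  polyDeriv v p + ∑ α ∈ 𝓡, (((μ α / 2 : ℝ) : ℂ) * bil (toPhase α) v) • divDiff α p

theorem polyRefl_comm {α : ConfigSpace N} (hα : ‖α‖ ^ 2 = 2) (β : ConfigSpace N)
    (p : MvPolynomial (Fin N) ℂ) :
    polyRefl β (polyRefl α p) = polyRefl α (polyRefl (refl α β) p) :=
  poly_ext fun x => by simp only [eval_polyRefl, phaseRefl_conj hα]

end

/-! ### Commutativity of the Dunkl operators -/

section

open MvPolynomial

variable {N : ℕ} {𝓡 : Finset (ConfigSpace N)} {μ : ConfigSpace N → ℝ}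

theorem linForm_sub (v w : PhaseSpace N) : linForm (v - w) = linForm v - linForm w :=
  poly_ext fun x => by simp [bil_sub_left]

theorem linForm_smul (a : ℂ) (v : PhaseSpace N) : linForm (a • v) = a • linForm v :=
  poly_ext fun x => by simp [bil_smul_left, smul_eval]

theorem linForm_single (i : Fin N) : linForm (EuclideanSpace.single i (1 : ℂ)) = X i := by
  refine poly_ext fun x => ?_
  simp [bil]

theorem bil_single_left (i : Fin N) (v : PhaseSpace N) :
    bil (EuclideanSpace.single i (1 : ℂ)) v = v i := by
  simp [bil]

theorem sub_polyRefl_linForm (α : ConfigSpace N) (w : PhaseSpace N) :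
    linForm w - polyRefl α (linForm w) = bil (toPhase α) w • linForm (toPhase α) := by
  rw [polyRefl_linForm, ← linForm_sub, ← linForm_smul, phaseRefl, sub_sub_cancel]

section divDiff

variable {α : ConfigSpace N} (hα : ‖α‖ ^ 2 = 2)
include hα

theorem divDiff_add (p q : MvPolynomial (Fin N) ℂ) :
    divDiff α (p + q) = divDiff α p + divDiff α q :=
  divDiff_eq hα (by rw [mul_add, linForm_mul_divDiff, linForm_mul_divDiff, map_add]; ring)

theorem divDiff_smul (a : ℂ) (p : MvPolynomial (Fin N) ℂ) :
    divDiff α (a • p) = a • divDiff α p :=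
  divDiff_eq hα (by rw [mul_smul_comm, linForm_mul_divDiff, map_smul, smul_sub])

theorem divDiff_C (a : ℂ) : divDiff α (C a : MvPolynomial (Fin N) ℂ) = 0 :=
  divDiff_eq hα (by simp [polyRefl])

theorem divDiff_linForm_mul (w : PhaseSpace N) (p : MvPolynomial (Fin N) ℂ) :
    divDiff α (linForm w * p) =
      linForm w * divDiff α p + bil (toPhase α) w • polyRefl α p := by
  refine divDiff_eq hα ?_
  rw [mul_add, mul_left_comm, linForm_mul_divDiff, mul_smul_comm, ← smul_mul_assoc,
    ← sub_polyRefl_linForm, map_mul]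
  ring

theorem divDiff_polyRefl {β : ConfigSpace N} (hβ : ‖β‖ ^ 2 = 2) (p : MvPolynomial (Fin N) ℂ) :
    divDiff β (polyRefl α p) = polyRefl α (divDiff (refl α β) p) := by
  refine divDiff_eq hβ ?_
  have h : linForm (toPhase β) = polyRefl α (linForm (toPhase (refl α β))) := by
    rw [polyRefl_linForm, toPhase_refl hα, phaseRefl_phaseRefl hα]
  rw [h, ← map_mul, linForm_mul_divDiff, map_sub, polyRefl_comm hα]

end divDiff

theorem polyDeriv_add_left (v w : PhaseSpace N) (p : MvPolynomial (Fin N) ℂ) :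
    polyDeriv (v + w) p = polyDeriv v p + polyDeriv w p := by
  have : polyDeriv (v + w) = polyDeriv v + polyDeriv w :=
    MvPolynomial.derivation_ext fun i => by simp
  rw [this, Derivation.add_apply]

theorem polyDeriv_smul_left (a : ℂ) (v : PhaseSpace N) (p : MvPolynomial (Fin N) ℂ) :
    polyDeriv (a • v) p = a • polyDeriv v p := by
  have : polyDeriv (a • v) = a • polyDeriv v :=
    MvPolynomial.derivation_ext fun i => by simp [smul_eq_C_mul]
  rw [this, Derivation.smul_apply]

theorem polyDunkl_add_left (v w : PhaseSpace N) (p : MvPolynomial (Fin N) ℂ) :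
    polyDunkl 𝓡 μ (v + w) p = polyDunkl 𝓡 μ v p + polyDunkl 𝓡 μ w p := by
  simp only [polyDunkl, polyDeriv_add_left, bil_add_right, mul_add, add_smul,
    Finset.sum_add_distrib]
  abel

theorem polyDunkl_smul_left (a : ℂ) (v : PhaseSpace N) (p : MvPolynomial (Fin N) ℂ) :
    polyDunkl 𝓡 μ (a • v) p = a • polyDunkl 𝓡 μ v p := by
  simp only [polyDunkl, polyDeriv_smul_left, bil_smul_right, smul_add, Finset.smul_sum, smul_smul,
    mul_left_comm]

theorem polyDunkl_phaseRefl (β : ConfigSpace N) (v : PhaseSpace N) (p : MvPolynomial (Fin N) ℂ) :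
    polyDunkl 𝓡 μ (phaseRefl β v) p =
      polyDunkl 𝓡 μ v p - bil (toPhase β) v • polyDunkl 𝓡 μ (toPhase β) p := by
  rw [phaseRefl, sub_eq_add_neg, ← neg_smul, polyDunkl_add_left, polyDunkl_smul_left, neg_smul,
    ← sub_eq_add_neg]

theorem sum_polyDunkl_single (v : PhaseSpace N) (p : MvPolynomial (Fin N) ℂ) :
    ∑ i, v i • polyDunkl 𝓡 μ (EuclideanSpace.single i (1 : ℂ)) p = polyDunkl 𝓡 μ v p := by
  let T : PhaseSpace N →ₗ[ℂ] MvPolynomial (Fin N) ℂ :=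
    { toFun := fun v => polyDunkl 𝓡 μ v p
      map_add' := fun v w => polyDunkl_add_left v w p
      map_smul' := fun a v => polyDunkl_smul_left a v p }
  have hv : v = ∑ i, v i • EuclideanSpace.single i (1 : ℂ) := by
    ext j
    simp [Finset.sum_apply, Pi.single_apply]
  have := congrArg T hv
  rw [map_sum] at this
  simpa [T] using this.symm

section polyDunkl

variable (h𝓡 : IsRootSystem 𝓡)
include h𝓡

theorem polyDunkl_add (v : PhaseSpace N) (p q : MvPolynomial (Fin N) ℂ) :
    polyDunkl 𝓡 μ v (p + q) = polyDunkl 𝓡 μ v p + polyDunkl 𝓡 μ v q := by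
  simp only [polyDunkl, map_add]
  rw [add_add_add_comm, ← Finset.sum_add_distrib]
  congr 1
  exact Finset.sum_congr rfl fun α hα => by rw [divDiff_add (h𝓡.norm_sq α hα), smul_add]

theorem polyDunkl_smul (v : PhaseSpace N) (a : ℂ) (p : MvPolynomial (Fin N) ℂ) :
    polyDunkl 𝓡 μ v (a • p) = a • polyDunkl 𝓡 μ v p := by
  rw [polyDunkl, polyDunkl, Derivation.map_smul, smul_add, Finset.smul_sum]
  congr 1
  exact Finset.sum_congr rfl fun α hα => by rw [divDiff_smul (h𝓡.norm_sq α hα), smul_comm]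

theorem polyDunkl_C (v : PhaseSpace N) (a : ℂ) :
    polyDunkl 𝓡 μ v (C a : MvPolynomial (Fin N) ℂ) = 0 := by
  rw [polyDunkl, polyDeriv_C, zero_add]
  exact Finset.sum_eq_zero fun α hα => by rw [divDiff_C (h𝓡.norm_sq α hα), smul_zero]

theorem polyDunkl_sum {ι : Type*} (v : PhaseSpace N) (s : Finset ι)
    (p : ι → MvPolynomial (Fin N) ℂ) :
    polyDunkl 𝓡 μ v (∑ i ∈ s, p i) = ∑ i ∈ s, polyDunkl 𝓡 μ v (p i) := by
  classical
  induction s using Finset.induction_on with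
  | empty => simpa using polyDunkl_C h𝓡 (μ := μ) v 0
  | insert i s hi ih => rw [Finset.sum_insert hi, Finset.sum_insert hi, polyDunkl_add h𝓡, ih]

/-- The commutator of `T_v` with multiplication by a linear form: the derivative gives the constant
term, and the twisted product rule for divided differences gives the reflections. -/
theorem polyDunkl_linForm_mul (v w : PhaseSpace N) (p : MvPolynomial (Fin N) ℂ) :
    polyDunkl 𝓡 μ v (linForm w * p) = linForm w * polyDunkl 𝓡 μ v p + bil v w • p +
      ∑ β ∈ 𝓡, (((μ β / 2 : ℝ) : ℂ) * bil (toPhase β) v * bil (toPhase β) w) • polyRefl β p := by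
  have h : ∀ β ∈ 𝓡, (((μ β / 2 : ℝ) : ℂ) * bil (toPhase β) v) • divDiff β (linForm w * p) =
      linForm w * ((((μ β / 2 : ℝ) : ℂ) * bil (toPhase β) v) • divDiff β p) +
      (((μ β / 2 : ℝ) : ℂ) * bil (toPhase β) v * bil (toPhase β) w) • polyRefl β p := by
    intro β hβ
    rw [divDiff_linForm_mul (h𝓡.norm_sq β hβ), smul_add, mul_smul_comm, smul_smul]
  rw [polyDunkl, polyDunkl, Finset.sum_congr rfl h, Finset.sum_add_distrib, Derivation.leibniz,
    polyDeriv_linForm, mul_add, ← Finset.mul_sum, smul_eq_mul, smul_eq_mul, bil_comm w v,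
    smul_eq_C_mul (a := bil v w)]
  ring

/-- Equivariance: the reflection permutes the roots, with `μ` unchanged, and carries divided
differences along `σ_α β` to those along `β`. -/
theorem polyDunkl_polyRefl (hμ : IsMultiplicity 𝓡 μ) {α : ConfigSpace N} (hα : α ∈ 𝓡)
    (v : PhaseSpace N) (p : MvPolynomial (Fin N) ℂ) :
    polyDunkl 𝓡 μ v (polyRefl α p) = polyRefl α (polyDunkl 𝓡 μ (phaseRefl α v) p) := by
  have hn := h𝓡.norm_sq α hα
  rw [polyDunkl, polyDunkl, polyDeriv_polyRefl, map_add, map_sum,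
    ← IsDunklKernel.sum_comp_refl h𝓡 hα fun β => polyRefl α
      ((((μ β / 2 : ℝ) : ℂ) * bil (toPhase β) (phaseRefl α v)) • divDiff β p)]
  congr 1
  refine Finset.sum_congr rfl fun β hβ => ?_
  rw [toPhase_refl hn, bil_phaseRefl_phaseRefl hn, IsDunklKernel.mu_refl hμ hα hβ, map_smul,
    divDiff_polyRefl hn (h𝓡.norm_sq β hβ)]

/-- Dunkl operators commute. -/
theorem polyDunkl_comm (hμ : IsMultiplicity 𝓡 μ) (v w : PhaseSpace N)
    (p : MvPolynomial (Fin N) ℂ) :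
    polyDunkl 𝓡 μ v (polyDunkl 𝓡 μ w p) = polyDunkl 𝓡 μ w (polyDunkl 𝓡 μ v p) := by
  induction p using MvPolynomial.induction_on with
  | C a => rw [polyDunkl_C h𝓡, polyDunkl_C h𝓡, ← map_zero C, polyDunkl_C h𝓡, polyDunkl_C h𝓡]
  | add p q hp hq => simp only [polyDunkl_add h𝓡, hp, hq]
  | mul_X p i hp =>
    rw [mul_comm, ← linForm_single]
    generalize (EuclideanSpace.single i (1 : ℂ) : PhaseSpace N) = u
    -- Everything except the first term is symmetric in `v` and `w`, and the induction hypothesis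
    -- handles the first term.
    have key : ∀ v w : PhaseSpace N,
        polyDunkl 𝓡 μ v (polyDunkl 𝓡 μ w (linForm u * p)) =
          linForm u * polyDunkl 𝓡 μ v (polyDunkl 𝓡 μ w p) +
          (bil v u • polyDunkl 𝓡 μ w p + bil w u • polyDunkl 𝓡 μ v p) +
          ∑ β ∈ 𝓡, (((μ β / 2 : ℝ) : ℂ) * bil (toPhase β) u) •
            ((bil (toPhase β) v • polyRefl β (polyDunkl 𝓡 μ w p) +
              bil (toPhase β) w • polyRefl β (polyDunkl 𝓡 μ v p)) -
              (bil (toPhase β) w * bil (toPhase β) v) •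
                polyRefl β (polyDunkl 𝓡 μ (toPhase β) p)) := by
      intro v w
      have hs : ∀ β ∈ 𝓡, polyDunkl 𝓡 μ v
          ((((μ β / 2 : ℝ) : ℂ) * bil (toPhase β) w * bil (toPhase β) u) • polyRefl β p) =
          (((μ β / 2 : ℝ) : ℂ) * bil (toPhase β) w * bil (toPhase β) u) •
            (polyRefl β (polyDunkl 𝓡 μ v p) -
              bil (toPhase β) v • polyRefl β (polyDunkl 𝓡 μ (toPhase β) p)) := by
        intro β hβ
        rw [polyDunkl_smul h𝓡, polyDunkl_polyRefl h𝓡 hμ hβ, polyDunkl_phaseRefl, map_sub,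
          map_smul]
      rw [polyDunkl_linForm_mul h𝓡 w, polyDunkl_add h𝓡, polyDunkl_add h𝓡, polyDunkl_sum h𝓡,
        Finset.sum_congr rfl hs, polyDunkl_linForm_mul h𝓡 v, polyDunkl_smul h𝓡]
      have e : ∀ a b c d f : MvPolynomial (Fin N) ℂ,
          a + b + c + d + f = a + (b + d) + (c + f) := fun a b c d f => by ring
      rw [e, ← Finset.sum_add_distrib]
      refine congrArg₂ (· + ·) rfl (Finset.sum_congr rfl fun β _ => ?_)
      simp only [smul_eq_C_mul, map_mul]
      ring
    rw [key v w, key w v, hp]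
    exact congrArg₂ (· + ·) (congrArg₂ (· + ·) rfl (add_comm _ _)) (Finset.sum_congr rfl fun β _ =>
      congrArg₂ (· • ·) rfl (congrArg₂ (· - ·) (add_comm _ _)
        (congrArg₂ (· • ·) (mul_comm _ _) rfl)))

/-- The operator `∑ xᵢ Tᵢ`, in terms of the Euler vector field. -/
noncomputable def dunklEuler (𝓡 : Finset (ConfigSpace N)) (μ : ConfigSpace N → ℝ) :
    MvPolynomial (Fin N) ℂ →ₗ[ℂ] MvPolynomial (Fin N) ℂ :=
  polyEuler.toLinearMap +
    ∑ β ∈ 𝓡, ((μ β / 2 : ℝ) : ℂ) • (LinearMap.id - (polyRefl β).toLinearMap)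

omit h𝓡 in
theorem dunklEuler_apply (p : MvPolynomial (Fin N) ℂ) : dunklEuler 𝓡 μ p =
    polyEuler p + ∑ β ∈ 𝓡, ((μ β / 2 : ℝ) : ℂ) • (p - polyRefl β p) := by
  simp [dunklEuler]

omit h𝓡 in
theorem dunklEuler_eq_sum (p : MvPolynomial (Fin N) ℂ) : dunklEuler 𝓡 μ p =
    ∑ i, linForm (EuclideanSpace.single i 1) * polyDunkl 𝓡 μ (EuclideanSpace.single i 1) p := by
  have h : ∀ β ∈ 𝓡, ((μ β / 2 : ℝ) : ℂ) • (p - polyRefl β p) =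
      ∑ i, linForm (EuclideanSpace.single i 1) * (((μ β / 2 : ℝ) : ℂ) *
        bil (toPhase β) (EuclideanSpace.single i 1)) • divDiff β p := by
    intro β _
    rw [← linForm_mul_divDiff, linForm, Finset.sum_mul, Finset.smul_sum]
    refine Finset.sum_congr rfl fun i _ => ?_
    rw [linForm_single, bil_comm, bil_single_left, smul_eq_C_mul, smul_eq_C_mul, map_mul]
    ring
  rw [dunklEuler_apply, Finset.sum_congr rfl h, Finset.sum_comm, polyEuler_eq_sum]
  simp only [polyDunkl, mul_add, Finset.sum_add_distrib, linForm_single, Finset.mul_sum]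

/-- In `∑ xᵢ Tᵢ` the operator `T_v` is moved past `xᵢ` by the commutator rule and past `Tᵢ` by
commutativity. -/
theorem polyDunkl_dunklEuler (hμ : IsMultiplicity 𝓡 μ) (v : PhaseSpace N)
    (p : MvPolynomial (Fin N) ℂ) :
    polyDunkl 𝓡 μ v (dunklEuler 𝓡 μ p) = dunklEuler 𝓡 μ (polyDunkl 𝓡 μ v p) +
      polyDunkl 𝓡 μ v p + ∑ β ∈ 𝓡, (((μ β / 2 : ℝ) : ℂ) * bil (toPhase β) v) •
        polyRefl β (polyDunkl 𝓡 μ (toPhase β) p) := by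
  rw [dunklEuler_eq_sum, polyDunkl_sum h𝓡]
  simp only [polyDunkl_linForm_mul h𝓡, Finset.sum_add_distrib, polyDunkl_comm h𝓡 hμ v]
  rw [dunklEuler_eq_sum, Finset.sum_comm]
  simp only [bil_comm v, bil_single_left, sum_polyDunkl_single]
  congr 1
  refine Finset.sum_congr rfl fun β _ => ?_
  rw [← sum_polyDunkl_single (toPhase β), map_sum, Finset.smul_sum]
  refine Finset.sum_congr rfl fun i _ => ?_
  rw [map_smul, smul_smul, bil_comm (toPhase β) (EuclideanSpace.single i 1), bil_single_left]

end polyDunkl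

end

/-! ### Inverting `dunklEuler` on homogeneous polynomials -/

section

open MvPolynomial

variable {N : ℕ} {𝓡 : Finset (ConfigSpace N)} {μ : ConfigSpace N → ℝ}

theorem isHomogeneous_linForm (v : PhaseSpace N) : (linForm v).IsHomogeneous 1 :=
  IsHomogeneous.sum _ _ _ fun i _ => by
    simpa using (isHomogeneous_C (Fin N) (v i)).mul (isHomogeneous_X ℂ i)

theorem isHomogeneous_polyRefl (α : ConfigSpace N) {p : MvPolynomial (Fin N) ℂ} {n : ℕ}
    (hp : p.IsHomogeneous n) : (polyRefl α p).IsHomogeneous n := by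
  have := hp.aeval (g := fun i => X i - C (toPhase α i) * linForm (toPhase α)) (n := 1) fun i =>
    (isHomogeneous_X ℂ i).sub (by
      simpa using (isHomogeneous_C (Fin N) (toPhase α i)).mul (isHomogeneous_linForm (toPhase α)))
  rwa [one_mul] at this

/-- On homogeneous polynomials of degree `n`, `dunklEuler` is bounded below by `n`. -/
theorem mul_norm_eval_le (h𝓡 : IsRootSystem 𝓡) (hμ : IsMultiplicity 𝓡 μ)
    {p : MvPolynomial (Fin N) ℂ} {n : ℕ} (hn : 0 < n) (hp : p.IsHomogeneous n) {r B : ℝ}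
    (h : ∀ x : PhaseSpace N, ‖x‖ ≤ r → ‖eval x.ofLp (dunklEuler 𝓡 μ p)‖ ≤ B) (x : PhaseSpace N)
    (hx : ‖x‖ ≤ r) : n * ‖eval x.ofLp p‖ ≤ B := by
  have hc : Continuous fun x : PhaseSpace N => eval x.ofLp p :=
    (MvPolynomial.continuous_eval p).comp (PiLp.continuous_ofLp 2 _)
  refine mul_norm_le_of_mul_add_sum_sub_le (isCompact_closedBall (0 : PhaseSpace N) r)
    hc.continuousOn 𝓡 (c := fun α => μ α / 2)
    (fun α hα => div_nonneg (hμ.nonneg α hα) zero_le_two) (σ := phaseRefl) (fun α hα x hx => ?_)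
    (Nat.cast_pos.mpr hn) (fun x hx => ?_) x (mem_closedBall_zero_iff.mpr hx)
  · rw [mem_closedBall_zero_iff] at *
    rwa [norm_phaseRefl (h𝓡.norm_sq α hα)]
  · convert h x (mem_closedBall_zero_iff.mp hx) using 2
    rw [dunklEuler_apply, polyEuler_of_isHomogeneous hp, map_add, map_sum]
    simp [smul_eval]

/-- `dunklEuler` has a linear right inverse in every positive degree. -/
theorem exists_rightInverse_dunklEuler (h𝓡 : IsRootSystem 𝓡) (hμ : IsMultiplicity 𝓡 μ) {n : ℕ}
    (hn : 0 < n) : ∃ S : MvPolynomial (Fin N) ℂ →ₗ[ℂ] MvPolynomial (Fin N) ℂ,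
      ∀ p, p.IsHomogeneous n → (S p).IsHomogeneous n ∧ dunklEuler 𝓡 μ (S p) = p := by
  have hmaps : ∀ p ∈ homogeneousSubmodule (Fin N) ℂ n,
      dunklEuler 𝓡 μ p ∈ homogeneousSubmodule (Fin N) ℂ n := by
    intro p hp
    rw [dunklEuler_apply, polyEuler_of_isHomogeneous hp]
    exact Submodule.add_mem _ (Submodule.smul_mem _ _ hp) (Submodule.sum_mem _ fun α _ =>
      Submodule.smul_mem _ _ (Submodule.sub_mem _ hp (isHomogeneous_polyRefl α hp)))
  have hfin : FiniteDimensional ℂ (homogeneousSubmodule (Fin N) ℂ n) :=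
    Module.Finite.iff_fg.mpr (homogeneousSubmodule_fg _ _ n)
  -- The maximum principle with `B = 0` gives injectivity, hence bijectivity on the
  -- finite-dimensional space of forms of degree `n`.
  have hinj : Function.Injective ((dunklEuler 𝓡 μ).restrict hmaps) := by
    rw [← LinearMap.ker_eq_bot, LinearMap.ker_eq_bot']
    rintro ⟨p, hp⟩ h
    have h0 : dunklEuler 𝓡 μ p = 0 := congrArg Subtype.val h
    refine Subtype.ext (poly_ext fun x => ?_)
    have := mul_norm_eval_le h𝓡 hμ hn hp (r := ‖x‖) (B := 0) (fun y _ => by simp [h0]) x le_rfl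
    have h1 : (0 : ℝ) < n := Nat.cast_pos.mpr hn
    have h2 : ‖eval x.ofLp p‖ ≤ 0 := by
      by_contra! h3
      exact absurd this (not_le.mpr (mul_pos h1 h3))
    simpa using h2
  let e := LinearEquiv.ofInjectiveEndo _ hinj
  obtain ⟨S, hS⟩ := ((homogeneousSubmodule (Fin N) ℂ n).subtype ∘ₗ e.symm.toLinearMap).exists_extend
  refine ⟨S, fun p hp => ?_⟩
  have hSp : S p = e.symm ⟨p, hp⟩ := LinearMap.congr_fun hS ⟨p, hp⟩
  rw [hSp]
  exact ⟨(e.symm ⟨p, hp⟩).2, congrArg Subtype.val (e.apply_symm_apply ⟨p, hp⟩)⟩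

theorem polyEuler_polyDeriv (v : PhaseSpace N) (p : MvPolynomial (Fin N) ℂ) :
    polyEuler (polyDeriv v p) = polyDeriv v (polyEuler p) - polyDeriv v p := by
  have h : ⁅(polyEuler : Derivation ℂ (MvPolynomial (Fin N) ℂ) _), polyDeriv v⁆ = -polyDeriv v :=
    MvPolynomial.derivation_ext fun i => by
      simp [Derivation.commutator_apply, polyEuler]
  have := congrArg (fun d => d p) h
  rw [Derivation.commutator_apply, Derivation.neg_apply] at this
  rw [sub_eq_iff_eq_add.mp this]
  ring

/-- Applying the Euler field to the defining relation of the quotient gives its degree, without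
inspecting the quotient, in the form of an Euler eigenvalue. -/
theorem polyEuler_divDiff {α : ConfigSpace N} (hα : ‖α‖ ^ 2 = 2) {p : MvPolynomial (Fin N) ℂ}
    {n : ℕ} (hp : p.IsHomogeneous (n + 1)) : polyEuler (divDiff α p) = (n : ℂ) • divDiff α p := by
  refine mul_left_cancel₀ (linForm_ne_zero hα) ?_
  have h := congrArg polyEuler (linForm_mul_divDiff α p)
  rw [polyEuler_of_isHomogeneous (hp.sub (isHomogeneous_polyRefl α hp)), ← linForm_mul_divDiff,
    Derivation.leibniz, polyEuler_linForm, smul_eq_mul, smul_eq_mul] at h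
  rw [eq_sub_of_add_eq h, smul_eq_C_mul, smul_eq_C_mul]
  push_cast
  rw [map_add, map_one]
  ring

theorem polyEuler_polyDunkl (h𝓡 : IsRootSystem 𝓡) (v : PhaseSpace N)
    {p : MvPolynomial (Fin N) ℂ} {n : ℕ} (hp : p.IsHomogeneous (n + 1)) :
    polyEuler (polyDunkl 𝓡 μ v p) = (n : ℂ) • polyDunkl 𝓡 μ v p := by
  rw [polyDunkl, map_add, map_sum, smul_add, Finset.smul_sum, polyEuler_polyDeriv,
    polyEuler_of_isHomogeneous hp, Derivation.map_smul]
  congr 1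
  · push_cast
    module
  · refine Finset.sum_congr rfl fun α hα => ?_
    rw [Derivation.map_smul, polyEuler_divDiff (h𝓡.norm_sq α hα) hp, smul_comm]

end

/-! ### The power series of the Dunkl kernel -/

section

open MvPolynomial

variable {N : ℕ} {𝓡 : Finset (ConfigSpace N)} {μ : ConfigSpace N → ℝ}

/-- A sequence of homogeneous polynomials that solves the Euler equation of the Dunkl kernel
`E · y` degree by degree. -/
structure IsDunklSeries (𝓡 : Finset (ConfigSpace N)) (μ : ConfigSpace N → ℝ) (y : PhaseSpace N)
    (f : ℕ → MvPolynomial (Fin N) ℂ) : Prop where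
  zero : f 0 = 1
  isHomogeneous : ∀ n, (f n).IsHomogeneous n
  dunklEuler_succ : ∀ n, dunklEuler 𝓡 μ (f (n + 1)) = linForm y * f n

/-- Each term is obtained by applying the right inverse in the next degree. That inverse is linear,
so the terms are finite combinations of fixed polynomials with coefficients entire in `y`; this
later gives joint holomorphy. -/
theorem exists_isDunklSeries (h𝓡 : IsRootSystem 𝓡) (hμ : IsMultiplicity 𝓡 μ) :
    ∃ f : ℕ → PhaseSpace N → MvPolynomial (Fin N) ℂ,
      (∀ y, IsDunklSeries 𝓡 μ y fun n => f n y) ∧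
      ∀ n, ∃ (ι : Type) (_ : Fintype ι) (q : ι → PhaseSpace N → ℂ)
        (p : ι → MvPolynomial (Fin N) ℂ), (∀ i, Differentiable ℂ (q i)) ∧
          ∀ y, f n y = ∑ i, q i y • p i := by
  choose S hS using fun n : ℕ => exists_rightInverse_dunklEuler h𝓡 hμ n.succ_pos
  let f : ℕ → PhaseSpace N → MvPolynomial (Fin N) ℂ :=
    Nat.rec (fun _ => 1) fun n g y => S n (linForm y * g y)
  have hf : ∀ n y, (f n y).IsHomogeneous n := by
    intro n y
    induction n with
    | zero => exact isHomogeneous_one _ _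
    | succ n ih =>
      refine (hS n _ ?_).1
      rw [Nat.succ_eq_add_one, add_comm]
      exact (isHomogeneous_linForm y).mul ih
  refine ⟨f, fun y => ⟨rfl, fun n => hf n y, fun n => (hS n _ ?_).2⟩, fun n => ?_⟩
  · rw [Nat.succ_eq_add_one, add_comm]
    exact (isHomogeneous_linForm y).mul (hf n y)
  · induction n with
    | zero => exact ⟨Unit, inferInstance, fun _ _ => 1, fun _ => 1,
        fun _ => differentiable_const _, fun y => by simp [f]⟩
    | succ n ih =>
      obtain ⟨ι, _, q, p, hq, h⟩ := ih
      refine ⟨Fin N × ι, inferInstance, fun k y => y k.1 * q k.2 y, fun k => S n (X k.1 * p k.2),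
        fun k => ?_, fun y => ?_⟩
      · have := hq k.2
        fun_prop
      · change S n (linForm y * f n y) = _
        rw [h, linForm, Finset.sum_mul_sum, map_sum, Fintype.sum_prod_type]
        refine Finset.sum_congr rfl fun i _ => ?_
        rw [map_sum]
        refine Finset.sum_congr rfl fun j _ => ?_
        rw [← map_smul]
        congr 1
        rw [smul_eq_C_mul, smul_eq_C_mul, map_mul]
        ring

namespace IsDunklSeries

variable {y : PhaseSpace N} {f : ℕ → MvPolynomial (Fin N) ℂ}

theorem polyDunkl_zero (h𝓡 : IsRootSystem 𝓡) (h : IsDunklSeries 𝓡 μ y f) (v : PhaseSpace N) :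
    polyDunkl 𝓡 μ v (f 0) = 0 := by
  rw [h.zero, ← map_one C, polyDunkl_C h𝓡]

/-- In degree `n + 1` the maximum principle gains a factor `1 / (n + 1)`, which builds up the
factorial. The induction is over a whole ball of fixed radius, since the principle uses bounds
there. -/
theorem norm_eval_le (h𝓡 : IsRootSystem 𝓡) (hμ : IsMultiplicity 𝓡 μ)
    (h : IsDunklSeries 𝓡 μ y f) (n : ℕ) (x : PhaseSpace N) :
    ‖eval x.ofLp (f n)‖ ≤ (‖x‖ * ‖y‖) ^ n / n.factorial := by
  suffices H : ∀ r, ∀ x : PhaseSpace N, ‖x‖ ≤ r →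
      ‖eval x.ofLp (f n)‖ ≤ (r * ‖y‖) ^ n / n.factorial from H _ x le_rfl
  intro r
  induction n with
  | zero => intro x _; simp [h.zero]
  | succ n ih =>
    intro x hx
    have := mul_norm_eval_le h𝓡 hμ n.succ_pos (h.isHomogeneous (n + 1)) (r := r)
      (B := r * ‖y‖ * ((r * ‖y‖) ^ n / n.factorial)) (fun z hz => ?_) x hx
    · rw [Nat.factorial_succ, le_div_iff₀ (by positivity)]
      rw [← mul_div_assoc, le_div_iff₀ (by positivity)] at this
      push_cast at this ⊢
      rw [pow_succ]
      linarith
    · rw [h.dunklEuler_succ, map_mul, norm_mul, eval_linForm]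
      have hr : 0 ≤ r := (norm_nonneg z).trans hz
      refine mul_le_mul ((norm_bil_le y z).trans ?_) (ih z hz) (norm_nonneg _) (by positivity)
      rw [mul_comm]
      gcongr

/-- Let `g v` be the defect of the eigenvalue equation in direction `v`. Applying `T_v` to the
radial equation gives a homogeneous equation for `g`, in which the reflections act simultaneously on
the point and on `v`; the maximum principle on a product of balls forces `g = 0`. -/
theorem polyDunkl_succ_of_linForm_mul (h𝓡 : IsRootSystem 𝓡) (hμ : IsMultiplicity 𝓡 μ)
    (h : IsDunklSeries 𝓡 μ y f) {n : ℕ}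
    (hn : ∀ v, linForm y * polyDunkl 𝓡 μ v (f n) = bil v y • dunklEuler 𝓡 μ (f n))
    (v : PhaseSpace N) : polyDunkl 𝓡 μ v (f (n + 1)) = bil v y • f n := by
  set g : PhaseSpace N → MvPolynomial (Fin N) ℂ :=
    fun v => polyDunkl 𝓡 μ v (f (n + 1)) - bil v y • f n with hg
  have hgE : ∀ v, polyEuler (g v) = (n : ℂ) • g v := fun v => by
    simp only [hg]
    rw [map_sub, Derivation.map_smul, polyEuler_polyDunkl h𝓡 v (h.isHomogeneous (n + 1)),
      polyEuler_of_isHomogeneous (h.isHomogeneous n), smul_sub, smul_comm (n : ℂ)]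
  have hgσ : ∀ β v, g (phaseRefl β v) = g v - bil (toPhase β) v • g (toPhase β) := fun β v => by
    simp only [hg]
    rw [polyDunkl_phaseRefl, phaseRefl, bil_sub_left, bil_smul_left]
    module
  have hgD : ∀ v, dunklEuler 𝓡 μ (g v) + g v +
      ∑ β ∈ 𝓡, (((μ β / 2 : ℝ) : ℂ) * bil (toPhase β) v) • polyRefl β (g (toPhase β)) = 0 := by
    intro v
    have h1 := polyDunkl_dunklEuler h𝓡 hμ v (f (n + 1))
    rw [h.dunklEuler_succ, polyDunkl_linForm_mul h𝓡, hn] at h1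
    simp only [hg, map_sub, map_smul, smul_sub, smul_smul, Finset.sum_sub_distrib]
    linear_combination (exp := 1) -h1
  -- The factor `n + 1` is the Euler eigenvalue `n` plus the extra `g v` from the commutator. It is
  -- positive also for `n = 0`.
  have hgF : ∀ v, ((n + 1 : ℝ) : ℂ) • g v +
      ∑ β ∈ 𝓡, ((μ β / 2 : ℝ) : ℂ) • (g v - polyRefl β (g (phaseRefl β v))) = 0 := by
    intro v
    rw [← hgD v, dunklEuler_apply, hgE, add_assoc (_ + _) (g v), add_add_add_comm, ← Finset.sum_add_distrib]
    congr 1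
    · push_cast
      module
    · refine Finset.sum_congr rfl fun β _ => ?_
      rw [hgσ, map_sub, map_smul]
      module
  have hc : Continuous fun p : PhaseSpace N × PhaseSpace N => eval p.1.ofLp (g p.2) := by
    have he : ∀ q : MvPolynomial (Fin N) ℂ, Continuous fun x : PhaseSpace N => eval x.ofLp q :=
      fun q => (MvPolynomial.continuous_eval q).comp (PiLp.continuous_ofLp 2 _)
    have e : (fun p : PhaseSpace N × PhaseSpace N => eval p.1.ofLp (g p.2)) = fun p =>
        ∑ i, p.2 i * eval p.1.ofLp (polyDunkl 𝓡 μ (EuclideanSpace.single i 1) (f (n + 1))) -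
          bil p.2 y * eval p.1.ofLp (f n) := by
      funext p
      simp only [hg]
      rw [← sum_polyDunkl_single, map_sub, map_sum]
      simp only [smul_eval]
    rw [e]
    refine (continuous_finsetSum _ fun i _ => ?_).sub ?_
    · exact Continuous.mul (by fun_prop) ((he _).comp continuous_fst)
    · exact ((differentiable_bil_right y).continuous.comp continuous_snd |>.congr
        fun p => bil_comm _ _).mul ((he _).comp continuous_fst)
  refine sub_eq_zero.mp (poly_ext fun x => ?_)
  have := mul_norm_le_of_mul_add_sum_sub_le (n := n + 1) (B := 0)
    ((isCompact_closedBall (0 : PhaseSpace N) ‖x‖).prod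
      (isCompact_closedBall (0 : PhaseSpace N) ‖v‖)) hc.continuousOn 𝓡 (c := fun α => μ α / 2)
    (fun α hα => div_nonneg (hμ.nonneg α hα) zero_le_two)
    (σ := fun α p => (phaseRefl α p.1, phaseRefl α p.2)) (fun α hα p hp => ?_) (by positivity)
    (fun p _ => ?_) (x, v) (by simp)
  · have h1 : ‖eval x.ofLp (g v)‖ ≤ 0 := by
      by_contra! h2
      exact absurd this (not_le.mpr (by positivity))
    exact (norm_le_zero_iff.mp h1).trans (map_zero _).symm
  · simpa [norm_phaseRefl (h𝓡.norm_sq α hα)] using hp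
  · have h1 := congrArg (eval p.1.ofLp) (hgF p.2)
    rw [map_add, map_sum, smul_eval, map_zero] at h1
    simp only [smul_eval, map_sub, eval_polyRefl] at h1
    rw [h1, norm_zero]

/-- The eigenvalue equations, degree by degree. -/
theorem polyDunkl_succ (h𝓡 : IsRootSystem 𝓡) (hμ : IsMultiplicity 𝓡 μ)
    (h : IsDunklSeries 𝓡 μ y f) (n : ℕ) (v : PhaseSpace N) :
    polyDunkl 𝓡 μ v (f (n + 1)) = bil v y • f n := by
  induction n generalizing v with
  | zero =>
    refine h.polyDunkl_succ_of_linForm_mul h𝓡 hμ (fun v => ?_) v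
    rw [h.polyDunkl_zero h𝓡, mul_zero, dunklEuler_apply,
      polyEuler_of_isHomogeneous (h.isHomogeneous 0), h.zero]
    simp
  | succ n ih =>
    refine h.polyDunkl_succ_of_linForm_mul h𝓡 hμ (fun v => ?_) v
    rw [ih, h.dunklEuler_succ, mul_smul_comm]

end IsDunklSeries

end

section

/-! ### Existence of the Dunkl kernel -/

/-- Locally normally convergent series of entire functions can be differentiated termwise. -/
theorem hasFDerivAt_tsum_of_bound {V : Type*} [NormedAddCommGroup V] [NormedSpace ℂ V]
    {F : ℕ → V → ℂ} (hF : ∀ n, Differentiable ℂ (F n))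
    (hb : ∀ R, ∃ u : ℕ → ℝ, Summable u ∧ ∀ n x, ‖x‖ ≤ R → ‖F n x‖ ≤ u n) (x : V) :
    Summable (fun n => fderiv ℂ (F n) x) ∧
      HasFDerivAt (fun x => ∑' n, F n x) (∑' n, fderiv ℂ (F n) x) x := by
  -- Termwise differentiation takes place on the ball of radius `‖x‖ + 1`, and Cauchy's estimate
  -- needs one more unit.
  obtain ⟨u, hu, h⟩ := hb (‖x‖ + 2)
  have hx : x ∈ Metric.ball (0 : V) (‖x‖ + 1) := by simp
  have hd : ∀ n, ∀ z ∈ Metric.ball (0 : V) (‖x‖ + 1), ‖fderiv ℂ (F n) z‖ ≤ u n := by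
    intro n z hz
    rw [mem_ball_zero_iff] at hz
    exact norm_fderiv_le_of_forall_closedBall (hF n) fun w hw => h n w (by linarith)
  refine ⟨Summable.of_norm_bounded hu fun n => hd n x hx, ?_⟩
  exact hasFDerivAt_tsum_of_isPreconnected hu Metric.isOpen_ball
    (convex_ball (0 : V) _).isPreconnected (fun n z _ => (hF n z).hasFDerivAt) hd hx
    (Summable.of_norm_bounded hu fun n => h n x (by linarith)) hx

open MvPolynomial

variable {N : ℕ} {𝓡 : Finset (ConfigSpace N)} {μ : ConfigSpace N → ℝ}

theorem differentiable_eval (p : MvPolynomial (Fin N) ℂ) :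
    Differentiable ℂ fun x : PhaseSpace N => eval x.ofLp p := by
  induction p using MvPolynomial.induction_on with
  | C a => simp
  | add p q hp hq =>
    simp only [map_add]
    exact hp.fun_add hq
  | mul_X p i hp =>
    simp only [map_mul, eval_X]
    exact hp.mul (by fun_prop)

theorem fderiv_eval (p : MvPolynomial (Fin N) ℂ) (x v : PhaseSpace N) :
    fderiv ℂ (fun x : PhaseSpace N => eval x.ofLp p) x v = eval x.ofLp (polyDeriv v p) := by
  induction p using MvPolynomial.induction_on with
  | C a => simp
  | add p q hp hq =>
    simp only [map_add]
    rw [fderiv_fun_add (differentiable_eval p x) (differentiable_eval q x), add_apply, hp, hq]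
  | mul_X p i hp =>
    have h : HasFDerivAt (fun x : PhaseSpace N => x i)
        (EuclideanSpace.proj i : PhaseSpace N →L[ℂ] ℂ) x :=
      (EuclideanSpace.proj i : PhaseSpace N →L[ℂ] ℂ).hasFDerivAt
    have h2 := ((differentiable_eval p x).hasFDerivAt.mul h).fderiv
    rw [show (fun x : PhaseSpace N => eval x.ofLp (p * X i)) =
      (fun x : PhaseSpace N => eval x.ofLp p) * fun x => x i by funext x; simp, h2]
    simp [Derivation.leibniz, hp]

/-- Off the hyperplane the defining relation of `divDiff` is divided by the linear form. On it, the
relation is differentiated along `α`: the linear form has derivative `2` and `σ_α α = -α`, so both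
sides are twice the desired ones. -/
theorem diffQuot_eval {α : ConfigSpace N} (hα : ‖α‖ ^ 2 = 2) (p : MvPolynomial (Fin N) ℂ)
    (x : ConfigSpace N) : diffQuot α (fun x => eval (toPhase x).ofLp p) x =
      eval (toPhase x).ofLp (divDiff α p) := by
  have h := linForm_mul_divDiff α p
  have hx := eval_linForm (toPhase x) (toPhase α)
  rw [bil_toPhase] at hx
  unfold diffQuot
  split_ifs with h0
  · rw [fderiv_comp_toPhase (differentiable_eval p), fderiv_eval]
    have hrx : phaseRefl α (toPhase x) = toPhase x := by
      rw [phaseRefl, bil_toPhase, h0, Complex.ofReal_zero, zero_smul, sub_zero]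
    have hr : phaseRefl α (toPhase α) = (-1 : ℂ) • toPhase α := by
      rw [phaseRefl, bil_toPhase, real_inner_self_eq_norm_sq, hα]
      module
    have h1 := congrArg (fun q => eval (toPhase x).ofLp (polyDeriv (toPhase α) q)) h
    simp only [Derivation.leibniz, map_sub, map_add, smul_eq_mul, map_mul, hx, h0,
      polyDeriv_polyRefl, eval_polyRefl, hrx, hr,
      polyDeriv_smul_left, polyDeriv_linForm, bil_toPhase, real_inner_self_eq_norm_sq, hα,
      smul_eval, eval_C] at h1
    simp only [Complex.ofReal_zero, zero_mul] at h1
    push_cast at h1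
    linear_combination -h1 / 2
  · have h1 := congrArg (eval (toPhase x).ofLp) h
    rw [map_mul, hx, map_sub, eval_polyRefl, ← toPhase_refl hα] at h1
    have h2 : (⟪α, x⟫ : ℂ) ≠ 0 := by exact_mod_cast h0
    rw [← h1, mul_div_cancel_left₀ _ h2]

theorem dunklOp_eval (h𝓡 : IsRootSystem 𝓡) (ξ : ConfigSpace N) (p : MvPolynomial (Fin N) ℂ)
    (x : ConfigSpace N) : dunklOp 𝓡 μ ξ (fun x => eval (toPhase x).ofLp p) x =
      eval (toPhase x).ofLp (polyDunkl 𝓡 μ (toPhase ξ) p) := by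
  rw [dunklOp, polyDunkl, fderiv_comp_toPhase (differentiable_eval p), fderiv_eval, map_add,
    map_sum, Finset.mul_sum]
  congr 1
  refine Finset.sum_congr rfl fun α hα => ?_
  rw [diffQuot_eval (h𝓡.norm_sq α hα), smul_eval, bil_toPhase]
  push_cast
  ring

theorem hasSum_dunklOp {F : ℕ → PhaseSpace N → ℂ} (hF : ∀ n, Differentiable ℂ (F n))
    (hb : ∀ R, ∃ u : ℕ → ℝ, Summable u ∧ ∀ n x, ‖x‖ ≤ R → ‖F n x‖ ≤ u n) (ξ x : ConfigSpace N) :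
    HasSum (fun n => dunklOp 𝓡 μ ξ (fun x => F n (toPhase x)) x)
      (dunklOp 𝓡 μ ξ (fun x => ∑' n, F n (toPhase x)) x) := by
  have hd : Differentiable ℂ fun x => ∑' n, F n x := fun x =>
    (hasFDerivAt_tsum_of_bound hF hb x).2.differentiableAt
  have h1 : ∀ x v : ConfigSpace N, HasSum (fun n => fderiv ℝ (fun x => F n (toPhase x)) x v)
      (fderiv ℝ (fun x => ∑' n, F n (toPhase x)) x v) := by
    intro x v
    obtain ⟨hs, hf⟩ := hasFDerivAt_tsum_of_bound hF hb (toPhase x)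
    rw [fderiv_comp_toPhase hd, hf.fderiv]
    simp only [fderiv_comp_toPhase (hF _)]
    exact hs.hasSum.mapL (ContinuousLinearMap.apply ℂ ℂ (toPhase v))
  have h2 : ∀ x : PhaseSpace N, HasSum (fun n => F n x) (∑' n, F n x) := by
    intro x
    obtain ⟨u, hu, h⟩ := hb ‖x‖
    exact (Summable.of_norm_bounded hu fun n => h n x le_rfl).hasSum
  have h3 : ∀ α : ConfigSpace N, HasSum (fun n => diffQuot α (fun x => F n (toPhase x)) x)
      (diffQuot α (fun x => ∑' n, F n (toPhase x)) x) := by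
    intro α
    unfold diffQuot
    split_ifs
    · exact h1 x α
    · exact ((h2 _).sub (h2 _)).div_const _
  exact (h1 x ξ).add ((hasSum_sum fun α _ => (h3 α).mul_left _).mul_left _)

/-- The Dunkl kernel exists for non-negative multiplicities. -/
theorem exists_isDunklKernel (h𝓡 : IsRootSystem 𝓡) (hμ : IsMultiplicity 𝓡 μ) :
    ∃ E, IsDunklKernel 𝓡 μ E := by
  obtain ⟨f, hf, hq⟩ := exists_isDunklSeries h𝓡 hμ
  have hbound : ∀ (n : ℕ) (R : ℝ) (x y : PhaseSpace N), ‖x‖ ≤ R → ‖y‖ ≤ R →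
      ‖eval x.ofLp (f n y)‖ ≤ (R * R) ^ n / n.factorial := fun n R x y hx hy => by
    refine ((hf y).norm_eval_le h𝓡 hμ n x).trans ?_
    have := (norm_nonneg x).trans hx
    gcongr
  have hsum : ∀ R : ℝ, Summable fun n : ℕ => (R * R) ^ n / (n.factorial : ℝ) := fun R =>
    Real.summable_pow_div_factorial _
  refine ⟨fun x y => ∑' n, eval x.ofLp (f n y), ⟨fun p => ?_, fun ξ x y => ?_, fun y => ?_⟩⟩
  · refine (hasFDerivAt_tsum_of_bound (V := PhaseSpace N × PhaseSpace N)
      (F := fun n p => eval p.1.ofLp (f n p.2)) (fun n => ?_) (fun R => ⟨_, hsum R, fun n p hp =>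
        hbound n R _ _ ((norm_fst_le p).trans hp) ((norm_snd_le p).trans hp)⟩) p).2.differentiableAt
    obtain ⟨ι, _, q, c, hqd, h⟩ := hq n
    simp only [h, map_sum, smul_eval]
    exact Differentiable.fun_sum fun i _ => ((hqd i).comp differentiable_snd).mul
      ((differentiable_eval _).comp differentiable_fst)
  · have h := hasSum_dunklOp (𝓡 := 𝓡) (μ := μ)
      (F := fun n (x : PhaseSpace N) => eval x.ofLp (f n (toPhase y)))
      (fun n => differentiable_eval _) (fun R => ⟨_, hsum (max R ‖y‖), fun n x hx =>
        hbound n _ _ _ (hx.trans (le_max_left _ _))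
          ((norm_toPhase y).le.trans (le_max_right _ _))⟩) ξ x
    simp only [dunklOp_eval h𝓡] at h
    -- A Dunkl operator kills the constant term and lowers the index of the others by one, so the
    -- series reproduces itself after a shift.
    rw [← h.tsum_eq, h.summable.tsum_eq_zero_add, (hf _).polyDunkl_zero h𝓡, map_zero, zero_add,
      ← tsum_mul_left]
    refine tsum_congr fun n => ?_
    rw [(hf _).polyDunkl_succ h𝓡 hμ, smul_eval, bil_toPhase]
  · rw [tsum_eq_single 0]
    · rw [(hf _).zero, map_one]
    · intro n hn
      have := (hf (toPhase y)).norm_eval_le h𝓡 hμ n 0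
      simpa [hn] using this

theorem isDunklKernel_dunklKernel (h𝓡 : IsRootSystem 𝓡) (hμ : IsMultiplicity 𝓡 μ) :
    IsDunklKernel 𝓡 μ (dunklKernel 𝓡 μ) := by
  have h := exists_isDunklKernel h𝓡 hμ
  rw [dunklKernel, dif_pos h]
  exact h.choose_spec

end

end Dunkl

theorem mainTheorem7 {N : ℕ} (hN : 1 ≤ N) (𝓡 : Finset (Dunkl.ConfigSpace N))
    (h𝓡 : Dunkl.IsRootSystem 𝓡) (μ : Dunkl.ConfigSpace N → ℝ) (hμ : Dunkl.IsMultiplicity 𝓡 μ) :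
    ∃ _ : Fact (Dunkl.sbKernel 𝓡 μ 1).PosSemidef,
    ∃ (R : Lp ℂ 2 (Dunkl.measureTilde 𝓡 μ 1) ≃ₗᵢ[ℂ] Lp ℂ 2 (Dunkl.measureOmega 𝓡 μ (1 / 4)))
      (δ : Lp ℂ 2 (Dunkl.measureOmega 𝓡 μ (1 / 4)) ≃ₗᵢ[ℂ] Lp ℂ 2 (Dunkl.measureOmega 𝓡 μ 1))
      (A : Lp ℂ 2 (Dunkl.measureOmega 𝓡 μ 1) →L[ℂ] Dunkl.SegalBargmannSpace 𝓡 μ 1)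
      (BSO : Lp ℂ 2 (Dunkl.measureTilde 𝓡 μ 1) →L[ℂ] Dunkl.SegalBargmannSpace 𝓡 μ 1),
      (∀ φ, R φ =ᵐ[Dunkl.measureOmega 𝓡 μ (1 / 4)] Dunkl.rescaling 𝓡 μ φ) ∧
      (∀ ψ, δ ψ =ᵐ[Dunkl.measureOmega 𝓡 μ 1] Dunkl.dilation (1 / 2) ψ) ∧
      (∀ ψ z, Integrable (fun q => Dunkl.kernelA 𝓡 μ 1 z q * ψ q) (Dunkl.measureOmega 𝓡 μ 1) ∧
        A ψ z = Dunkl.transformA 𝓡 μ 1 ψ z) ∧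
      (∀ φ z, Integrable (fun y => Dunkl.kernelBSO 𝓡 μ z y * φ y) (Dunkl.measureTilde 𝓡 μ 1) ∧
        BSO φ z = Dunkl.transformBSO 𝓡 μ φ z) ∧
      ∀ φ, BSO φ = A (δ (R φ)) := by
  exact Dunkl.exists_transforms h𝓡 hμ (Dunkl.isDunklKernel_dunklKernel h𝓡 hμ)
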